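/- Let $\mathfrak K$ be a finite-dimensional complex Hilbert space and $\mathfrak H=\mathfrak K\otimes L^2(0,\infty)=L^2((0,\infty);\mathfrak K)$. For $A\in\mathfrak B(\mathfrak K)$ put $(\Lambda(A)f)(x)=e^{-x}Af(x)$, write $\Lambda=\Lambda(I)$, let $E(t,\infty)$ be the projection of $\mathfrak H$ onto the functions supported in $(t,\infty)$, and let $\mathfrak A(\mathfrak H)=(I-\Lambda)^{1/2}\mathfrak B(\mathfrak H)(I-\Lambda)^{1/2}$. A boundary weight is a linear functional $\mu$ on $\mathfrak A(\mathfrak H)$ such that $B\mapsto\mu((I-\Lambda)^{1/2}B(I-\Lambda)^{1/2})$ is a normal functional on $\mathfrak B(\mathfrak H)$; $\mathfrak A(\mathfrak H)_*$ is the space of boundary weights. For a linear map $\omega:\mathfrak B(\mathfrak K)_*\to\mathfrak A(\mathfrak H)_*$ let $\breve\omega:\mathfrak A(\mathfrak H)\to\mathfrak B(\mathfrak K)$ be its dual, $\rho(\breve\omega(A))=\omega(\rho)(A)$; the range rank of $\omega$ is $\dim\operatorname{range}\breve\omega$. Put $\omega|_t(\rho)(A)=\omega(\rho)(E(t,\infty)AE(t,\infty))$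 for $A\in\mathfrak B(\mathfrak H)$ and $\hat\Lambda(\phi)=\phi\circ\Lambda$. The map $\omega$ is a $q$-weight map if it is completely positive, $\omega(\rho)(I-\Lambda)\le\rho(I)$ for all positive $\rho$, and for every $t>0$ the map $I+\hat\Lambda\,\omega|_t$ is invertible and $\omega|_t(I+\hat\Lambda\,\omega|_t)^{-1}$ is a completely positive contraction, whose dual is denoted $\pi_t^{\#}:\mathfrak B(\mathfrak H)\to\mathfrak B(\mathfrak K)$. For $q$-weight maps write $\eta\le_q\omega$ if the difference $\pi^\#_t-\xi^\#_t$ of the corresponding maps of $\omega$ and $\eta$ is completely positive for all $t>0$; $\omega$ is $q$-pure if the set of $q$-weight maps $\eta\le_q\omega$ is totally ordered by $\le_q$. Two $q$-weight maps $\omega,\eta$ are completely orthogonal with respect to projections $E_1,E_2\in\mathfrak B(\mathfrak K)$ with $E_1E_2=0$ if, with $\psi_{ij}(\rho)(A)=\rho(E_iAE_j)$, one has $\omega(\rho)(A)=\omega(\psi_{11}(\rho))((E_1\otimes I)A(E_1\otimes I))$ and $\eta(\rho)(A)=\eta(\psi_{22}(\rho))((E_2\otimes I)A(E_2\otimes I))$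 for all $\rho,A$. In that case a $q$-corner from $\omega$ to $\eta$ is a linear map $\gamma:\mathfrak B(\mathfrak K)_*\to\mathfrak A(\mathfrak H)_*$ with $\gamma(\rho)(A)=\gamma(\psi_{12}(\rho))((E_1\otimes I)A(E_2\otimes I))$ for all $\rho,A$ such that $\omega+\gamma+\gamma^*+\eta$ is a $q$-weight map, where $\gamma^*(\rho)(A)=\overline{\gamma(\rho^*)(A^*)}$ and $\rho^*(X)=\overline{\rho(X^*)}$. **Theorem.** Let $\omega$ and $\eta$ be $q$-pure $q$-weight maps over $\mathfrak K$ of range rank one that are completely orthogonal with respect to $E_1,E_2$, and let $\omega(\rho)(A)=\rho(T_1)\mu(A)$ and $\eta(\rho)(A)=\rho(T_2)\nu(A)$ for all $\rho\in\mathfrak B(\mathfrak K)_*$, $A\in\mathfrak A(\mathfrak H)$, where $T_1,T_2\in\mathfrak B(\mathfrak K)$ are non-zero projections and $\mu,\nu\in\mathfrak A(\mathfrak H)_*$. (a) There is a non-zero $q$-corner of range rank one from $\omega$ to $\eta$ if and only if there are a unitary $U\in\mathfrak B(\mathfrak K)$ with $UT_1U^*=T_2$, a number $z>0$, and countable families $(f_k),(g_k),(h_k)$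 in $\mathfrak H$ such that, for all $A\in\mathfrak A(\mathfrak H)$, $$\mu(A)=\sum_k(f_k,(I-\Lambda)^{-1/2}A(I-\Lambda)^{-1/2}f_k),\qquad \nu(A)=\sum_k(g_k,(I-\Lambda)^{-1/2}A(I-\Lambda)^{-1/2}g_k),$$ and $g_k=z(U\otimes I)f_k+h_k$ for all $k$, with $h_k$ in the range of $(I-\Lambda)^{1/2}$ and $$\sum_k\|(I-\Lambda)^{-1/2}h_k\|^2<\infty .$$ (b) If $\omega$ and $\eta$ are moreover completely orthogonal with respect to $T_1,T_2$, then the same equivalence holds with the additional requirements on the right-hand side that every $f_k$ lies in the range of $T_1\otimes I$ and every $h_k$ lies in the range of $(I-\Lambda)^{1/2}(T_2\otimes I)$. -/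

import Mathlib

open MeasureTheory
open scoped ENNReal ComplexOrder InnerProductSpace

namespace QWeight

/-! ### The Hilbert space `K ⊗ L²(0,∞)` and its basic operators -/

/-- Lebesgue measure on the half line `(0,∞)`. -/
noncomputable abbrev halfLine : Measure ℝ := volume.restrict (Set.Ioi (0 : ℝ))

/-- `K ⊗ L²(0,∞)`, realised as the square integrable `K`-valued functions on `(0,∞)`. -/
abbrev KL2 (K : Type*) [NormedAddCommGroup K] : Type _ := Lp K 2 halfLine

/-- The algebra of bounded operators on `E`. -/
abbrev Op (E : Type*) [NormedAddCommGroup E] [NormedSpace ℂ E] : Type _ := E →L[ℂ] E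

section Operators

variable {K : Type*} [NormedAddCommGroup K] [InnerProductSpace ℂ K]

/-- Multiplication by an essentially bounded scalar function. -/
noncomputable def mulOp (K : Type*) [NormedAddCommGroup K] [InnerProductSpace ℂ K]
    (φ : ℝ → ℂ) (hφ : MemLp φ ∞ halfLine) : Op (KL2 K) :=
  (ContinuousLinearMap.lsmul ℂ ℂ : ℂ →L[ℂ] K →L[ℂ] K).holderL halfLine ∞ 2 2 (hφ.toLp φ)

theorem mulOp_coe (φ : ℝ → ℂ) (hφ : MemLp φ ∞ halfLine) (f : KL2 K) :
    (mulOp K φ hφ f : ℝ → K) =ᵐ[halfLine] fun x => φ x • f x := by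
  have h := (ContinuousLinearMap.lsmul ℂ ℂ : ℂ →L[ℂ] K →L[ℂ] K).coeFn_holder (r := 2)
    (hφ.toLp φ) f
  filter_upwards [h, hφ.coeFn_toLp] with x hx hx'
  rw [mulOp, ContinuousLinearMap.holderL_apply_apply, hx, hx', ContinuousLinearMap.lsmul_apply]

/-- The operator `A ⊗ I` on `K ⊗ L²(0,∞)`. -/
noncomputable def ampl (A : Op K) : Op (KL2 K) := A.compLpL 2 halfLine

theorem ampl_coe (A : Op K) (f : KL2 K) :
    (ampl A f : ℝ → K) =ᵐ[halfLine] fun x => A (f x) := A.coeFn_compLpL f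

theorem memLp_exp : MemLp (fun x : ℝ => ((Real.exp (-x) : ℝ) : ℂ)) ∞ halfLine := by
  refine memLp_top_of_bound (by fun_prop) 1 ?_
  filter_upwards [ae_restrict_mem measurableSet_Ioi] with x hx
  rw [Complex.norm_real, Real.norm_eq_abs, abs_of_pos (Real.exp_pos _)]
  exact Real.exp_le_one_iff.2 (by simpa using le_of_lt hx)

theorem memLp_sqrt :
    MemLp (fun x : ℝ => ((Real.sqrt (1 - Real.exp (-x)) : ℝ) : ℂ)) ∞ halfLine := by
  refine memLp_top_of_bound (by fun_prop) 1 (Filter.Eventually.of_forall fun x => ?_)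
  rw [Complex.norm_real, Real.norm_eq_abs, abs_of_nonneg (Real.sqrt_nonneg _)]
  refine Real.sqrt_le_one.2 ?_
  linarith [Real.exp_pos (-x)]

theorem memLp_tail (t : ℝ) :
    MemLp (Set.indicator (Set.Ioi t) (fun _ : ℝ => (1 : ℂ))) ∞ halfLine :=
  (memLp_top_const (μ := halfLine) (1 : ℂ)).indicator measurableSet_Ioi

theorem memLp_invSqrt (t : ℝ) (ht : 0 < t) :
    MemLp (Set.indicator (Set.Ioi t)
      (fun x : ℝ => (((Real.sqrt (1 - Real.exp (-x)))⁻¹ : ℝ) : ℂ))) ∞ halfLine := by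
  refine memLp_top_of_bound ?_ (Real.sqrt (1 - Real.exp (-t)))⁻¹
    (Filter.Eventually.of_forall fun x => ?_)
  · exact (Measurable.indicator (by fun_prop) measurableSet_Ioi).aestronglyMeasurable
  · by_cases hx : x ∈ Set.Ioi t
    · rw [Set.indicator_of_mem hx, Complex.norm_real, Real.norm_eq_abs,
        abs_of_nonneg (inv_nonneg.2 (Real.sqrt_nonneg _))]
      have hx' : t < x := hx
      have h1 : Real.exp (-x) ≤ Real.exp (-t) := Real.exp_le_exp.2 (by linarith)
      have h2 : Real.exp (-t) < 1 := Real.exp_lt_one_iff.2 (by linarith)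
      exact inv_anti₀ (Real.sqrt_pos.2 (by linarith)) (Real.sqrt_le_sqrt (by linarith))
    · rw [Set.indicator_of_notMem hx, norm_zero]
      positivity

/-- `E(t,∞) = S_t S_t*`, the projection onto the functions supported in `(t,∞)`. -/
noncomputable def tailProj (K : Type*) [NormedAddCommGroup K] [InnerProductSpace ℂ K] (t : ℝ) :
    Op (KL2 K) := mulOp K _ (memLp_tail t)

/-- `Λ(A)`, given by `(Λ(A) f)(x) = e^{-x} A f(x)`, as a linear map in `A`. -/
noncomputable def Lam : Op K →ₗ[ℂ] Op (KL2 K) where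
  toFun A := mulOp K _ memLp_exp * ampl A
  map_add' A B := by
    rw [← mul_add]; congr 1
    exact ContinuousLinearMap.add_compLpL A B
  map_smul' c A := by
    rw [RingHom.id_apply, ← mul_smul_comm]; congr 1
    exact ContinuousLinearMap.smul_compLpL c A

/-- `(I - Λ(I))^{1/2}`, i.e. multiplication by `(1 - e^{-x})^{1/2}`. -/
noncomputable def rootD (K : Type*) [NormedAddCommGroup K] [InnerProductSpace ℂ K] :
    Op (KL2 K) := mulOp K _ memLp_sqrt

theorem rootD_mul_rootD : rootD K * rootD K = 1 - Lam (1 : Op K) := by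
  ext1 f
  apply Lp.ext
  have e1 := mulOp_coe (K := K) _ memLp_sqrt (rootD K f)
  have e2 := mulOp_coe (K := K) _ memLp_sqrt f
  have e3 := mulOp_coe (K := K) _ memLp_exp (ampl (1 : Op K) f)
  have e4 := ampl_coe (1 : Op K) f
  have e5 := Lp.coeFn_sub f (Lam (1 : Op K) f)
  filter_upwards [e1, e2, e3, e4, e5, ae_restrict_mem measurableSet_Ioi] with x h1 h2 h3 h4 h5 hx
  have hx' : (0 : ℝ) < x := hx
  have hnn : 0 ≤ 1 - Real.exp (-x) := by
    have := Real.exp_le_one_iff.2 (show -x ≤ 0 by linarith)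
    linarith
  change (mulOp K _ memLp_sqrt (rootD K f) : ℝ → K) x = (f - Lam (1 : Op K) f : KL2 K) x
  rw [h5, Pi.sub_apply]
  change _ = f x - (mulOp K _ memLp_exp (ampl (1 : Op K) f) : ℝ → K) x
  rw [h1, h3, h4]
  change _ • (mulOp K _ memLp_sqrt f : ℝ → K) x = _
  rw [h2, smul_smul, ← Complex.ofReal_mul, Real.mul_self_sqrt hnn]
  simp [sub_smul]

theorem ampl_mul_rootD (A : Op K) : ampl A * rootD K = rootD K * ampl A := by
  ext1 f
  apply Lp.ext
  filter_upwards [ampl_coe A (rootD K f), mulOp_coe (K := K) _ memLp_sqrt f,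
    mulOp_coe (K := K) _ memLp_sqrt (ampl A f), ampl_coe A f] with x h1 h2 h3 h4
  change (ampl A (rootD K f) : ℝ → K) x = (mulOp K _ memLp_sqrt (ampl A f) : ℝ → K) x
  rw [h1, h3, h4]
  change A ((mulOp K _ memLp_sqrt f : ℝ → K) x) = _
  rw [h2, map_smul]

theorem tailProj_eq (t : ℝ) (ht : 0 < t) :
    tailProj K t = rootD K * mulOp K _ (memLp_invSqrt t ht) ∧
      tailProj K t = mulOp K _ (memLp_invSqrt t ht) * rootD K := by
  have key : ∀ x : ℝ, Set.indicator (Set.Ioi t) (fun _ : ℝ => (1 : ℂ)) x =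
      ((Real.sqrt (1 - Real.exp (-x)) : ℝ) : ℂ) * Set.indicator (Set.Ioi t)
        (fun x : ℝ => (((Real.sqrt (1 - Real.exp (-x)))⁻¹ : ℝ) : ℂ)) x := by
    intro x
    by_cases hx : x ∈ Set.Ioi t
    · rw [Set.indicator_of_mem hx, Set.indicator_of_mem hx, ← Complex.ofReal_mul,
        mul_inv_cancel₀, Complex.ofReal_one]
      have hx' : t < x := hx
      have : Real.exp (-x) < 1 := Real.exp_lt_one_iff.2 (by linarith)
      exact (Real.sqrt_pos.2 (by linarith)).ne'
    · rw [Set.indicator_of_notMem hx, Set.indicator_of_notMem hx, mul_zero]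
  constructor <;> (ext1 f; apply Lp.ext)
  · filter_upwards [mulOp_coe (K := K) _ (memLp_tail t) f,
      mulOp_coe (K := K) _ memLp_sqrt (mulOp K _ (memLp_invSqrt t ht) f),
      mulOp_coe (K := K) _ (memLp_invSqrt t ht) f] with x h1 h2 h3
    change (mulOp K _ (memLp_tail t) f : ℝ → K) x =
      (mulOp K _ memLp_sqrt (mulOp K _ (memLp_invSqrt t ht) f) : ℝ → K) x
    rw [h1, h2, h3, smul_smul, key x]
  · filter_upwards [mulOp_coe (K := K) _ (memLp_tail t) f,
      mulOp_coe (K := K) _ (memLp_invSqrt t ht) (rootD K f),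
      mulOp_coe (K := K) _ memLp_sqrt f] with x h1 h2 h3
    change (mulOp K _ (memLp_tail t) f : ℝ → K) x =
      (mulOp K _ (memLp_invSqrt t ht) (rootD K f) : ℝ → K) x
    rw [h1, h2]
    change _ = _ • (mulOp K _ memLp_sqrt f : ℝ → K) x
    rw [h3, smul_smul, key x, mul_comm]

theorem rootD_inner (f g : KL2 K) : ⟪rootD K f, g⟫_ℂ = ⟪f, rootD K g⟫_ℂ := by
  rw [L2.inner_def, L2.inner_def]
  refine integral_congr_ae ?_
  filter_upwards [mulOp_coe (K := K) _ memLp_sqrt f, mulOp_coe (K := K) _ memLp_sqrt g]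
    with x h1 h2
  change ⟪(mulOp K _ memLp_sqrt f : ℝ → K) x, g x⟫_ℂ = ⟪f x, (mulOp K _ memLp_sqrt g : ℝ → K) x⟫_ℂ
  rw [h1, h2, inner_smul_left, inner_smul_right, Complex.conj_ofReal]

theorem adjoint_rootD [CompleteSpace K] : star (rootD K) = rootD K := by
  rw [ContinuousLinearMap.star_eq_adjoint, eq_comm, ContinuousLinearMap.eq_adjoint_iff]
  exact fun f g => rootD_inner f g

end Operators

/-! ### The algebra `𝔄(H)` and boundary weights -/

section Boundary

variable {K : Type*} [NormedAddCommGroup K] [InnerProductSpace ℂ K]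

/-- The linear map `B ↦ (I - Λ)^{1/2} B (I - Λ)^{1/2}` on the bounded operators on `H`. -/
noncomputable def sandwich (K : Type*) [NormedAddCommGroup K] [InnerProductSpace ℂ K] :
    Op (KL2 K) →ₗ[ℂ] Op (KL2 K) := LinearMap.mulLeftRight ℂ (rootD K, rootD K)

/-- `𝔄(H) = (I - Λ)^{1/2} 𝔅(H) (I - Λ)^{1/2}`. -/
noncomputable def BdryAlg (K : Type*) [NormedAddCommGroup K] [InnerProductSpace ℂ K] :
    Submodule ℂ (Op (KL2 K)) := LinearMap.range (sandwich K)

/-- The linear bijection `B ↦ (I - Λ)^{1/2} B (I - Λ)^{1/2}` of `𝔅(H)` onto `𝔄(H)`. -/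
noncomputable def toBdry : Op (KL2 K) →ₗ[ℂ] BdryAlg K := (sandwich K).rangeRestrict

/-- `I - Λ` as an element of `𝔄(H)`. -/
noncomputable def oneSubLam (K : Type*) [NormedAddCommGroup K] [InnerProductSpace ℂ K] :
    BdryAlg K :=
  ⟨1 - Lam (1 : Op K), 1, by simp [sandwich, rootD_mul_rootD]⟩

theorem tail_mem (t : ℝ) (ht : 0 < t) (A : Op (KL2 K)) :
    tailProj K t * A * tailProj K t ∈ BdryAlg K := by
  refine ⟨mulOp K _ (memLp_invSqrt t ht) * A * mulOp K _ (memLp_invSqrt t ht), ?_⟩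
  nth_rewrite 1 [(tailProj_eq t ht).1]
  rw [(tailProj_eq t ht).2]
  simp only [sandwich, LinearMap.mulLeftRight_apply, mul_assoc]

/-- The linear map `A ↦ E(t,∞) A E(t,∞)` from `𝔅(H)` to `𝔄(H)`. -/
noncomputable def cutoff (t : ℝ) (ht : 0 < t) : Op (KL2 K) →ₗ[ℂ] BdryAlg K :=
  (LinearMap.mulLeftRight ℂ (tailProj K t, tailProj K t)).codRestrict (BdryAlg K)
    fun A => by simpa using tail_mem t ht A

theorem compress_mem (E F : Op K) (A : BdryAlg K) :
    ampl E * (A : Op (KL2 K)) * ampl F ∈ BdryAlg K := by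
  obtain ⟨A, B, rfl⟩ := A
  refine ⟨ampl E * B * ampl F, ?_⟩
  have h1 := ampl_mul_rootD E
  have h2 := ampl_mul_rootD F
  simp only [sandwich, LinearMap.mulLeftRight_apply]
  calc rootD K * (ampl E * B * ampl F) * rootD K
      = (rootD K * ampl E) * B * (ampl F * rootD K) := by simp only [mul_assoc]
    _ = (ampl E * rootD K) * B * (rootD K * ampl F) := by rw [h1, h2]
    _ = _ := by simp only [mul_assoc]

/-- The linear map `A ↦ (E ⊗ I) A (F ⊗ I)` of `𝔄(H)` into itself. -/
noncomputable def compress (E F : Op K) : BdryAlg K →ₗ[ℂ] BdryAlg K :=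
  ((LinearMap.mulLeftRight ℂ (ampl E, ampl F)).domRestrict (BdryAlg K)).codRestrict (BdryAlg K)
    fun A => by simpa using compress_mem E F A

theorem star_mem_bdry [CompleteSpace K] (A : BdryAlg K) :
    star (A : Op (KL2 K)) ∈ BdryAlg K := by
  obtain ⟨A, B, rfl⟩ := A
  refine ⟨star B, ?_⟩
  simp only [sandwich, LinearMap.mulLeftRight_apply, star_mul, adjoint_rootD, mul_assoc]

/-- The adjoint operation `A ↦ A*` on `𝔄(H)`. -/
noncomputable def bdryStar [CompleteSpace K] (A : BdryAlg K) : BdryAlg K :=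
  ⟨star (A : Op (KL2 K)), star_mem_bdry A⟩

/-- A linear functional on `𝔅(E)` is normal (σ-weakly continuous) if it has the form
`A ↦ ∑ (xₙ, A yₙ)` with `∑ ‖xₙ‖² < ∞` and `∑ ‖yₙ‖² < ∞`. -/
def IsNormalFunctional {E : Type*} [NormedAddCommGroup E] [InnerProductSpace ℂ E]
    (ℓ : Module.Dual ℂ (Op E)) : Prop :=
  ∃ x y : ℕ → E, Summable (fun n => ‖x n‖ ^ 2) ∧ Summable (fun n => ‖y n‖ ^ 2) ∧
    ∀ A : Op E, HasSum (fun n => ⟪x n, A (y n)⟫_ℂ) (ℓ A)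

/-- Boundary weights: the linear functionals `μ` on `𝔄(H)` for which
`B ↦ μ((I - Λ)^{1/2} B (I - Λ)^{1/2})` is a normal functional on `𝔅(H)`. -/
def IsBoundaryWeight (μ : Module.Dual ℂ (BdryAlg K)) : Prop :=
  IsNormalFunctional (μ ∘ₗ toBdry (K := K))

/-- Linear maps from `𝔅(K)_*` to the functionals on `𝔄(H)`.  For finite-dimensional `K`, the case
in which this is used, the predual `𝔅(K)_*` consists of all linear functionals on `𝔅(K)`. -/
abbrev WeightMap (K : Type*) [NormedAddCommGroup K] [InnerProductSpace ℂ K] : Type _ :=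
  Module.Dual ℂ (Op K) →ₗ[ℂ] Module.Dual ℂ (BdryAlg K)

/-- The matrix `(A i j)` of operators on `E` is a positive operator on `Eⁿ`. -/
def IsPosMatrix {E : Type*} [NormedAddCommGroup E] [InnerProductSpace ℂ E] {n : ℕ}
    (A : Fin n → Fin n → Op E) : Prop :=
  ∀ x : Fin n → E, 0 ≤ ∑ i, ∑ j, ⟪x i, A i j (x j)⟫_ℂ

/-- Complete positivity of a linear map defined on a space `S` of operators on `E`. -/
def IsCP {E F : Type*} [NormedAddCommGroup E] [InnerProductSpace ℂ E] [NormedAddCommGroup F]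
    [InnerProductSpace ℂ F] {S : Submodule ℂ (Op E)} (φ : S →ₗ[ℂ] Op F) : Prop :=
  ∀ (n : ℕ) (A : Fin n → Fin n → S),
    IsPosMatrix (fun i j => (A i j : Op E)) → IsPosMatrix (fun i j => φ (A i j))

/-- Complete positivity of a linear map defined on all bounded operators. -/
def IsCPFull {E F : Type*} [NormedAddCommGroup E] [InnerProductSpace ℂ E] [NormedAddCommGroup F]
    [InnerProductSpace ℂ F] (φ : Op E →ₗ[ℂ] Op F) : Prop :=
  IsCP (φ.domRestrict ⊤)

end Boundary

/-! ### `q`-weight maps over a finite-dimensional space -/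

section QWeightMaps

variable {K : Type*} [NormedAddCommGroup K] [InnerProductSpace ℂ K] [FiniteDimensional ℂ K]

/-- The dual of a map `ω : 𝔅(K)_* → V'`: the unique map `V → 𝔅(K)` with
`ρ(dualize ω v) = ω(ρ)(v)` for all `ρ`. -/
noncomputable def dualize {V : Type*} [AddCommGroup V] [Module ℂ V]
    (ω : Module.Dual ℂ (Op K) →ₗ[ℂ] Module.Dual ℂ V) : V →ₗ[ℂ] Op K :=
  (Module.evalEquiv ℂ (Op K)).symm.toLinearMap ∘ₗ ω.flip

theorem dualize_spec {V : Type*} [AddCommGroup V] [Module ℂ V]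
    (ω : Module.Dual ℂ (Op K) →ₗ[ℂ] Module.Dual ℂ V) (ρ : Module.Dual ℂ (Op K)) (v : V) :
    ρ (dualize ω v) = ω ρ v := by
  simp [dualize]

/-- The range rank of a boundary weight map: the dimension of the range of its dual. -/
noncomputable def rangeRank (ω : WeightMap K) : ℕ :=
  Module.finrank ℂ (LinearMap.range (dualize ω))

/-- The truncation `ω|_t(ρ)(A) = ω(ρ)(E(t,∞) A E(t,∞))`. -/
noncomputable def truncate (ω : WeightMap K) (t : ℝ) (ht : 0 < t) :
    Module.Dual ℂ (Op K) →ₗ[ℂ] Module.Dual ℂ (Op (KL2 K)) :=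
  (cutoff t ht).dualMap ∘ₗ ω

/-- The map `I + Λ̂ ω|_t` of `𝔅(K)_*` into itself, where `Λ̂(ϕ)(A) = ϕ(Λ(A))`. -/
noncomputable def resolventMap (ω : WeightMap K) (t : ℝ) (ht : 0 < t) :
    Module.End ℂ (Module.Dual ℂ (Op K)) :=
  1 + (Lam (K := K)).dualMap ∘ₗ truncate ω t ht

/-- The generalized boundary representation `π_t^# : 𝔅(H) → 𝔅(K)`, the dual of
`ω|_t (I + Λ̂ ω|_t)⁻¹`.  It is meaningful when `I + Λ̂ ω|_t` is invertible. -/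
noncomputable def bdryRep (ω : WeightMap K) (t : ℝ) (ht : 0 < t) :
    Op (KL2 K) →ₗ[ℂ] Op K :=
  dualize (truncate ω t ht ∘ₗ Ring.inverse (resolventMap ω t ht))

/-- `q`-weight maps over `K`. -/
structure IsQWeightMap (ω : WeightMap K) : Prop where
  boundary : ∀ ρ, IsBoundaryWeight (ω ρ)
  cp : IsCP (dualize ω)
  bound : ∀ ρ : Module.Dual ℂ (Op K), (∀ A : Op K, A.IsPositive → 0 ≤ ρ A) →
    ω ρ (oneSubLam K) ≤ ρ 1
  invertible : ∀ (t : ℝ) (ht : 0 < t), IsUnit (resolventMap ω t ht)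
  rep_cp : ∀ (t : ℝ) (ht : 0 < t), IsCPFull (bdryRep ω t ht)
  rep_contr : ∀ (t : ℝ) (ht : 0 < t) (A : Op (KL2 K)), ‖bdryRep ω t ht A‖ ≤ ‖A‖

/-- The order `η ≤_q ω` between `q`-weight maps. -/
def QLE (η ω : WeightMap K) : Prop :=
  ∀ (t : ℝ) (ht : 0 < t), IsCPFull (bdryRep ω t ht - bdryRep η t ht)

/-- `ω` is `q`-pure: its `q`-subordinates are totally ordered by `q`-subordination. -/
def IsQPure (ω : WeightMap K) : Prop :=
  ∀ η₁ η₂ : WeightMap K, IsQWeightMap η₁ → IsQWeightMap η₂ → QLE η₁ ω → QLE η₂ ω →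
    QLE η₁ η₂ ∨ QLE η₂ η₁

/-- `ψ(ρ)(A) = ρ(E A F)`. -/
noncomputable def psi (E F : Op K) : Module.Dual ℂ (Op K) →ₗ[ℂ] Module.Dual ℂ (Op K) :=
  (LinearMap.mulLeftRight ℂ (E, F)).dualMap

/-- `η₁` and `η₂` are completely orthogonal by way of the orthogonal projections `E₁`, `E₂`. -/
structure CompletelyOrthogonal [CompleteSpace K] (E₁ E₂ : Op K) (η₁ η₂ : WeightMap K) : Prop where
  proj₁ : IsStarProjection E₁
  proj₂ : IsStarProjection E₂
  orth : E₁ * E₂ = 0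
  supp₁ : ∀ ρ A, η₁ ρ A = η₁ (psi E₁ E₁ ρ) (compress E₁ E₁ A)
  supp₂ : ∀ ρ A, η₂ ρ A = η₂ (psi E₂ E₂ ρ) (compress E₂ E₂ A)

/-- The functional `ρ*(A) = conj ρ(A*)` on `𝔅(K)`. -/
noncomputable def dualStar [CompleteSpace K] (ρ : Module.Dual ℂ (Op K)) :
    Module.Dual ℂ (Op K) where
  toFun A := star (ρ (star A))
  map_add' A B := by simp
  map_smul' c A := by simp

/-- The adjoint map `γ*(ρ)(A) = conj (γ(ρ*)(A*))`. -/
noncomputable def adjMap [CompleteSpace K] (γ : WeightMap K) : WeightMap K :=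
  LinearMap.mk₂ ℂ (fun ρ A => star (γ (dualStar ρ) (bdryStar A)))
    (fun ρ σ A => by
      have h : dualStar (ρ + σ) = dualStar ρ + dualStar σ := by ext; simp [dualStar]
      simp [h])
    (fun c ρ A => by
      have h : dualStar (c • ρ) = star c • dualStar ρ := by ext; simp [dualStar]
      simp [h])
    (fun ρ A B => by
      have h : bdryStar (A + B) = bdryStar A + bdryStar B := by ext1; simp [bdryStar]
      simp [h])
    (fun c ρ A => by
      have h : bdryStar (c • A) = star c • bdryStar A := by ext1; simp [bdryStar]
      simp [h])

/-- `γ` is an (internal) `q`-corner from `η₁` to `η₂`, with respect to the projections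
`E₁`, `E₂`. -/
structure IsQCorner [CompleteSpace K] (E₁ E₂ : Op K) (η₁ η₂ γ : WeightMap K) : Prop where
  boundary : ∀ ρ, IsBoundaryWeight (γ ρ)
  supp : ∀ ρ A, γ ρ A = γ (psi E₁ E₂ ρ) (compress E₁ E₂ A)
  qweight : IsQWeightMap (η₁ + γ + adjMap γ + η₂)

end QWeightMaps

/-- The vectors `f k` represent `μ`: for all `A` in `𝔄(H)`,
`μ(A) = ∑ (f k, (I - Λ)^{-1/2} A (I - Λ)^{-1/2} f k)`, where `(I - Λ)^{-1/2} A (I - Λ)^{-1/2}`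
is the bounded operator `B` with `A = (I - Λ)^{1/2} B (I - Λ)^{1/2}`.  Finite families are
sequences that are eventually `0`. -/
def Represents {K : Type*} [NormedAddCommGroup K] [InnerProductSpace ℂ K]
    (f : ℕ → KL2 K) (μ : Module.Dual ℂ (BdryAlg K)) : Prop :=
  ∀ B : Op (KL2 K), HasSum (fun k => ⟪f k, B (f k)⟫_ℂ) (μ (toBdry B))

end QWeight

open QWeight

/-! A normal functional on `𝔅(H)` has the form `B ↦ ⟨x, (B ⊗ I) y⟩` with `x`, `y` in `H ⊗ ℓ²`, and a
positive one has `x = y`. So `μ` and `ν` are given by single vectors `f`, `g`, unique up to the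
choice of representing sequence, and everything is governed by the vectors `D_t f` and `D_t g`,
where `D_t = E(t,∞) Λ^{1/2} (I - Λ)^{-1/2}` (`seqRatio`). As `t → 0`, the norms `‖D_t p‖` stay
bounded exactly when `p` lies in the range of `(I - Λ)^{1/2} ⊗ I` (`exists_rootD_eq`,
`seqRatio_rootD`). The summability condition on the `h_k` is thus a uniform bound on `D_t (g - z U
f)`.

A corner of range rank one is `γ(ρ) = ρ(C) τ` with `τ = ⟨x, · y⟩`. On the four blocks of `ω + γ + γ*
+ η` the resolvent is diagonal, so `π_t^#` is explicit (`CornerData.bdryRep_eq`). Its diagonal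
coefficients are `(1 + ‖T₁ D_t f‖²)⁻¹` and `(1 + ‖T₂ D_t g‖²)⁻¹`, and its corner coefficient is `(1
+ ⟨D_t x, C D_t y⟩)⁻¹`. Complete positivity is therefore a determinant condition comparing `(1 + ‖T₁
D_t f‖²)(1 + ‖T₂ D_t g‖²)` with `|1 + ⟨D_t x, C D_t y⟩|²`.

Sufficiency: take `C = T₁ U*` and `τ = s ⟨f, · g⟩`. If `T₂ D_t g` and `z C* D_t f` stay within
bounded distance, the inequality of arithmetic and geometric means yields the determinant condition
for one small `s` and all `t` (`sq_mul_le_of_norm_sub_le`). If `⟨f, · g⟩` vanishes, another sequence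
representing `μ` is used.

Necessity: normalise `‖C‖ = 1`. The quotient of the square root of the first quantity by that of the
second increases as `t → 0` and is bounded (`cornerRatio_mono`, `cornerRatio_bddAbove`). With its
limit `r`, the weights `μ`, `rτ`, `ν` form a positive `2 × 2` matrix, so `rτ = ⟨f', · g'⟩` for
suitable representing vectors. Then `⟨C* T₁ D_t f', T₂ D_t g'⟩` is within `r` of the Cauchy–Schwarz
bound, which forces `T₂ D_t g' - w C* D_t f'` and `w T₁ D_t f' - C D_t g'` to be bounded
(`exists_near_multiple`). A compactness argument makes `w` independent of `t`.

Purity enters once: a `q`-pure map of this form admits no nonzero self-adjoint `D` on the range of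
`T` that kills a nonzero vector of that range and keeps `D D_t f` bounded
(`IsQPure.eq_zero_of_bounded`). Applied to `T₁ - C C*` and `T₂ - C* C`, this makes `C` a partial
isometry, and its adjoint extends, up to the phase of `w`, to the unitary `U`. -/

set_option linter.unusedSectionVars false

namespace QWeight

/-! ### Normal functionals as vector functionals on `E ⊗ ℓ²` -/

section Amplification

variable {E : Type*} [NormedAddCommGroup E] [InnerProductSpace ℂ E]

/-- Square summable sequences in `E`, i.e. `E ⊗ ℓ²`. -/
abbrev SeqL2 (E : Type*) [NormedAddCommGroup E] : Type _ := lp (fun _ : ℕ => E) 2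

theorem memlp_two_iff {x : ℕ → E} : Memℓp x 2 ↔ Summable fun n => ‖x n‖ ^ 2 := by
  rw [memℓp_gen_iff (by norm_num)]
  simp

theorem SeqL2.summable_sq (x : SeqL2 E) : Summable fun n => ‖x n‖ ^ 2 := memlp_two_iff.1 x.2

theorem SeqL2.hasSum_sq (x : SeqL2 E) : HasSum (fun n => ‖x n‖ ^ 2) (‖x‖ ^ 2) := by
  have := lp.hasSum_norm (p := 2) (by norm_num) x
  simpa using this

theorem memlp_map (B : Op E) (x : SeqL2 E) : Memℓp (fun n => B (x n)) 2 := by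
  refine memlp_two_iff.2 (.of_nonneg_of_le (fun n => by positivity) (fun n => ?_)
    (x.summable_sq.mul_left (‖B‖ ^ 2)))
  rw [← mul_pow]
  gcongr
  exact B.le_opNorm _

/-- The operator `B ⊗ I` on `E ⊗ ℓ²`. -/
noncomputable def amp (B : Op E) : Op (SeqL2 E) :=
  LinearMap.mkContinuous
    { toFun := fun x => ⟨fun n => B (x n), memlp_map B x⟩
      map_add' := fun x y => by ext n; exact map_add B (x n) (y n)
      map_smul' := fun c x => by ext n; exact map_smul B c (x n) }
    ‖B‖ (fun x => by
      refine (sq_le_sq₀ (norm_nonneg _) (by positivity)).1 ?_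
      rw [mul_pow]
      refine hasSum_le (fun n => ?_) (SeqL2.hasSum_sq _) ((SeqL2.hasSum_sq x).mul_left _)
      rw [← mul_pow]
      gcongr
      exact B.le_opNorm _)

@[simp] theorem amp_apply (B : Op E) (x : SeqL2 E) (n : ℕ) : amp B x n = B (x n) := rfl

theorem amp_mul_apply (A B : Op E) (x : SeqL2 E) : amp (A * B) x = amp A (amp B x) := rfl

theorem amp_one : amp (1 : Op E) = 1 := rfl

theorem amp_add (A B : Op E) : amp (A + B) = amp A + amp B := rfl

theorem amp_sub (A B : Op E) : amp (A - B) = amp A - amp B := by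
  ext x n; simp

theorem amp_smul (c : ℂ) (A : Op E) : amp (c • A) = c • amp A := rfl

theorem hasSum_inner_amp (x y : SeqL2 E) (B : Op E) :
    HasSum (fun n => ⟪x n, B (y n)⟫_ℂ) ⟪x, amp B y⟫_ℂ :=
  lp.hasSum_inner x (amp B y)

theorem amp_norm_le (B : Op E) (x : SeqL2 E) : ‖amp B x‖ ≤ ‖B‖ * ‖x‖ :=
  (amp B).le_of_opNorm_le (LinearMap.mkContinuous_norm_le _ (norm_nonneg _) _) x

variable [CompleteSpace E]

theorem amp_inner_left (B : Op E) (x y : SeqL2 E) :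
    ⟪amp B x, y⟫_ℂ = ⟪x, amp (star B) y⟫_ℂ := by
  rw [lp.inner_eq_tsum, lp.inner_eq_tsum]
  refine tsum_congr fun n => ?_
  simp [ContinuousLinearMap.star_eq_adjoint, ContinuousLinearMap.adjoint_inner_right]

attribute [irreducible] amp

theorem isNormalFunctional_iff {ℓ : Module.Dual ℂ (Op E)} :
    IsNormalFunctional ℓ ↔ ∃ x y : SeqL2 E, ∀ B, ℓ B = ⟪x, amp B y⟫_ℂ := by
  constructor
  · rintro ⟨x, y, hx, hy, h⟩
    refine ⟨⟨x, memlp_two_iff.2 hx⟩, ⟨y, memlp_two_iff.2 hy⟩, fun B => ?_⟩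
    exact (h B).unique (hasSum_inner_amp ⟨x, memlp_two_iff.2 hx⟩ ⟨y, memlp_two_iff.2 hy⟩ B)
  · rintro ⟨x, y, h⟩
    exact ⟨x, y, x.summable_sq, y.summable_sq, fun B => h B ▸ hasSum_inner_amp x y B⟩

end Amplification

/-! ### Positive normal functionals -/

section PositiveNormal

variable {E : Type*} [NormedAddCommGroup E] [InnerProductSpace ℂ E]

/-- Summing over a Hilbert basis first or over the index of two square summable families first. -/
theorem summable_prod_inner {ι κ : Type*} (e : HilbertBasis ι ℂ E) {u v : κ → E}
    (hu : Summable fun n => ‖u n‖ ^ 2) (hv : Summable fun n => ‖v n‖ ^ 2) :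
    Summable fun p : κ × ι => ⟪u p.1, e p.2⟫_ℂ * ⟪e p.2, v p.1⟫_ℂ := by
  have sq : ∀ w : E, HasSum (fun i => ‖⟪e i, w⟫_ℂ‖ ^ 2) (‖w‖ ^ 2) := by
    intro w
    have h := e.hasSum_inner_mul_inner w w
    have h2 := (Complex.hasSum_iff _ _).1 h |>.1
    have h3 : (⟪w, w⟫_ℂ).re = ‖w‖ ^ 2 := inner_self_eq_norm_sq (𝕜 := ℂ) w
    rw [h3] at h2
    convert h2 using 2 with i
    rw [← inner_conj_symm w, ← Complex.normSq_eq_norm_sq, ← Complex.normSq_eq_conj_mul_self,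
      Complex.ofReal_re]
  have key : ∀ w : κ → E, Summable (fun n => ‖w n‖ ^ 2) →
      Summable fun p : κ × ι => ‖⟪e p.2, w p.1⟫_ℂ‖ ^ 2 := by
    intro w hw
    rw [summable_prod_of_nonneg (fun p => by positivity)]
    exact ⟨fun n => (sq (w n)).summable, hw.congr fun n => ((sq (w n)).tsum_eq).symm⟩
  refine .of_norm_bounded ((key u hu).add (key v hv)) fun p => ?_
  rw [norm_mul, norm_inner_symm]
  nlinarith [sq_nonneg (‖⟪e p.2, u p.1⟫_ℂ‖ - ‖⟪e p.2, v p.1⟫_ℂ‖),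
    sq_nonneg (‖⟪e p.2, u p.1⟫_ℂ‖), sq_nonneg ‖⟪e p.2, v p.1⟫_ℂ‖]

/-- Parseval for each `n`, with the order of summation exchanged by absolute summability. This plays
the part of a trace formula below. -/
theorem hasSum_prod_inner {ι κ : Type*} (e : HilbertBasis ι ℂ E) {u v : κ → E}
    (hu : Summable fun n => ‖u n‖ ^ 2) (hv : Summable fun n => ‖v n‖ ^ 2) :
    HasSum (fun i => ∑' n, ⟪u n, e i⟫_ℂ * ⟪e i, v n⟫_ℂ) (∑' n, ⟪u n, v n⟫_ℂ) := by
  have h := summable_prod_inner e hu hv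
  have h1 : HasSum (fun p : κ × ι => ⟪u p.1, e p.2⟫_ℂ * ⟪e p.2, v p.1⟫_ℂ)
      (∑' n, ⟪u n, v n⟫_ℂ) := by
    have := h.hasSum
    rw [h.tsum_prod] at this
    simpa only [e.tsum_inner_mul_inner] using this
  have h2 := (Equiv.prodComm ι κ).hasSum_iff.2 h1
  exact h2.prod_fiberwise fun i => (h.prod_symm.prod_factor i).hasSum

variable [CompleteSpace E]

/-- The rank one operators `|yₙ⟩⟨xₙ|` have norm at most `‖xₙ‖² + ‖yₙ‖²`, so their sum converges in
norm. It is the density operator of `B ↦ ∑ ⟨xₙ, B yₙ⟩`. -/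
theorem exists_density (x y : SeqL2 E) :
    ∃ d : Op E, ∀ a b : E, HasSum (fun n => ⟪a, y n⟫_ℂ * ⟪x n, b⟫_ℂ) ⟪a, d b⟫_ℂ := by
  have hs : Summable fun n => InnerProductSpace.rankOne ℂ (y n) (x n) := by
    refine .of_norm_bounded (x.summable_sq.add y.summable_sq) fun n => ?_
    rw [InnerProductSpace.norm_rankOne]
    nlinarith [sq_nonneg (‖x n‖ - ‖y n‖), sq_nonneg ‖x n‖, sq_nonneg ‖y n‖]
  refine ⟨∑' n, InnerProductSpace.rankOne ℂ (y n) (x n), fun a b => ?_⟩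
  have h := (hs.hasSum.mapL (ContinuousLinearMap.apply ℂ E b)).mapL (innerSL ℂ a)
  simpa [inner_smul_right, mul_comm] using h

/-- A normal functional that is positive on rank one projections is a sum of vector functionals. -/
theorem exists_eq_inner_self {ℓ : Module.Dual ℂ (Op E)} {x y : SeqL2 E}
    (h : ∀ B, ℓ B = ⟪x, amp B y⟫_ℂ) (hpos : ∀ k, 0 ≤ ℓ (InnerProductSpace.rankOne ℂ k k)) :
    ∃ F : SeqL2 E, ∀ B, ℓ B = ⟪F, amp B F⟫_ℂ := by
  obtain ⟨d, hd⟩ := exists_density x y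
  have dpos : 0 ≤ d := by
    rw [ContinuousLinearMap.nonneg_iff_isPositive, ContinuousLinearMap.isPositive_iff_complex]
    intro k
    have h1 : ⟪k, d k⟫_ℂ = ℓ (InnerProductSpace.rankOne ℂ k k) := by
      rw [h]
      refine (hd k k).unique ?_
      convert hasSum_inner_amp x y (InnerProductSpace.rankOne ℂ k k) using 2 with n
      simp [inner_smul_right]
    have h2 := hpos k
    rw [← h1] at h2
    have h3 := Complex.nonneg_iff.1 h2
    have h4 : ⟪d k, k⟫_ℂ = ⟪k, d k⟫_ℂ := by
      rw [← inner_conj_symm, Complex.conj_eq_iff_im.2 h3.2.symm]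
    rw [h4]
    exact ⟨Complex.ext (by simp) (by simpa using h3.2), h3.1⟩
  -- With `S = d^{1/2}`, the functional is `B ↦ tr (S B S)`, so the vectors `S e_i` represent it.
  obtain ⟨S, hSsa, hS⟩ : ∃ S : Op E, star S = S ∧ S * S = d :=
    ⟨CFC.sqrt d, (CFC.sqrt_nonneg d).isSelfAdjoint.star_eq, CFC.sqrt_mul_sqrt_self d⟩
  have hSi : ∀ a b : E, ⟪S a, b⟫_ℂ = ⟪a, S b⟫_ℂ := fun a b => by
    conv_rhs => rw [← hSsa, ContinuousLinearMap.star_eq_adjoint,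
      ContinuousLinearMap.adjoint_inner_right]
  have hSS : ∀ a b : E, ⟪S a, S b⟫_ℂ = ⟪a, d b⟫_ℂ := fun a b => by
    rw [hSi, ← hS]; rfl
  obtain ⟨w, e, -⟩ := exists_hilbertBasis ℂ E
  have hsum : Summable fun i => ‖S (e i)‖ ^ 2 := by
    have h1 := (hasSum_prod_inner e x.summable_sq y.summable_sq).summable
    have h2 := ((Complex.hasSum_iff _ _).1 h1.hasSum).1.summable
    refine h2.congr fun i => ?_
    have h3 : (⟪S (e i), S (e i)⟫_ℂ).re = ‖S (e i)‖ ^ 2 := inner_self_eq_norm_sq (𝕜 := ℂ) _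
    rw [← h3, hSS, ← (hd _ _).tsum_eq]
    simp only [mul_comm]
  have hB : ∀ B : Op E, HasSum (fun i => ⟪S (e i), B (S (e i))⟫_ℂ) (ℓ B) := by
    intro B
    have hsumB : Summable fun i => ‖B (S (e i))‖ ^ 2 := by
      refine .of_nonneg_of_le (fun n => by positivity) (fun n => ?_) (hsum.mul_left (‖B‖ ^ 2))
      rw [← mul_pow]
      gcongr
      exact B.le_opNorm _
    have h1 := hasSum_prod_inner e hsum hsumB
    have h2 := hasSum_prod_inner e x.summable_sq (amp B y).summable_sq
    -- Both double sums have the same `e_j` term, `⟨B* e_j, d e_j⟩`. This is where `S² = d` replaces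
    -- the pair `x`, `y` by the vectors `S e_i`.
    have h3 : ∀ j, ∑' i, ⟪S (e i), e j⟫_ℂ * ⟪e j, B (S (e i))⟫_ℂ
        = ∑' n, ⟪x n, e j⟫_ℂ * ⟪e j, amp B y n⟫_ℂ := by
      intro j
      have e1 : ∑' i, ⟪S (e i), e j⟫_ℂ * ⟪e j, B (S (e i))⟫_ℂ
          = ⟪S (star B (e j)), S (e j)⟫_ℂ := by
        rw [← e.tsum_inner_mul_inner]
        refine tsum_congr fun i => ?_
        rw [mul_comm, hSi (star B _), ContinuousLinearMap.star_eq_adjoint,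
          ContinuousLinearMap.adjoint_inner_left, hSi (e i)]
      rw [e1, hSS, ← (hd _ _).tsum_eq]
      refine tsum_congr fun n => ?_
      rw [mul_comm, ContinuousLinearMap.star_eq_adjoint,
          ContinuousLinearMap.adjoint_inner_left, amp_apply]
    simp only [h3] at h1
    have h4 : ∑' i, ⟪S (e i), B (S (e i))⟫_ℂ = ℓ B := by
      rw [h1.unique h2, h B, ← (hasSum_inner_amp x y B).tsum_eq]
      simp only [amp_apply]
    rw [← h4]
    refine Summable.hasSum (.of_norm_bounded (hsum.add hsumB) fun i => ?_)
    refine (norm_inner_le_norm _ _).trans ?_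
    nlinarith [sq_nonneg (‖S (e i)‖ - ‖B (S (e i))‖), sq_nonneg (‖S (e i)‖),
      sq_nonneg ‖B (S (e i))‖]
  -- The Hilbert basis may be uncountable, but only countably many `S e_i` are nonzero. These are
  -- spread over `ℕ`, with zeros elsewhere.
  have hc : (Function.support fun i => ‖S (e i)‖ ^ 2).Countable := hsum.countable_support
  have := hc.to_subtype
  obtain ⟨φ, hφ⟩ := exists_injective_nat (Function.support fun i => ‖S (e i)‖ ^ 2)
  have conv : ∀ {V : Type _} [AddCommGroup V] [TopologicalSpace V] (G : E → V), G 0 = 0 → ∀ {a : V},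
      HasSum (fun i => G (S (e i))) a → HasSum (fun n => G (Function.extend φ
        (fun i => S (e i.1)) 0 n)) a := by
    intro V _ _ G hG a ha
    have h1 : HasSum (fun i : Function.support fun i => ‖S (e i)‖ ^ 2 => G (S (e i.1))) a := by
      refine (hasSum_subtype_iff_of_support_subset ?_).2 ha
      intro i hi hi'
      apply hi
      have : S (e i) = 0 := by simpa using hi'
      simp [this, hG]
    rw [← hasSum_extend_zero hφ] at h1
    convert h1 using 2 with n
    by_cases hn : ∃ i, φ i = n
    · obtain ⟨i, rfl⟩ := hn
      rw [hφ.extend_apply, hφ.extend_apply]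
    · rw [Function.extend_apply' _ _ _ hn, Function.extend_apply' _ _ _ hn]
      exact hG
  refine ⟨⟨_, memlp_two_iff.2 (conv (fun v => ‖v‖ ^ 2) (by simp) hsum.hasSum).summable⟩,
    fun B => ?_⟩
  exact (conv (fun v => ⟪v, B v⟫_ℂ) (by simp) (hB B)).unique (hasSum_inner_amp _ _ B)

end PositiveNormal

end QWeight

namespace QWeight

/-! ### Multiplication operators on the half line -/

section Multiplication

variable {K : Type*} [NormedAddCommGroup K] [InnerProductSpace ℂ K]

theorem mulOp_mul {φ ψ χ : ℝ → ℂ} (hφ : MemLp φ ∞ halfLine) (hψ : MemLp ψ ∞ halfLine)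
    (hχ : MemLp χ ∞ halfLine) (h : ∀ x, 0 < x → χ x = φ x * ψ x) :
    mulOp K φ hφ * mulOp K ψ hψ = mulOp K χ hχ := by
  ext1 f
  apply Lp.ext
  filter_upwards [mulOp_coe (K := K) φ hφ (mulOp K ψ hψ f), mulOp_coe (K := K) ψ hψ f,
    mulOp_coe (K := K) χ hχ f, ae_restrict_mem measurableSet_Ioi] with x h1 h2 h3 hx
  rw [h3, h x hx, ← smul_smul, ← h2]
  exact h1

theorem mulOp_add {φ ψ χ : ℝ → ℂ} (hφ : MemLp φ ∞ halfLine) (hψ : MemLp ψ ∞ halfLine)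
    (hχ : MemLp χ ∞ halfLine) (h : ∀ x, 0 < x → χ x = φ x + ψ x) :
    mulOp K φ hφ + mulOp K ψ hψ = mulOp K χ hχ := by
  ext1 f
  apply Lp.ext
  filter_upwards [mulOp_coe (K := K) φ hφ f, mulOp_coe (K := K) ψ hψ f,
    mulOp_coe (K := K) χ hχ f, Lp.coeFn_add (mulOp K φ hφ f) (mulOp K ψ hψ f),
    ae_restrict_mem measurableSet_Ioi] with x h1 h2 h3 h4 hx
  rw [h3, h x hx, add_smul, ← h1, ← h2]
  exact h4

theorem mulOp_ampl {φ : ℝ → ℂ} (hφ : MemLp φ ∞ halfLine) (A : Op K) :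
    mulOp K φ hφ * ampl A = ampl A * mulOp K φ hφ := by
  ext1 f
  apply Lp.ext
  filter_upwards [ampl_coe A (mulOp K φ hφ f), mulOp_coe (K := K) φ hφ f,
    mulOp_coe (K := K) φ hφ (ampl A f), ampl_coe A f] with x h1 h2 h3 h4
  change (mulOp K φ hφ (ampl A f) : ℝ → K) x = (ampl A (mulOp K φ hφ f) : ℝ → K) x
  rw [h1, h3, h4, h2, map_smul]

theorem mulOp_norm_le {φ : ℝ → ℂ} (hφ : MemLp φ ∞ halfLine) {c : ℝ}
    (h : ∀ x, 0 < x → ‖φ x‖ ≤ c) (f : KL2 K) : ‖mulOp K φ hφ f‖ ≤ c * ‖f‖ := by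
  refine Lp.norm_le_mul_norm_of_ae_le_mul ?_
  filter_upwards [mulOp_coe (K := K) φ hφ f, ae_restrict_mem measurableSet_Ioi] with x h1 hx
  rw [h1, norm_smul]
  gcongr
  exact h x hx

theorem star_mulOp [CompleteSpace K] {φ : ℝ → ℂ} (hφ : MemLp φ ∞ halfLine)
    (h : ∀ x, (starRingEnd ℂ) (φ x) = φ x) : star (mulOp K φ hφ) = mulOp K φ hφ := by
  rw [ContinuousLinearMap.star_eq_adjoint, eq_comm, ContinuousLinearMap.eq_adjoint_iff]
  intro f g
  rw [L2.inner_def, L2.inner_def]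
  refine integral_congr_ae ?_
  filter_upwards [mulOp_coe (K := K) _ hφ f, mulOp_coe (K := K) _ hφ g] with x h1 h2
  rw [h1, h2, inner_smul_left, inner_smul_right, h]

theorem ampl_mul (A B : Op K) : ampl (A * B) = ampl A * ampl B := by
  ext1 f
  apply Lp.ext
  filter_upwards [ampl_coe (A * B) f, ampl_coe A (ampl B f), ampl_coe B f] with x h1 h2 h3
  rw [h1]
  change _ = (ampl A (ampl B f) : ℝ → K) x
  rw [h2, h3]
  rfl

theorem ampl_one : ampl (1 : Op K) = 1 := by
  ext1 f
  apply Lp.ext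
  filter_upwards [ampl_coe (1 : Op K) f] with x h1
  rw [h1]
  rfl

theorem ampl_add (A B : Op K) : ampl (A + B) = ampl A + ampl B :=
  ContinuousLinearMap.add_compLpL A B

theorem ampl_smul (c : ℂ) (A : Op K) : ampl (c • A) = c • ampl A :=
  ContinuousLinearMap.smul_compLpL c A

theorem ampl_sub (A B : Op K) : ampl (A - B) = ampl A - ampl B := by
  have h : A - B = A + (-1 : ℂ) • B := by simp [sub_eq_add_neg]
  rw [h, ampl_add, ampl_smul]
  simp [sub_eq_add_neg]

theorem ampl_zero : ampl (0 : Op K) = 0 := by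
  simpa using ampl_smul (0 : ℂ) (0 : Op K)

theorem star_ampl [CompleteSpace K] (A : Op K) : star (ampl A) = ampl (star A) := by
  rw [ContinuousLinearMap.star_eq_adjoint, eq_comm, ContinuousLinearMap.eq_adjoint_iff]
  intro f g
  rw [L2.inner_def, L2.inner_def]
  refine integral_congr_ae ?_
  filter_upwards [ampl_coe (star A) f, ampl_coe A g] with x h1 h2
  rw [h1, h2, ContinuousLinearMap.star_eq_adjoint, ContinuousLinearMap.adjoint_inner_left]

theorem memLp_halfExp : MemLp (fun x : ℝ => ((Real.exp (-x / 2) : ℝ) : ℂ)) ∞ halfLine := by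
  refine memLp_top_of_bound (by fun_prop) 1 ?_
  filter_upwards [ae_restrict_mem measurableSet_Ioi] with x hx
  have hx' : (0 : ℝ) < x := hx
  rw [Complex.norm_real, Real.norm_eq_abs, abs_of_pos (Real.exp_pos _)]
  exact Real.exp_le_one_iff.2 (by linarith)

/-- `Λ^{1/2}`. -/
noncomputable def rootLam (K : Type*) [NormedAddCommGroup K] [InnerProductSpace ℂ K] :
    Op (KL2 K) := mulOp K _ memLp_halfExp

/-- `E(t,∞) (I - Λ)^{-1/2}`. -/
noncomputable def invRoot (K : Type*) [NormedAddCommGroup K] [InnerProductSpace ℂ K] (t : ℝ)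
    (ht : 0 < t) : Op (KL2 K) := mulOp K _ (memLp_invSqrt t ht)

/-- `E(t,∞) Λ^{1/2} (I - Λ)^{-1/2}`. -/
noncomputable def ratio (K : Type*) [NormedAddCommGroup K] [InnerProductSpace ℂ K] (t : ℝ)
    (ht : 0 < t) : Op (KL2 K) := invRoot K t ht * rootLam K

/-- The symmetric splitting lets the cut-off weight of `Λ(A)` be written as a sesquilinear form in
`D_t`-images. -/
theorem Lam_eq (A : Op K) : Lam A = rootLam K * ampl A * rootLam K := by
  have h : mulOp K _ memLp_exp = rootLam K * rootLam K := by
    refine (mulOp_mul _ _ _ fun x _ => ?_).symm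
    rw [← Complex.ofReal_mul, ← Real.exp_add]
    ring_nf
  change mulOp K _ memLp_exp * ampl A = _
  rw [h, mul_assoc, mul_assoc]
  congr 1
  exact mulOp_ampl _ A

theorem rootD_mul_invRoot (t : ℝ) (ht : 0 < t) : rootD K * invRoot K t ht = tailProj K t :=
  (tailProj_eq t ht).1.symm

theorem invRoot_mul_rootD (t : ℝ) (ht : 0 < t) : invRoot K t ht * rootD K = tailProj K t :=
  (tailProj_eq t ht).2.symm

theorem tailProj_mul_invRoot {s t : ℝ} (hs : 0 < s) (ht : 0 < t) (h : t ≤ s) :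
    tailProj K s * invRoot K t ht = invRoot K s hs := by
  refine mulOp_mul _ _ _ fun x _ => ?_
  by_cases hx : x ∈ Set.Ioi s
  · rw [Set.indicator_of_mem hx, Set.indicator_of_mem hx, Set.indicator_of_mem, one_mul]
    exact lt_of_le_of_lt h hx
  · rw [Set.indicator_of_notMem hx, Set.indicator_of_notMem hx, zero_mul]

theorem tailProj_mul_ratio {s t : ℝ} (hs : 0 < s) (ht : 0 < t) (h : t ≤ s) :
    tailProj K s * ratio K t ht = ratio K s hs := by
  rw [ratio, ← mul_assoc, tailProj_mul_invRoot hs ht h, ratio]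

theorem tailProj_mul_self (t : ℝ) : tailProj K t * tailProj K t = tailProj K t := by
  refine mulOp_mul _ _ _ fun x _ => ?_
  by_cases hx : x ∈ Set.Ioi t
  · simp [Set.indicator_of_mem hx]
  · simp [Set.indicator_of_notMem hx]

theorem ratio_eq_mul (t : ℝ) (ht : 0 < t) : ratio K t ht = rootLam K * invRoot K t ht := by
  have h : MemLp (fun x => (Set.Ioi t).indicator
      (fun x : ℝ => (((Real.sqrt (1 - Real.exp (-x)))⁻¹ : ℝ) : ℂ)) x *
        ((Real.exp (-x / 2) : ℝ) : ℂ)) ∞ halfLine :=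
    memLp_halfExp.mul (memLp_invSqrt t ht)
  exact (mulOp_mul _ _ h fun x _ => rfl).trans (mulOp_mul _ _ h fun x _ => mul_comm _ _).symm

theorem rootD_mul_rootLam : rootD K * rootLam K = rootLam K * rootD K := by
  have h : MemLp (fun x => ((Real.sqrt (1 - Real.exp (-x)) : ℝ) : ℂ) *
        ((Real.exp (-x / 2) : ℝ) : ℂ)) ∞ halfLine :=
    memLp_halfExp.mul memLp_sqrt
  exact (mulOp_mul _ _ h fun x _ => rfl).trans (mulOp_mul _ _ h fun x _ => mul_comm _ _).symm

/-- The identity `1/(1 - e^{-x}) = 1 + e^{-x}/(1 - e^{-x})` on `(t,∞)`. It shows that `(I -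
Λ)^{-1/2}` and `Λ^{1/2}(I - Λ)^{-1/2}` blow up at `0` together, up to a bounded term. -/
theorem invRoot_mul_invRoot (t : ℝ) (ht : 0 < t) :
    invRoot K t ht * invRoot K t ht = tailProj K t + ratio K t ht * ratio K t ht := by
  have h1 : MemLp (fun x => (Set.Ioi t).indicator
      (fun x : ℝ => (((Real.sqrt (1 - Real.exp (-x)))⁻¹ : ℝ) : ℂ)) x *
        ((Real.exp (-x / 2) : ℝ) : ℂ)) ∞ halfLine :=
    memLp_halfExp.mul (memLp_invSqrt t ht)
  have h2 := h1.mul (r := ∞) h1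
  have h3 := (memLp_invSqrt t ht).mul (r := ∞) (memLp_invSqrt t ht)
  have e1 : ratio K t ht = mulOp K _ h1 := mulOp_mul _ _ h1 fun x _ => rfl
  have e2 : ratio K t ht * ratio K t ht = mulOp K _ h2 := by
    rw [e1]
    exact mulOp_mul _ _ h2 fun x _ => rfl
  have e3 : invRoot K t ht * invRoot K t ht = mulOp K _ h3 := mulOp_mul _ _ h3 fun x _ => rfl
  rw [e2, e3]
  refine (mulOp_add _ _ _ fun x hx => ?_).symm
  simp only [Pi.mul_apply]
  by_cases hxt : x ∈ Set.Ioi t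
  · simp only [Set.indicator_of_mem hxt, ← Complex.ofReal_mul]
    rw [← Complex.ofReal_one, ← Complex.ofReal_add]
    congr 1
    have hp : 0 < 1 - Real.exp (-x) := by
      have : Real.exp (-x) < 1 := Real.exp_lt_one_iff.2 (by linarith)
      linarith
    have hs := Real.mul_self_sqrt hp.le
    have hs0 := (Real.sqrt_pos.2 hp).ne'
    have he : Real.exp (-x / 2) * Real.exp (-x / 2) = Real.exp (-x) := by
      rw [← Real.exp_add]; ring_nf
    have hr : (Real.sqrt (1 - Real.exp (-x)))⁻¹ * (Real.sqrt (1 - Real.exp (-x)))⁻¹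
        * (1 - Real.exp (-x)) = 1 := by
      nth_rewrite 3 [← hs]
      field_simp
    linear_combination hr - (Real.sqrt (1 - Real.exp (-x)))⁻¹
      * (Real.sqrt (1 - Real.exp (-x)))⁻¹ * he
  · simp [Set.indicator_of_notMem hxt]

theorem rootLam_norm_le (f : KL2 K) : ‖rootLam K f‖ ≤ ‖f‖ := by
  refine (mulOp_norm_le _ (c := 1) (fun x hx => ?_) f).trans_eq (one_mul _)
  rw [Complex.norm_real, Real.norm_eq_abs, abs_of_pos (Real.exp_pos _)]
  exact Real.exp_le_one_iff.2 (by linarith)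

theorem tailProj_norm_le (t : ℝ) (f : KL2 K) : ‖tailProj K t f‖ ≤ ‖f‖ := by
  refine (mulOp_norm_le _ (c := 1) (fun x hx => ?_) f).trans_eq (one_mul _)
  by_cases hx : x ∈ Set.Ioi t
  · simp [Set.indicator_of_mem hx]
  · simp [Set.indicator_of_notMem hx]

section Complete

variable [CompleteSpace K]

theorem star_rootLam : star (rootLam K) = rootLam K :=
  star_mulOp _ fun x => Complex.conj_ofReal _

theorem star_tailProj (t : ℝ) : star (tailProj K t) = tailProj K t :=
  star_mulOp _ fun x => by
    by_cases hx : x ∈ Set.Ioi t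
    · simp [Set.indicator_of_mem hx]
    · simp [Set.indicator_of_notMem hx]

theorem star_invRoot (t : ℝ) (ht : 0 < t) : star (invRoot K t ht) = invRoot K t ht :=
  star_mulOp _ fun x => by
    by_cases hx : x ∈ Set.Ioi t
    · rw [Set.indicator_of_mem hx, Complex.conj_ofReal]
    · simp [Set.indicator_of_notMem hx]

theorem star_ratio (t : ℝ) (ht : 0 < t) : star (ratio K t ht) = ratio K t ht := by
  rw [ratio, star_mul, star_rootLam, star_invRoot, ← ratio_eq_mul, ratio]

end Complete

theorem ratio_mul_rootD (t : ℝ) (ht : 0 < t) :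
    ratio K t ht * rootD K = tailProj K t * rootLam K := by
  rw [ratio, mul_assoc, ← rootD_mul_rootLam, ← mul_assoc, invRoot_mul_rootD]

theorem ampl_mul_invRoot (A : Op K) (t : ℝ) (ht : 0 < t) :
    ampl A * invRoot K t ht = invRoot K t ht * ampl A := (mulOp_ampl _ A).symm

theorem ampl_mul_ratio (A : Op K) (t : ℝ) (ht : 0 < t) :
    ampl A * ratio K t ht = ratio K t ht * ampl A := by
  rw [ratio, ← mul_assoc, ampl_mul_invRoot, mul_assoc, mul_assoc]
  congr 1
  exact (mulOp_ampl _ A).symm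

/-- A sequence decreasing to `0`. -/
noncomputable def cut (n : ℕ) : ℝ := 1 / ((n : ℝ) + 1)

theorem cut_pos (n : ℕ) : 0 < cut n := Nat.one_div_pos_of_nat

theorem tendsto_cut : Filter.Tendsto cut Filter.atTop (nhds 0) :=
  tendsto_one_div_add_atTop_nhds_zero_nat

theorem cut_anti : Antitone cut := fun _ _ h => Nat.one_div_le_one_div h

/-- Dominated convergence: the integrand is `‖f x‖²` on `(0, cut n]` and zero elsewhere. -/
theorem tendsto_tailProj (f : KL2 K) :
    Filter.Tendsto (fun n => tailProj K (cut n) f) Filter.atTop (nhds f) := by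
  rw [tendsto_iff_norm_sub_tendsto_zero]
  have h1 : ∀ n, ‖tailProj K (cut n) f - f‖ ^ 2
      = ∫ x, ‖(tailProj K (cut n) f - f : KL2 K) x‖ ^ 2 ∂halfLine := by
    intro n
    have h2 : ((‖tailProj K (cut n) f - f‖ ^ 2 : ℝ) : ℂ)
        = ((∫ x, ‖(tailProj K (cut n) f - f : KL2 K) x‖ ^ 2 ∂halfLine : ℝ) : ℂ) := by
      rw [← integral_complex_ofReal, Complex.ofReal_pow]
      have h3 := inner_self_eq_norm_sq_to_K (𝕜 := ℂ) (tailProj K (cut n) f - f)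
      rw [L2.inner_def] at h3
      refine Eq.trans h3.symm (integral_congr_ae (.of_forall fun x => ?_))
      have h4 := inner_self_eq_norm_sq_to_K (𝕜 := ℂ) ((tailProj K (cut n) f - f : KL2 K) x)
      simpa using h4
    exact_mod_cast h2
  have hlim : Filter.Tendsto (fun n => ‖tailProj K (cut n) f - f‖ ^ 2) Filter.atTop (nhds 0) := by
    simp only [h1]
    have hz : (0 : ℝ) = ∫ _x : ℝ, (0 : ℝ) ∂halfLine := by simp
    rw [hz]
    have hsub : ∀ᵐ x ∂halfLine, ∀ n, (tailProj K (cut n) f - f : KL2 K) x =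
        (Set.Ioi (cut n)).indicator (fun _ : ℝ => (1 : ℂ)) x • f x - f x := by
      rw [ae_all_iff]
      intro n
      filter_upwards [Lp.coeFn_sub (tailProj K (cut n) f) f,
        mulOp_coe (K := K) _ (memLp_tail (cut n)) f] with x h1 h2
      rw [h1, Pi.sub_apply]
      congr 1
    refine tendsto_integral_of_dominated_convergence (fun x => ‖f x‖ ^ 2) (fun n => ?_) ?_
      (fun n => ?_) ?_
    · exact (Lp.aestronglyMeasurable _).norm.pow 2
    · exact (Lp.memLp f).integrable_norm_pow (by norm_num)
    · filter_upwards [hsub] with x hx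
      rw [hx n, Real.norm_eq_abs, abs_of_nonneg (by positivity)]
      by_cases hxt : x ∈ Set.Ioi (cut n)
      · simp [Set.indicator_of_mem hxt]
      · simp [Set.indicator_of_notMem hxt]
    · filter_upwards [hsub, ae_restrict_mem measurableSet_Ioi] with x hx hx0
      refine tendsto_const_nhds.congr' ?_
      filter_upwards [tendsto_cut.eventually_lt_const (show (0 : ℝ) < x from hx0)] with n hn
      rw [hx n, Set.indicator_of_mem (show x ∈ Set.Ioi (cut n) from hn)]
      simp
  have := hlim.sqrt
  simpa [Real.sqrt_sq (norm_nonneg _)] using this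

theorem tendsto_amp_tailProj (x : SeqL2 (KL2 K)) :
    Filter.Tendsto (fun n => amp (tailProj K (cut n)) x) Filter.atTop (nhds x) := by
  rw [tendsto_iff_norm_sub_tendsto_zero]
  have hlim : Filter.Tendsto (fun n => ‖amp (tailProj K (cut n)) x - x‖ ^ 2) Filter.atTop
      (nhds (∑' _k : ℕ, (0 : ℝ))) := by
    have h1 : ∀ n, ‖amp (tailProj K (cut n)) x - x‖ ^ 2
        = ∑' k, ‖tailProj K (cut n) (x k) - x k‖ ^ 2 := fun n => by
      rw [← (SeqL2.hasSum_sq _).tsum_eq]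
      simp
    simp only [h1]
    refine tendsto_tsum_of_dominated_convergence (bound := fun k => (2 * ‖x k‖) ^ 2) ?_ ?_ ?_
    · simp only [mul_pow]
      exact x.summable_sq.mul_left _
    · intro k
      have := (tendsto_iff_norm_sub_tendsto_zero.1 (tendsto_tailProj (x k))).pow 2
      simpa using this
    · refine .of_forall fun n k => ?_
      rw [Real.norm_eq_abs, abs_of_nonneg (by positivity)]
      gcongr
      refine (norm_sub_le _ _).trans ?_
      linarith [tailProj_norm_le (cut n) (x k)]
  have := hlim.sqrt
  simpa [Real.sqrt_sq (norm_nonneg _)] using this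

end Multiplication

end QWeight

namespace QWeight

/-! ### Boundary weights given by vectors in `H ⊗ ℓ²` -/

section VectorWeights

variable {K : Type*} [NormedAddCommGroup K] [InnerProductSpace ℂ K]

theorem amp_contraction {E : Type*} [NormedAddCommGroup E] [InnerProductSpace ℂ E] {B : Op E}
    (h : ∀ f, ‖B f‖ ≤ ‖f‖) (x : SeqL2 E) : ‖amp B x‖ ≤ ‖x‖ := by
  refine (amp_norm_le B x).trans ?_
  have : ‖B‖ ≤ 1 := B.opNorm_le_bound zero_le_one fun f => by simpa using h f
  nlinarith [norm_nonneg x]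

theorem amp_amp (A B : Op (KL2 K)) (x : SeqL2 (KL2 K)) : amp A (amp B x) = amp (A * B) x :=
  (amp_mul_apply A B x).symm

theorem amp_tailProj_norm_le (t : ℝ) (x : SeqL2 (KL2 K)) : ‖amp (tailProj K t) x‖ ≤ ‖x‖ :=
  amp_contraction (E := KL2 K) (B := tailProj K t) (tailProj_norm_le t) x

theorem amp_rootLam_norm_le (x : SeqL2 (KL2 K)) : ‖amp (rootLam K) x‖ ≤ ‖x‖ :=
  amp_contraction (E := KL2 K) (B := rootLam K) rootLam_norm_le x

/-- The operator `A ⊗ I ⊗ I` on `K ⊗ L²(0,∞) ⊗ ℓ²`. -/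
noncomputable def hat (A : Op K) : Op (SeqL2 (KL2 K)) := amp (ampl A)

theorem hat_mul_apply (A B : Op K) (x : SeqL2 (KL2 K)) : hat (A * B) x = hat A (hat B x) := by
  rw [hat, ampl_mul, amp_mul_apply]; rfl

theorem hat_one_apply (x : SeqL2 (KL2 K)) : hat (1 : Op K) x = x := by
  rw [hat, ampl_one, amp_one]; rfl

theorem hat_zero_apply (x : SeqL2 (KL2 K)) : hat (0 : Op K) x = 0 := by
  rw [hat, ampl_zero]; ext n; simp

theorem hat_sub_apply (A B : Op K) (x : SeqL2 (KL2 K)) : hat (A - B) x = hat A x - hat B x := by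
  rw [hat, ampl_sub, amp_sub]; rfl

theorem hat_smul_apply (c : ℂ) (A : Op K) (x : SeqL2 (KL2 K)) : hat (c • A) x = c • hat A x := by
  rw [hat, ampl_smul, amp_smul]; rfl

theorem hat_norm_le (A : Op K) (x : SeqL2 (KL2 K)) : ‖hat A x‖ ≤ ‖A‖ * ‖x‖ := by
  refine (amp_norm_le _ x).trans ?_
  gcongr
  exact ContinuousLinearMap.norm_compLpL_le A

/-- The operator `E(t,∞) Λ^{1/2} (I - Λ)^{-1/2} ⊗ I` on `K ⊗ L²(0,∞) ⊗ ℓ²`. -/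
noncomputable def seqRatio (t : ℝ) (ht : 0 < t) : Op (SeqL2 (KL2 K)) := amp (ratio K t ht)

/-- The operator `E(t,∞) (I - Λ)^{-1/2} ⊗ I` on `K ⊗ L²(0,∞) ⊗ ℓ²`. -/
noncomputable def seqInvRoot (t : ℝ) (ht : 0 < t) : Op (SeqL2 (KL2 K)) := amp (invRoot K t ht)

theorem hat_seqRatio (A : Op K) (t : ℝ) (ht : 0 < t) (x : SeqL2 (KL2 K)) :
    hat A (seqRatio t ht x) = seqRatio t ht (hat A x) := by
  rw [hat, seqRatio, amp_amp, amp_amp, ampl_mul_ratio]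

theorem hat_seqInvRoot (A : Op K) (t : ℝ) (ht : 0 < t) (x : SeqL2 (KL2 K)) :
    hat A (seqInvRoot t ht x) = seqInvRoot t ht (hat A x) := by
  rw [hat, seqInvRoot, amp_amp, amp_amp, ampl_mul_invRoot]

theorem seqRatio_anti {s t : ℝ} (hs : 0 < s) (ht : 0 < t) (h : t ≤ s) (x : SeqL2 (KL2 K)) :
    ‖seqRatio s hs x‖ ≤ ‖seqRatio t ht x‖ := by
  rw [seqRatio, ← tailProj_mul_ratio hs ht h, amp_mul_apply]
  exact amp_tailProj_norm_le s _

/-- `D_t (I - Λ)^{1/2} = E(t,∞) Λ^{1/2}` is a contraction. This is the converse of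
`exists_rootD_eq`. -/
theorem seqRatio_rootD (t : ℝ) (ht : 0 < t) (u : SeqL2 (KL2 K)) :
    ‖seqRatio t ht (amp (rootD K) u)‖ ≤ ‖u‖ := by
  rw [seqRatio, amp_amp, ratio_mul_rootD, amp_mul_apply]
  exact (amp_tailProj_norm_le t _).trans (amp_rootLam_norm_le _)

section Complete

variable [CompleteSpace K]

theorem hat_inner_left (A : Op K) (x y : SeqL2 (KL2 K)) :
    ⟪hat A x, y⟫_ℂ = ⟪x, hat (star A) y⟫_ℂ := by
  rw [hat, amp_inner_left, star_ampl, hat]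

theorem hat_inner_right (A : Op K) (x y : SeqL2 (KL2 K)) :
    ⟪x, hat A y⟫_ℂ = ⟪hat (star A) x, y⟫_ℂ := by
  rw [hat_inner_left, star_star]

theorem seqInvRoot_sq (t : ℝ) (ht : 0 < t) (x : SeqL2 (KL2 K)) :
    ‖seqInvRoot t ht x‖ ^ 2 = ‖amp (tailProj K t) x‖ ^ 2 + ‖seqRatio t ht x‖ ^ 2 := by
  have h : ⟪seqInvRoot t ht x, seqInvRoot t ht x⟫_ℂ =
      ⟪amp (tailProj K t) x, amp (tailProj K t) x⟫_ℂ + ⟪seqRatio t ht x, seqRatio t ht x⟫_ℂ := by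
    rw [seqInvRoot, seqRatio, amp_inner_left, amp_inner_left, amp_inner_left, star_invRoot,
      star_ratio, star_tailProj, amp_amp, amp_amp, amp_amp,
      invRoot_mul_invRoot, tailProj_mul_self, amp_add, ← inner_add_right]
    rfl
  simp only [inner_self_eq_norm_sq_to_K] at h
  exact_mod_cast h

theorem seqRatio_le_seqInvRoot (t : ℝ) (ht : 0 < t) (x : SeqL2 (KL2 K)) :
    ‖seqRatio t ht x‖ ^ 2 ≤ ‖seqInvRoot t ht x‖ ^ 2 := by
  rw [seqInvRoot_sq]; nlinarith [sq_nonneg ‖amp (tailProj K t) x‖]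

/-- The preimage is the limit of the truncations `E(t,∞)(I - Λ)^{-1/2} p`. By `seqInvRoot_sq` their
norms are bounded by `‖p‖² + R`, and as projections of one another they satisfy Pythagoras, so
increasing bounded norms make them a Cauchy sequence. -/
theorem exists_rootD_eq {p : SeqL2 (KL2 K)} {R : ℝ}
    (h : ∀ n, ‖seqRatio (cut n) (cut_pos n) p‖ ^ 2 ≤ R) :
    ∃ u : SeqL2 (KL2 K), p = amp (rootD K) u := by
  set v : ℕ → SeqL2 (KL2 K) := fun n => seqInvRoot (cut n) (cut_pos n) p with hv
  have hE : ∀ {n m}, n ≤ m → amp (tailProj K (cut n)) (v m) = v n := by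
    intro n m hnm
    simp only [hv, seqInvRoot]
    rw [amp_amp, tailProj_mul_invRoot (cut_pos n) (cut_pos m) (cut_anti hnm)]
  have hdist : ∀ {n m}, n ≤ m → ‖v m - v n‖ ^ 2 = ‖v m‖ ^ 2 - ‖v n‖ ^ 2 := by
    intro n m hnm
    have h1 : RCLike.re ⟪v m, v n⟫_ℂ = ‖v n‖ ^ 2 := by
      rw [← hE hnm]
      nth_rewrite 1 [← tailProj_mul_self, ← star_tailProj]
      rw [amp_mul_apply, star_tailProj, ← star_tailProj, ← amp_inner_left, star_tailProj]
      exact inner_self_eq_norm_sq _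
    rw [norm_sub_sq (𝕜 := ℂ), h1]
    ring
  have hmono : Monotone fun n => ‖v n‖ ^ 2 := by
    intro n m hnm
    have := hdist hnm
    have h2 := sq_nonneg ‖v m - v n‖
    simp only
    linarith
  have hbdd : BddAbove (Set.range fun n => ‖v n‖ ^ 2) := by
    refine ⟨‖p‖ ^ 2 + R, ?_⟩
    rintro _ ⟨n, rfl⟩
    simp only [hv]
    rw [seqInvRoot_sq]
    gcongr
    · exact amp_tailProj_norm_le _ _
    · exact h n
  have hc : CauchySeq v := by
    have hc0 := (tendsto_atTop_ciSup hmono hbdd).cauchySeq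
    rw [Metric.cauchySeq_iff'] at hc0 ⊢
    intro ε hε
    obtain ⟨N, hN⟩ := hc0 (ε ^ 2) (by positivity)
    refine ⟨N, fun n hn => ?_⟩
    have h1 := hN n hn
    rw [Real.dist_eq, ← hdist hn, abs_of_nonneg (by positivity)] at h1
    rw [dist_eq_norm]
    exact lt_of_pow_lt_pow_left₀ 2 hε.le h1
  obtain ⟨u, hu⟩ := cauchySeq_tendsto_of_complete hc
  refine ⟨u, ?_⟩
  have h1 := ((amp (rootD K)).continuous.tendsto u).comp hu
  have h2 : (amp (rootD K)) ∘ v = fun n => amp (tailProj K (cut n)) p := by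
    funext n
    simp only [Function.comp, hv, seqInvRoot]
    rw [amp_amp, rootD_mul_invRoot]
  rw [h2] at h1
  exact tendsto_nhds_unique (tendsto_amp_tailProj p) h1

theorem tendsto_inner_tailProj (x y : SeqL2 (KL2 K)) (B : Op (KL2 K)) :
    Filter.Tendsto
      (fun n => ⟪x, amp (tailProj K (cut n) * B * tailProj K (cut n)) y⟫_ℂ) Filter.atTop
      (nhds ⟪x, amp B y⟫_ℂ) := by
  have h := (tendsto_amp_tailProj x).inner (𝕜 := ℂ)
    (((amp B).continuous.tendsto y).comp (tendsto_amp_tailProj y))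
  refine h.congr fun n => ?_
  simp only [Function.comp]
  rw [amp_inner_left, star_tailProj, amp_amp, amp_amp, mul_assoc]

end Complete

theorem coe_toBdry (B : Op (KL2 K)) : (toBdry B : Op (KL2 K)) = rootD K * B * rootD K := by
  change sandwich K B = _
  simp [sandwich]

theorem coe_cutoff (t : ℝ) (ht : 0 < t) (A : Op (KL2 K)) :
    (cutoff t ht A : Op (KL2 K)) = tailProj K t * A * tailProj K t := by
  simp [cutoff]

theorem coe_compress (E F : Op K) (A : BdryAlg K) :
    (compress E F A : Op (KL2 K)) = ampl E * (A : Op (KL2 K)) * ampl F := by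
  simp [compress]

theorem cutoff_eq (t : ℝ) (ht : 0 < t) (A : Op (KL2 K)) :
    cutoff t ht A = toBdry (invRoot K t ht * A * invRoot K t ht) := by
  ext1
  rw [coe_cutoff, coe_toBdry]
  nth_rewrite 1 [← rootD_mul_invRoot t ht]
  rw [← invRoot_mul_rootD t ht]
  simp only [mul_assoc]

theorem compress_toBdry (E F : Op K) (B : Op (KL2 K)) :
    compress E F (toBdry B) = toBdry (ampl E * B * ampl F) := by
  ext1
  rw [coe_compress, coe_toBdry, coe_toBdry]
  calc _ = (ampl E * rootD K) * B * (rootD K * ampl F) := by simp only [mul_assoc]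
    _ = _ := by rw [ampl_mul_rootD, ← ampl_mul_rootD F]; simp only [mul_assoc]

theorem bdryStar_toBdry [CompleteSpace K] (B : Op (KL2 K)) :
    bdryStar (toBdry B) = toBdry (star B) := by
  ext1
  change star (toBdry B : Op (KL2 K)) = _
  rw [coe_toBdry, coe_toBdry, star_mul, star_mul, adjoint_rootD, mul_assoc]

theorem oneSubLam_eq : oneSubLam K = toBdry 1 := by
  ext1
  rw [coe_toBdry, mul_one, rootD_mul_rootD]
  rfl

theorem toBdry_surjective : Function.Surjective (toBdry (K := K)) :=
  LinearMap.surjective_rangeRestrict _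

theorem tail_sandwich (B : Op (KL2 K)) (t : ℝ) (ht : 0 < t) :
    invRoot K t ht * (rootD K * B * rootD K) * invRoot K t ht
      = tailProj K t * B * tailProj K t := by
  nth_rewrite 1 [← invRoot_mul_rootD t ht]
  rw [← rootD_mul_invRoot t ht]
  simp only [mul_assoc]

theorem cutoff_coe (A : BdryAlg K) (t : ℝ) (ht : 0 < t) (B : Op (KL2 K)) (h : A = toBdry B) :
    cutoff t ht (A : Op (KL2 K)) = toBdry (tailProj K t * B * tailProj K t) := by
  rw [cutoff_eq, h, coe_toBdry, tail_sandwich]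

/-- `(I - Λ)^{1/2}` has no bounded inverse, but it has one on each tail, and the tail projections
tend strongly to the identity. -/
theorem toBdry_injective [CompleteSpace K] : Function.Injective (toBdry (K := K)) := by
  refine (injective_iff_map_eq_zero _).2 fun B hB => ?_
  have h0 : ∀ n, tailProj K (cut n) * B * tailProj K (cut n) = 0 := by
    intro n
    rw [← tail_sandwich B _ (cut_pos n), ← coe_toBdry, hB]
    simp
  ext1 f
  refine ext_inner_left ℂ fun g => ?_
  have h1 := (tendsto_tailProj g).inner (𝕜 := ℂ)
    ((B.continuous.tendsto f).comp (tendsto_tailProj f))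
  refine tendsto_nhds_unique h1 ?_
  have h2 : ∀ n, ⟪tailProj K (cut n) g, (B ∘ fun n => tailProj K (cut n) f) n⟫_ℂ
      = ⟪g, (0 : Op (KL2 K)) f⟫_ℂ := by
    intro n
    rw [← h0 n]
    nth_rewrite 1 [← star_tailProj]
    rw [ContinuousLinearMap.star_eq_adjoint, ContinuousLinearMap.adjoint_inner_left]
    rfl
  simp only [h2]
  exact tendsto_const_nhds

variable [CompleteSpace K]

/-- The linear bijection `B ↦ (I - Λ)^{1/2} B (I - Λ)^{1/2}` as a linear equivalence. -/
noncomputable def toBdryEquiv : Op (KL2 K) ≃ₗ[ℂ] BdryAlg K :=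
  LinearEquiv.ofBijective toBdry ⟨toBdry_injective, toBdry_surjective⟩

/-- The functional `(I - Λ)^{1/2} B (I - Λ)^{1/2} ↦ ∑ (xₙ, B yₙ)` on `𝔄(H)`. -/
noncomputable def vecWeight (x y : SeqL2 (KL2 K)) : Module.Dual ℂ (BdryAlg K) :=
  { toFun := fun B => ⟪x, amp B y⟫_ℂ
    map_add' := fun A B => by rw [amp_add, ← inner_add_right]; rfl
    map_smul' := fun c A => by rw [amp_smul, RingHom.id_apply, smul_eq_mul, ← inner_smul_right]; rfl
    : Op (KL2 K) →ₗ[ℂ] ℂ } ∘ₗ toBdryEquiv.symm.toLinearMap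

theorem vecWeight_toBdry (x y : SeqL2 (KL2 K)) (B : Op (KL2 K)) :
    vecWeight x y (toBdry B) = ⟪x, amp B y⟫_ℂ := by
  change ⟪x, amp (toBdryEquiv.symm (toBdryEquiv B)) y⟫_ℂ = _
  rw [LinearEquiv.symm_apply_apply]

theorem eq_vecWeight_iff {φ : Module.Dual ℂ (BdryAlg K)} {x y : SeqL2 (KL2 K)} :
    φ = vecWeight x y ↔ ∀ B, φ (toBdry B) = ⟪x, amp B y⟫_ℂ := by
  constructor
  · rintro rfl B; exact vecWeight_toBdry x y B
  · intro h
    ext A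
    obtain ⟨B, rfl⟩ := toBdry_surjective A
    rw [h, vecWeight_toBdry]

theorem isBoundaryWeight_iff {φ : Module.Dual ℂ (BdryAlg K)} :
    IsBoundaryWeight φ ↔ ∃ x y, φ = vecWeight x y := by
  simp only [IsBoundaryWeight, isNormalFunctional_iff, eq_vecWeight_iff, LinearMap.comp_apply]

theorem isBoundaryWeight_vecWeight (x y : SeqL2 (KL2 K)) : IsBoundaryWeight (vecWeight x y) :=
  isBoundaryWeight_iff.2 ⟨x, y, rfl⟩

theorem IsBoundaryWeight.smul {φ : Module.Dual ℂ (BdryAlg K)} (h : IsBoundaryWeight φ) (c : ℂ) :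
    IsBoundaryWeight (c • φ) := by
  obtain ⟨x, y, rfl⟩ := isBoundaryWeight_iff.1 h
  refine isBoundaryWeight_iff.2 ⟨x, c • y, eq_vecWeight_iff.2 fun B => ?_⟩
  rw [LinearMap.smul_apply, vecWeight_toBdry, map_smul, inner_smul_right, smul_eq_mul]

theorem IsBoundaryWeight.add {φ ψ : Module.Dual ℂ (BdryAlg K)} (hφ : IsBoundaryWeight φ)
    (hψ : IsBoundaryWeight ψ) : IsBoundaryWeight (φ + ψ) := by
  obtain ⟨x, y, hx, hy, h⟩ := hφ
  obtain ⟨x', y', hx', hy', h'⟩ := hψ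
  have key : ∀ {V : Type} [AddCommMonoid V] [TopologicalSpace V] [ContinuousAdd V]
      {F G : ℕ → V} {a b : V}, HasSum F a → HasSum G b →
      HasSum (fun n => Sum.elim F G (Equiv.natSumNatEquivNat.symm n)) (a + b) := by
    intro V _ _ _ F G a b hF hG
    exact (Equiv.hasSum_iff Equiv.natSumNatEquivNat.symm).2
      (HasSum.sum (f := Sum.elim F G) hF hG)
  refine ⟨fun n => Sum.elim x x' (Equiv.natSumNatEquivNat.symm n),
    fun n => Sum.elim y y' (Equiv.natSumNatEquivNat.symm n), ?_, ?_, fun A => ?_⟩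
  · convert (key hx.hasSum hx'.hasSum).summable using 2 with n
    simp only
    rcases Equiv.natSumNatEquivNat.symm n with k | k <;> rfl
  · convert (key hy.hasSum hy'.hasSum).summable using 2 with n
    simp only
    rcases Equiv.natSumNatEquivNat.symm n with k | k <;> rfl
  · convert key (h A) (h' A) using 2 with n
    · simp only
      rcases Equiv.natSumNatEquivNat.symm n with k | k <;> rfl
    · rfl

/-- Testing at `B = 1` shows that a representing sequence is square summable, so it is a vector of
`H ⊗ ℓ²`. -/
theorem represents_iff {f : ℕ → KL2 K} {φ : Module.Dual ℂ (BdryAlg K)} :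
    Represents f φ ↔ ∃ F : SeqL2 (KL2 K), (F : ℕ → KL2 K) = f ∧ φ = vecWeight F F := by
  constructor
  · intro h
    have h1 := ((Complex.hasSum_iff _ _).1 (h 1)).1.summable
    have hs : Summable fun n => ‖f n‖ ^ 2 := h1.congr fun n => inner_self_eq_norm_sq (𝕜 := ℂ) _
    refine ⟨⟨f, memlp_two_iff.2 hs⟩, rfl, eq_vecWeight_iff.2 fun B => ?_⟩
    exact (h B).unique (hasSum_inner_amp ⟨f, memlp_two_iff.2 hs⟩ ⟨f, memlp_two_iff.2 hs⟩ B)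
  · rintro ⟨F, rfl, rfl⟩ B
    rw [vecWeight_toBdry]
    exact hasSum_inner_amp F F B

theorem vecWeight_cutoff (x y : SeqL2 (KL2 K)) (t : ℝ) (ht : 0 < t) (A : Op (KL2 K)) :
    vecWeight x y (cutoff t ht A) = ⟪seqInvRoot t ht x, amp A (seqInvRoot t ht y)⟫_ℂ := by
  rw [cutoff_eq, vecWeight_toBdry, seqInvRoot, amp_inner_left, star_invRoot, mul_assoc,
    amp_mul_apply, amp_mul_apply]

theorem vecWeight_cutoff_Lam (x y : SeqL2 (KL2 K)) (t : ℝ) (ht : 0 < t) (A : Op K) :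
    vecWeight x y (cutoff t ht (Lam A)) = ⟪seqRatio t ht x, hat A (seqRatio t ht y)⟫_ℂ := by
  rw [cutoff_eq, vecWeight_toBdry, seqRatio, amp_inner_left, star_ratio, hat, amp_amp,
    amp_amp]
  congr 3
  rw [Lam_eq]
  nth_rewrite 1 [ratio]
  rw [ratio_eq_mul]
  simp only [mul_assoc]

theorem vecWeight_compress (x y : SeqL2 (KL2 K)) (E F : Op K) (A : BdryAlg K) :
    vecWeight x y (compress E F A) = vecWeight (hat (star E) x) (hat F y) A := by
  obtain ⟨B, rfl⟩ := toBdry_surjective A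
  rw [compress_toBdry, vecWeight_toBdry, vecWeight_toBdry, hat_inner_left, star_star, mul_assoc,
    amp_mul_apply, amp_mul_apply]
  rfl

theorem vecWeight_star (x y : SeqL2 (KL2 K)) (A : BdryAlg K) :
    star (vecWeight x y (bdryStar A)) = vecWeight y x A := by
  obtain ⟨B, rfl⟩ := toBdry_surjective A
  rw [bdryStar_toBdry, vecWeight_toBdry, vecWeight_toBdry, ← amp_inner_left]
  exact inner_conj_symm _ _

theorem vecWeight_oneSubLam (x y : SeqL2 (KL2 K)) : vecWeight x y (oneSubLam K) = ⟪x, y⟫_ℂ := by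
  rw [oneSubLam_eq, vecWeight_toBdry, amp_one]; rfl

theorem vecWeight_smul (x y : SeqL2 (KL2 K)) (c : ℂ) : vecWeight x (c • y) = c • vecWeight x y := by
  refine (eq_vecWeight_iff.2 fun B => ?_).symm
  rw [LinearMap.smul_apply, vecWeight_toBdry, map_smul, inner_smul_right, smul_eq_mul]

/-- A vector functional that vanishes on all `E(t,∞) A E(t,∞)` is `0`. -/
theorem vecWeight_eq_zero {x y : SeqL2 (KL2 K)}
    (h : ∀ n A, vecWeight x y (cutoff (cut n) (cut_pos n) A) = 0) : vecWeight x y = 0 := by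
  ext A
  obtain ⟨B, rfl⟩ := toBdry_surjective A
  rw [vecWeight_toBdry]
  refine tendsto_nhds_unique (tendsto_inner_tailProj x y B) ?_
  have : ∀ n, ⟪x, amp (tailProj K (cut n) * B * tailProj K (cut n)) y⟫_ℂ = 0 := by
    intro n
    rw [← vecWeight_toBdry, ← cutoff_coe _ _ (cut_pos n) B rfl, h]
  simp only [this]
  exact tendsto_const_nhds

end VectorWeights

end QWeight

namespace QWeight

/-! ### Complete positivity and contractivity -/

section CompletePositivity

variable {E F : Type*} [NormedAddCommGroup E] [InnerProductSpace ℂ E]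
  [NormedAddCommGroup F] [InnerProductSpace ℂ F]

theorem isCPFull_iff {Φ : Op E →ₗ[ℂ] Op F} : IsCPFull Φ ↔ ∀ (n : ℕ) (A : Fin n → Fin n → Op E),
    IsPosMatrix A → IsPosMatrix fun i j => Φ (A i j) :=
  ⟨fun h n A hA => h n (fun i j => ⟨A i j, trivial⟩) hA, fun h n A hA => h n _ hA⟩

theorem IsCPFull.add {Φ Ψ : Op E →ₗ[ℂ] Op F} (hΦ : IsCPFull Φ) (hΨ : IsCPFull Ψ) :
    IsCPFull (Φ + Ψ) := by
  rw [isCPFull_iff] at *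
  intro n A hA x
  have h := add_nonneg (hΦ n A hA x) (hΨ n A hA x)
  simp only [← Finset.sum_add_distrib, ← inner_add_right] at h
  exact h

theorem IsCPFull.inner_nonneg {Φ : Op E →ₗ[ℂ] Op F} (hΦ : IsCPFull Φ) {A : Op E}
    (hA : ∀ x, 0 ≤ ⟪x, A x⟫_ℂ) (v : F) : 0 ≤ ⟪v, Φ A v⟫_ℂ := by
  have h := isCPFull_iff.1 hΦ 1 (fun _ _ => A) (fun x => by simpa using hA (x 0)) (fun _ => v)
  simpa using h

theorem inner_self_eq_ofReal (v : E) : ⟪v, v⟫_ℂ = ((‖v‖ ^ 2 : ℝ) : ℂ) := by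
  rw [inner_self_eq_norm_sq_to_K]; simp

theorem inner_self_nonneg_complex (v : E) : 0 ≤ ⟪v, v⟫_ℂ := by
  rw [inner_self_eq_ofReal]; exact Complex.zero_le_real.2 (sq_nonneg _)

theorem isPosMatrix_dilation [CompleteSpace E] (A : Op E) :
    IsPosMatrix (E := E) ![![(‖A‖ : ℂ) • 1, A], ![star A, (‖A‖ : ℂ) • 1]] := by
  intro x
  simp only [Fin.sum_univ_two, Matrix.cons_val_zero, Matrix.cons_val_one]
  have h1 : ⟪x 1, star A (x 0)⟫_ℂ = (starRingEnd ℂ) ⟪x 0, A (x 1)⟫_ℂ := by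
    rw [ContinuousLinearMap.star_eq_adjoint, ContinuousLinearMap.adjoint_inner_right,
      inner_conj_symm]
  have h2 : ∀ v : E, ⟪v, ((‖A‖ : ℂ) • (1 : Op E)) v⟫_ℂ = ((‖A‖ * ‖v‖ ^ 2 : ℝ) : ℂ) := by
    intro v
    change ⟪v, (‖A‖ : ℂ) • v⟫_ℂ = _
    rw [inner_smul_right, inner_self_eq_ofReal, Complex.ofReal_mul]
  have h3 : |(⟪x 0, A (x 1)⟫_ℂ).re| ≤ ‖x 0‖ * (‖A‖ * ‖x 1‖) :=
    (Complex.abs_re_le_norm _).trans <| (norm_inner_le_norm _ _).trans <| by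
      gcongr; exact A.le_opNorm _
  rw [h1, h2, h2, Complex.nonneg_iff]
  constructor
  · simp only [Complex.add_re, Complex.ofReal_re, Complex.conj_re]
    have := (abs_le.1 h3).1
    nlinarith [mul_nonneg (norm_nonneg A) (sq_nonneg (‖x 0‖ - ‖x 1‖))]
  · simp only [Complex.add_im, Complex.ofReal_im, Complex.conj_im]
    ring

/-- The map is applied to the positive matrix with diagonal `‖A‖` and off-diagonal entries `A`,
`A*`; the bound at `1` then controls the off-diagonal entry. -/
theorem IsCPFull.norm_le [CompleteSpace E] {Φ : Op E →ₗ[ℂ] Op F} (hΦ : IsCPFull Φ)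
    (h1 : ∀ v, (⟪v, Φ 1 v⟫_ℂ).re ≤ ‖v‖ ^ 2) (A : Op E) : ‖Φ A‖ ≤ ‖A‖ := by
  have key : ∀ v w : F, 0 ≤ ‖A‖ * ⟪v, Φ 1 v⟫_ℂ + ⟪v, Φ A w⟫_ℂ + (⟪w, Φ (star A) v⟫_ℂ
      + ‖A‖ * ⟪w, Φ 1 w⟫_ℂ) := by
    intro v w
    have h := isCPFull_iff.1 hΦ 2 _ (isPosMatrix_dilation A) ![v, w]
    simpa only [Fin.sum_univ_two, Matrix.cons_val_zero, Matrix.cons_val_one, map_smul,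
      smul_apply, inner_smul_right] using h
  have real : ∀ v : F, (⟪v, Φ 1 v⟫_ℂ).im = 0 := fun v => by
    have h := hΦ.inner_nonneg (A := 1) inner_self_nonneg_complex v
    exact (Complex.nonneg_iff.1 h).2.symm
  have hre : ∀ v w : F, 0 ≤ ‖A‖ * (‖v‖ ^ 2 + ‖w‖ ^ 2) + 2 * (⟪v, Φ A w⟫_ℂ).re := by
    intro v w
    have e1 := (Complex.nonneg_iff.1 (key v w)).1
    -- The vanishing imaginary part at `i w` says that `⟨v, Φ(A) w⟩` and `⟨w, Φ(A*) v⟩` have the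
    -- same real part.
    have e2 := (Complex.nonneg_iff.1 (key v (Complex.I • w))).2
    simp only [map_smul, inner_smul_left, inner_smul_right, Complex.add_re, Complex.add_im,
      Complex.mul_re, Complex.mul_im, real, Complex.conj_I, Complex.I_re, Complex.I_im,
      Complex.ofReal_re, Complex.ofReal_im, Complex.neg_re, Complex.neg_im] at e1 e2
    nlinarith [mul_le_mul_of_nonneg_left (h1 v) (norm_nonneg A),
      mul_le_mul_of_nonneg_left (h1 w) (norm_nonneg A)]
  refine ContinuousLinearMap.opNorm_le_bound _ (norm_nonneg _) fun w => ?_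
  by_cases hv : Φ A w = 0
  · rw [hv, norm_zero]; positivity
  by_cases hw : w = 0
  · simp [hw]
  have hv' : 0 < ‖Φ A w‖ := norm_pos_iff.2 hv
  have hw' : 0 < ‖w‖ := norm_pos_iff.2 hw
  -- The test vector is `Φ A w`, rescaled to the norm of `w` and with the sign that makes the cross
  -- term negative.
  have h := hre (-((‖w‖ / ‖Φ A w‖ : ℝ) : ℂ) • Φ A w) w
  rw [norm_smul, norm_neg, Complex.norm_real, Real.norm_eq_abs, abs_of_pos (by positivity),
    div_mul_cancel₀ _ hv'.ne', neg_smul, inner_neg_left, inner_smul_left, Complex.conj_ofReal,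
    inner_self_eq_ofReal, ← Complex.ofReal_mul, Complex.neg_re, Complex.ofReal_re] at h
  have h2 : ‖w‖ / ‖Φ A w‖ * ‖Φ A w‖ ^ 2 = ‖w‖ * ‖Φ A w‖ := by field_simp
  rw [h2] at h
  nlinarith

theorem amp_isPosMatrix {n : ℕ} {A : Fin n → Fin n → Op E} (hA : IsPosMatrix A) :
    IsPosMatrix fun i j => amp (A i j) := by
  intro x
  have h : HasSum (fun k => ∑ i, ∑ j, ⟪x i k, A i j (x j k)⟫_ℂ)
      (∑ i, ∑ j, ⟪x i, amp (A i j) (x j)⟫_ℂ) :=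
    hasSum_sum fun i _ => hasSum_sum fun j _ => hasSum_inner_amp _ _ _
  exact h.nonneg fun k => hA fun i => x i k

/-- Completing the square in the scalar matrix `(α κ; κ̄ β)`: in each coordinate of `F` the form is
that of `√α p x + (κ/√α) q y`, plus `β - |κ|²/α ≥ 0` times that of `q y`. -/
theorem amp_posForm [FiniteDimensional ℂ F] {n : ℕ} {A : Fin n → Fin n → Op E}
    (hA : IsPosMatrix A) (x y : SeqL2 E) {α β : ℝ} {κ : ℂ} (hα : 0 < α) (hκ : ‖κ‖ ^ 2 ≤ α * β)
    (p q : Fin n → F) :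
    0 ≤ ∑ i, ∑ j, (α * ⟪x, amp (A i j) x⟫_ℂ * ⟪p i, p j⟫_ℂ
      + κ * ⟪x, amp (A i j) y⟫_ℂ * ⟪p i, q j⟫_ℂ
      + (starRingEnd ℂ) κ * ⟪y, amp (A i j) x⟫_ℂ * ⟪q i, p j⟫_ℂ
      + β * ⟪y, amp (A i j) y⟫_ℂ * ⟪q i, q j⟫_ℂ) := by
  set e := stdOrthonormalBasis ℂ F
  have hs : ((Real.sqrt α : ℝ) : ℂ) * ((Real.sqrt α : ℝ) : ℂ) = (α : ℂ) := by
    rw [← Complex.ofReal_mul, Real.mul_self_sqrt hα.le]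
  have hs0 : ((Real.sqrt α : ℝ) : ℂ) ≠ 0 :=
    Complex.ofReal_ne_zero.2 (Real.sqrt_pos.2 hα).ne'
  have hα0 : (α : ℂ) ≠ 0 := Complex.ofReal_ne_zero.2 hα.ne'
  have hβ : 0 ≤ β - ‖κ‖ ^ 2 / α := by
    rw [sub_nonneg, div_le_iff₀ hα]; linarith
  have key : ∀ a, 0 ≤ ∑ i, ∑ j, (α * ⟪x, amp (A i j) x⟫_ℂ * (⟪p i, e a⟫_ℂ * ⟪e a, p j⟫_ℂ)
      + κ * ⟪x, amp (A i j) y⟫_ℂ * (⟪p i, e a⟫_ℂ * ⟪e a, q j⟫_ℂ)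
      + (starRingEnd ℂ) κ * ⟪y, amp (A i j) x⟫_ℂ * (⟪q i, e a⟫_ℂ * ⟪e a, p j⟫_ℂ)
      + β * ⟪y, amp (A i j) y⟫_ℂ * (⟪q i, e a⟫_ℂ * ⟪e a, q j⟫_ℂ)) := by
    intro a
    have h1 := amp_isPosMatrix hA fun i => (((Real.sqrt α : ℝ) : ℂ) * ⟪e a, p i⟫_ℂ) • x
      + (κ / ((Real.sqrt α : ℝ) : ℂ) * ⟪e a, q i⟫_ℂ) • y
    have h2 := mul_nonneg (Complex.zero_le_real.2 hβ)
      (amp_isPosMatrix hA fun i => (⟪e a, q i⟫_ℂ) • y)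
    have h3 := add_nonneg h1 h2
    rw [Finset.mul_sum, ← Finset.sum_add_distrib] at h3
    refine h3.trans_eq (Finset.sum_congr rfl fun i _ => ?_)
    rw [Finset.mul_sum, ← Finset.sum_add_distrib]
    refine Finset.sum_congr rfl fun j _ => ?_
    have hk : (starRingEnd ℂ) κ * κ = ((‖κ‖ ^ 2 : ℝ) : ℂ) := by
      rw [← Complex.normSq_eq_conj_mul_self, Complex.normSq_eq_norm_sq]
    simp only [map_add, map_smul, inner_add_left, inner_add_right, inner_smul_left,
      inner_smul_right, map_mul, map_div₀, Complex.conj_ofReal, inner_conj_symm]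
    push_cast at hk ⊢
    rw [← hs] at hα0 ⊢
    field_simp
    rw [← hk]
    ring
  have h := Finset.sum_nonneg fun a (_ : a ∈ Finset.univ) => key a
  rw [Finset.sum_comm] at h
  refine h.trans_eq (Finset.sum_congr rfl fun i _ => ?_)
  rw [Finset.sum_comm]
  refine Finset.sum_congr rfl fun j _ => ?_
  simp only [Finset.sum_add_distrib, ← Finset.mul_sum, e.sum_inner_mul_inner]

end CompletePositivity

/-! ### Generalized boundary representations when the resolvent is diagonal -/

section BoundaryRepresentation

variable {K : Type*} [NormedAddCommGroup K] [InnerProductSpace ℂ K] [FiniteDimensional ℂ K]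

theorem op_ext_dual {X Y : Op K} (h : ∀ ρ : Module.Dual ℂ (Op K), ρ X = ρ Y) : X = Y :=
  (Module.evalEquiv ℂ (Op K)).injective (LinearMap.ext h)

variable {ω : WeightMap K} {ι : Type*} [Fintype ι] [DecidableEq ι] {C : ι → Op K}
  {φ : ι → Module.Dual ℂ (BdryAlg K)} {t : ℝ} {ht : 0 < t} {κ : ι → ℂ}

theorem dualize_eq_sum (hω : ∀ ρ A, ω ρ A = ∑ i, ρ (C i) * φ i A) (A : BdryAlg K) :
    dualize ω A = ∑ i, φ i A • C i := by
  refine op_ext_dual fun ρ => ?_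
  rw [dualize_spec, hω, map_sum]
  exact Finset.sum_congr rfl fun i _ => by rw [map_smul, smul_eq_mul, mul_comm]

theorem resolventMap_apply (hω : ∀ ρ A, ω ρ A = ∑ i, ρ (C i) * φ i A)
    (ρ : Module.Dual ℂ (Op K)) (X : Op K) :
    resolventMap ω t ht ρ X = ρ X + ∑ i, ρ (C i) * φ i (cutoff t ht (Lam X)) := by
  rw [← hω]; rfl

theorem resolventMap_diag (hω : ∀ ρ A, ω ρ A = ∑ i, ρ (C i) * φ i A)
    (hκ : ∀ i j, φ i (cutoff t ht (Lam (C j))) = if i = j then κ i else 0)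
    (ρ : Module.Dual ℂ (Op K)) (i : ι) :
    resolventMap ω t ht ρ (C i) = (1 + κ i) * ρ (C i) := by
  rw [resolventMap_apply hω]
  simp only [hκ, mul_ite, mul_zero, Finset.sum_ite_eq', Finset.mem_univ, if_true]
  ring

theorem one_add_ne_zero (hω : ∀ ρ A, ω ρ A = ∑ i, ρ (C i) * φ i A)
    (hκ : ∀ i j, φ i (cutoff t ht (Lam (C j))) = if i = j then κ i else 0)
    (hu : IsUnit (resolventMap ω t ht)) {i : ι} (hC : C i ≠ 0) : 1 + κ i ≠ 0 := by
  intro h0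
  apply hC
  refine op_ext_dual fun ρ => ?_
  obtain ⟨σ, rfl⟩ := ((Module.End.isUnit_iff _).1 hu).2 ρ
  rw [resolventMap_diag hω hκ, h0, zero_mul, map_zero]

/-- In finite dimensions injectivity suffices. A functional in the kernel vanishes on every `C i`,
and off these values the map is the identity. -/
theorem isUnit_resolventMap (hω : ∀ ρ A, ω ρ A = ∑ i, ρ (C i) * φ i A)
    (hκ : ∀ i j, φ i (cutoff t ht (Lam (C j))) = if i = j then κ i else 0)
    (h0 : ∀ i, 1 + κ i ≠ 0) : IsUnit (resolventMap ω t ht) := by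
  rw [LinearMap.isUnit_iff_ker_eq_bot, LinearMap.ker_eq_bot']
  intro ρ hρ
  have h1 : ∀ i, ρ (C i) = 0 := fun i => by
    have := resolventMap_diag hω hκ ρ i
    rw [hρ, LinearMap.zero_apply, eq_comm, mul_eq_zero] at this
    exact this.resolve_left (h0 i)
  ext X
  have := resolventMap_apply (t := t) (ht := ht) hω ρ X
  rw [hρ] at this
  simpa [h1] using this.symm

/-- The resolvent multiplies the value at `C i` by `1 + κ i`, and `ω` sees a functional only through
these values. -/
theorem bdryRep_eq_sum (hω : ∀ ρ A, ω ρ A = ∑ i, ρ (C i) * φ i A)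
    (hκ : ∀ i j, φ i (cutoff t ht (Lam (C j))) = if i = j then κ i else 0)
    (hu : IsUnit (resolventMap ω t ht)) (h0 : ∀ i, 1 + κ i ≠ 0) (A : Op (KL2 K)) :
    bdryRep ω t ht A = ∑ i, ((1 + κ i)⁻¹ * φ i (cutoff t ht A)) • C i := by
  refine op_ext_dual fun ρ => ?_
  rw [bdryRep, dualize_spec]
  change ω (Ring.inverse (resolventMap ω t ht) ρ) (cutoff t ht A) = _
  have h1 : resolventMap ω t ht (Ring.inverse (resolventMap ω t ht) ρ) = ρ := by
    have := Ring.mul_inverse_cancel _ hu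
    exact congrArg (fun T => T ρ) this
  set σ := Ring.inverse (resolventMap ω t ht) ρ
  rw [hω, map_sum]
  refine Finset.sum_congr rfl fun i _ => ?_
  rw [map_smul, ← h1, resolventMap_diag hω hκ, smul_eq_mul]
  have := h0 i
  field_simp

end BoundaryRepresentation

end QWeight

namespace QWeight

/-! ### `q`-weight maps of range rank one -/

section RankOne

variable {K : Type*} [NormedAddCommGroup K] [InnerProductSpace ℂ K]

/-- The map `ρ ↦ ρ(C) φ`. -/
noncomputable def tensorWeight (C : Op K) (φ : Module.Dual ℂ (BdryAlg K)) : WeightMap K :=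
  (Module.Dual.eval ℂ (Op K) C).smulRight φ

theorem tensorWeight_apply (C : Op K) (φ : Module.Dual ℂ (BdryAlg K)) (ρ : Module.Dual ℂ (Op K))
    (A : BdryAlg K) : tensorWeight C φ ρ A = ρ C * φ A := rfl

variable [CompleteSpace K]

theorem inner_star_left (T : Op K) (v w : K) : ⟪star T v, w⟫_ℂ = ⟪v, T w⟫_ℂ := by
  rw [ContinuousLinearMap.star_eq_adjoint, ContinuousLinearMap.adjoint_inner_left]

theorem _root_.IsStarProjection.apply_apply {T : Op K} (hT : IsStarProjection T) (v : K) :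
    T (T v) = T v := congrArg (fun S : Op K => S v) hT.isIdempotentElem.eq

theorem _root_.IsStarProjection.inner_apply {T : Op K} (hT : IsStarProjection T) (v w : K) :
    ⟪v, T w⟫_ℂ = ⟪T v, T w⟫_ℂ := by
  conv_rhs => rw [← inner_star_left, hT.isSelfAdjoint.star_eq, hT.apply_apply]
  rw [← inner_star_left, hT.isSelfAdjoint.star_eq]

theorem _root_.IsStarProjection.hat_inner {T : Op K} (hT : IsStarProjection T) (x y : SeqL2 (KL2 K)) :
    ⟪x, hat T y⟫_ℂ = ⟪hat T x, hat T y⟫_ℂ := by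
  rw [hat_inner_left, hT.isSelfAdjoint.star_eq, ← hat_mul_apply, hT.isIdempotentElem.eq]

theorem _root_.IsStarProjection.hat_inner_self {T : Op K} (hT : IsStarProjection T)
    (x : SeqL2 (KL2 K)) : ⟪x, hat T x⟫_ℂ = ((‖hat T x‖ ^ 2 : ℝ) : ℂ) := by
  rw [hT.hat_inner, inner_self_eq_ofReal]

theorem _root_.IsStarProjection.hat_norm_sq {T : Op K} (hT : IsStarProjection T)
    (x : SeqL2 (KL2 K)) : ‖x‖ ^ 2 = ‖hat T x‖ ^ 2 + ‖hat (1 - T) x‖ ^ 2 := by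
  have h : ⟪x, x⟫_ℂ = ⟪x, hat T x⟫_ℂ + ⟪x, hat (1 - T) x⟫_ℂ := by
    rw [hat_sub_apply, hat_one_apply, inner_sub_right]; ring
  rw [hT.hat_inner_self, hT.one_sub.hat_inner_self, inner_self_eq_ofReal] at h
  exact_mod_cast h

theorem _root_.IsStarProjection.hat_norm_le {T : Op K} (hT : IsStarProjection T)
    (x : SeqL2 (KL2 K)) : ‖hat T x‖ ^ 2 ≤ ‖x‖ ^ 2 := by
  rw [hT.hat_norm_sq x]; nlinarith [sq_nonneg ‖hat (1 - T) x‖]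

theorem _root_.IsStarProjection.exists_apply_eq {T : Op K} (hT : IsStarProjection T) (h0 : T ≠ 0) :
    ∃ v, T v = v ∧ v ≠ 0 := by
  obtain ⟨w, hw⟩ : ∃ w, T w ≠ 0 := by
    by_contra! h
    exact h0 (ContinuousLinearMap.ext h)
  exact ⟨T w, hT.apply_apply w, hw⟩

/-- The map `ρ ↦ s ρ(T) μ`, where `μ` is the weight of the sequence `f`. -/
noncomputable def rankOneMap (s : ℝ) (f : SeqL2 (KL2 K)) (T : Op K) : WeightMap K :=
  tensorWeight T ((s : ℂ) • vecWeight f f)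

theorem rankOneMap_apply (s : ℝ) (f : SeqL2 (KL2 K)) (T : Op K) (ρ : Module.Dual ℂ (Op K))
    (A : BdryAlg K) : rankOneMap s f T ρ A = ρ T * (s * vecWeight f f A) := rfl

variable [FiniteDimensional ℂ K]

theorem isCPFull_inner {Φ : Op (KL2 K) →ₗ[ℂ] Op K} {x : SeqL2 (KL2 K)} {T : Op K}
    (hT : IsStarProjection T) {c : ℝ} (hc : 0 ≤ c)
    (h : ∀ A, Φ A = ((c : ℂ) * ⟪x, amp A x⟫_ℂ) • T) : IsCPFull Φ := by
  rw [isCPFull_iff]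
  intro n A hA v
  have key := mul_nonneg (Complex.zero_le_real.2 hc) (amp_posForm hA x 0 (α := 1) (β := 0) (κ := 0)
    one_pos (by simp) (fun i => T (v i)) fun _ => 0)
  simp only [Finset.mul_sum] at key
  refine key.trans_eq (Finset.sum_congr rfl fun i _ => Finset.sum_congr rfl fun j _ => ?_)
  simp only [h]
  change _ = ⟪v i, ((c : ℂ) * ⟪x, amp (A i j) x⟫_ℂ) • T (v j)⟫_ℂ
  rw [inner_smul_right, hT.inner_apply (v i)]
  simp only [Complex.ofReal_one, Complex.ofReal_zero, inner_zero_right, inner_zero_left, mul_zero,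
    zero_mul, map_zero, add_zero, one_mul, mul_assoc]

variable {s : ℝ} {f : SeqL2 (KL2 K)} {T : Op K}

theorem rankOneMap_diag (hT : IsStarProjection T) (t : ℝ) (ht : 0 < t) :
    ((s : ℂ) • vecWeight f f) (cutoff t ht (Lam T))
      = ((s * ‖hat T (seqRatio t ht f)‖ ^ 2 : ℝ) : ℂ) := by
  rw [LinearMap.smul_apply, vecWeight_cutoff_Lam, hT.hat_inner_self, smul_eq_mul,
    ← Complex.ofReal_mul]

theorem one_add_mul_sq_ne_zero (hs : 0 ≤ s) (a : ℝ) : (1 : ℂ) + ((s * a ^ 2 : ℝ) : ℂ) ≠ 0 := by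
  rw [← Complex.ofReal_one, ← Complex.ofReal_add, Complex.ofReal_ne_zero]
  positivity

theorem isUnit_rankOneMap (hs : 0 ≤ s) (hT : IsStarProjection T) (t : ℝ) (ht : 0 < t) :
    IsUnit (resolventMap (rankOneMap s f T) t ht) :=
  isUnit_resolventMap (ι := Unit) (C := fun _ => T) (φ := fun _ => (s : ℂ) • vecWeight f f)
    (κ := fun _ => ((s * ‖hat T (seqRatio t ht f)‖ ^ 2 : ℝ) : ℂ))
    (fun ρ A => by simp [rankOneMap_apply])
    (fun i j => by simpa using rankOneMap_diag hT t ht) fun _ => one_add_mul_sq_ne_zero hs _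

theorem bdryRep_rankOneMap (hs : 0 ≤ s) (hT : IsStarProjection T) (t : ℝ) (ht : 0 < t)
    (A : Op (KL2 K)) : bdryRep (rankOneMap s f T) t ht A
      = (((s / (1 + s * ‖hat T (seqRatio t ht f)‖ ^ 2) : ℝ) : ℂ) *
        ⟪seqInvRoot t ht f, amp A (seqInvRoot t ht f)⟫_ℂ) • T := by
  rw [bdryRep_eq_sum (ι := Unit) (C := fun _ => T) (φ := fun _ => (s : ℂ) • vecWeight f f)
    (κ := fun _ => ((s * ‖hat T (seqRatio t ht f)‖ ^ 2 : ℝ) : ℂ))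
    (fun ρ A => by simp [rankOneMap_apply])
    (fun i j => by simpa using rankOneMap_diag hT t ht) (isUnit_rankOneMap hs hT t ht)
    fun _ => one_add_mul_sq_ne_zero hs _]
  simp only [Finset.univ_unique, Finset.sum_const, Finset.card_singleton, one_smul]
  rw [LinearMap.smul_apply, vecWeight_cutoff, smul_eq_mul]
  congr 1
  push_cast
  ring

/-- Positivity of `(I - Λ)^{1/2} B (I - Λ)^{1/2}` is tested on vectors `E(t,∞)(I - Λ)^{-1/2} x`;
then `t → 0`. -/
theorem isPosMatrix_toBdry {n : ℕ} {B : Fin n → Fin n → Op (KL2 K)}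
    (h : IsPosMatrix fun i j => (toBdry (B i j) : Op (KL2 K))) : IsPosMatrix B := by
  intro x
  have key : ∀ m, 0 ≤ ∑ i, ∑ j, ⟪tailProj K (cut m) (x i), B i j (tailProj K (cut m) (x j))⟫_ℂ := by
    intro m
    have h1 := h fun i => invRoot K (cut m) (cut_pos m) (x i)
    simp only [coe_toBdry] at h1
    refine h1.trans_eq (Finset.sum_congr rfl fun i _ => Finset.sum_congr rfl fun j _ => ?_)
    rw [← rootD_mul_invRoot _ (cut_pos m)]
    exact (rootD_inner _ _).symm
  have hlim : Filter.Tendsto (fun m => ∑ i, ∑ j,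
      ⟪tailProj K (cut m) (x i), B i j (tailProj K (cut m) (x j))⟫_ℂ) Filter.atTop
      (nhds (∑ i, ∑ j, ⟪x i, B i j (x j)⟫_ℂ)) :=
    tendsto_finsetSum _ fun i _ => tendsto_finsetSum _ fun j _ => (tendsto_tailProj (x i)).inner
      (((B i j).continuous.tendsto _).comp (tendsto_tailProj (x j)))
  exact ge_of_tendsto' hlim key

theorem isCP_of_toBdry {Φ : BdryAlg K →ₗ[ℂ] Op K} (h : IsCPFull (E := KL2 K) (Φ ∘ₗ toBdry)) :
    IsCP Φ := by
  rw [isCPFull_iff] at h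
  intro n A hA
  choose B hB using fun i j => toBdry_surjective (A i j)
  have h1 := h n B (isPosMatrix_toBdry (by simpa only [hB] using hA))
  simpa only [LinearMap.comp_apply, hB] using h1

theorem dualize_rankOneMap (A : BdryAlg K) :
    dualize (rankOneMap s f T) A = (s * vecWeight f f A) • T := by
  refine op_ext_dual fun ρ => ?_
  rw [dualize_spec, rankOneMap_apply, map_smul, smul_eq_mul, mul_comm]

/-- Since `π_t^#` is a positive multiple of a vector functional times `T`, only its value at `1` has
to be bounded, and `hc` is that bound. -/
theorem isQWeightMap_rankOneMap (hs : 0 ≤ s) (hT : IsStarProjection T) (hf : s * ‖f‖ ^ 2 ≤ 1)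
    (hc : ∀ t (ht : 0 < t), s * ‖seqInvRoot t ht f‖ ^ 2 ≤ 1 + s * ‖hat T (seqRatio t ht f)‖ ^ 2) :
    IsQWeightMap (rankOneMap s f T) := by
  have hcp : ∀ t (ht : 0 < t), IsCPFull (bdryRep (rankOneMap s f T) t ht) := by
    intro t ht
    exact isCPFull_inner hT (show 0 ≤ s / (1 + s * ‖hat T (seqRatio t ht f)‖ ^ 2) by positivity)
      (bdryRep_rankOneMap hs hT t ht)
  refine ⟨fun ρ => ((isBoundaryWeight_vecWeight f f).smul s).smul (ρ T), ?_, ?_,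
    isUnit_rankOneMap hs hT, hcp, fun t ht => (hcp t ht).norm_le fun v => ?_⟩
  · apply isCP_of_toBdry
    refine isCPFull_inner (x := f) hT hs fun A => ?_
    rw [LinearMap.comp_apply, dualize_rankOneMap, vecWeight_toBdry]
  · intro ρ hρ
    rw [rankOneMap_apply, vecWeight_oneSubLam, inner_self_eq_ofReal, ← Complex.ofReal_mul]
    have h1 := hρ T (.of_isStarProjection hT)
    have h2 := hρ _ (.of_isStarProjection hT.one_sub)
    rw [map_sub, sub_nonneg] at h2
    refine le_trans ?_ h2
    have h3 : ((s * ‖f‖ ^ 2 : ℝ) : ℂ) ≤ 1 := by exact_mod_cast hf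
    simpa using mul_le_mul_of_nonneg_left h3 h1
  · rw [bdryRep_rankOneMap hs hT, amp_one]
    change (⟪v, (_ * ⟪seqInvRoot t ht f, seqInvRoot t ht f⟫_ℂ) • T v⟫_ℂ).re ≤ _
    rw [inner_smul_right, hT.inner_apply, inner_self_eq_ofReal, inner_self_eq_ofReal,
      ← Complex.ofReal_mul, ← Complex.ofReal_mul, Complex.ofReal_re]
    have h1 : ‖T v‖ ^ 2 ≤ ‖v‖ ^ 2 := by
      have : ‖T v‖ ≤ 1 * ‖v‖ := T.le_of_opNorm_le (hT.norm_le) v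
      rw [one_mul] at this
      gcongr
    have h2 : s / (1 + s * ‖hat T (seqRatio t ht f)‖ ^ 2) * ‖seqInvRoot t ht f‖ ^ 2 ≤ 1 := by
      rw [div_mul_eq_mul_div, div_le_one (by positivity)]
      exact hc t ht
    nlinarith [sq_nonneg ‖T v‖]

theorem eq_rankOneMap {ω : WeightMap K} {μ : Module.Dual ℂ (BdryAlg K)}
    (h : ∀ ρ A, ω ρ A = ρ T * μ A) (hμ : μ = vecWeight f f) : ω = rankOneMap 1 f T := by
  refine LinearMap.ext fun ρ => LinearMap.ext fun A => ?_
  rw [h, hμ, rankOneMap_apply, Complex.ofReal_one, one_mul]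

/-- Contractivity of `π_t^#` at the identity, read off on a vector in the range of `T`. -/
theorem norm_seqInvRoot_le (hω : IsQWeightMap (rankOneMap 1 f T)) (hT : IsStarProjection T)
    (h0 : T ≠ 0) (t : ℝ) (ht : 0 < t) :
    ‖seqInvRoot t ht f‖ ^ 2 ≤ 1 + ‖hat T (seqRatio t ht f)‖ ^ 2 := by
  obtain ⟨v, hv, hv0⟩ := hT.exists_apply_eq h0
  have h1 : ‖bdryRep (rankOneMap 1 f T) t ht 1 v‖ ≤ 1 * ‖v‖ :=
    ContinuousLinearMap.le_of_opNorm_le _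
      ((hω.rep_contr t ht 1).trans ContinuousLinearMap.norm_id_le) v
  rw [bdryRep_rankOneMap zero_le_one hT, amp_one] at h1
  change ‖(_ * ⟪seqInvRoot t ht f, seqInvRoot t ht f⟫_ℂ) • T v‖ ≤ _ at h1
  rw [hv, norm_smul, inner_self_eq_ofReal, ← Complex.ofReal_mul, Complex.norm_real,
    Real.norm_of_nonneg (by positivity)] at h1
  have h2 := le_of_mul_le_mul_right h1 (norm_pos_iff.2 hv0)
  rwa [div_mul_eq_mul_div, one_mul, div_le_one (by positivity), one_mul] at h2

/-- The vector functional `A ↦ (v, A v)`. -/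
noncomputable def vecState (v : K) : Module.Dual ℂ (Op K) where
  toFun A := ⟪v, A v⟫_ℂ
  map_add' A B := by rw [← inner_add_right]; rfl
  map_smul' c A := by rw [RingHom.id_apply, smul_eq_mul, ← inner_smul_right]; rfl

theorem vecState_apply (v : K) (A : Op K) : vecState v A = ⟪v, A v⟫_ℂ := rfl

theorem norm_sq_le_one (hω : IsQWeightMap (rankOneMap 1 f T)) (hT : IsStarProjection T)
    (h0 : T ≠ 0) : ‖f‖ ^ 2 ≤ 1 := by
  obtain ⟨v, hv, hv0⟩ := hT.exists_apply_eq h0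
  have h1 := hω.bound (vecState v) fun A hA => hA.inner_nonneg_right v
  rw [rankOneMap_apply, vecState_apply, vecState_apply, hv, vecWeight_oneSubLam, Complex.ofReal_one,
    one_mul] at h1
  change ⟪v, v⟫_ℂ * _ ≤ ⟪v, v⟫_ℂ at h1
  rw [inner_self_eq_ofReal, inner_self_eq_ofReal, ← Complex.ofReal_mul, Complex.real_le_real] at h1
  have : 0 < ‖v‖ ^ 2 := by positivity
  exact le_of_mul_le_mul_left (h1.trans_eq (mul_one _).symm) this

/-- Otherwise the weight would vanish on all cut-off operators, hence everywhere, whereas its value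
at `I - Λ` is `‖f‖²`. -/
theorem exists_seqInvRoot_ne_zero (hf : f ≠ 0) : ∃ n, seqInvRoot (cut n) (cut_pos n) f ≠ 0 := by
  by_contra! h
  have h1 : vecWeight f f = 0 := vecWeight_eq_zero fun n A => by
    rw [vecWeight_cutoff, h n, inner_zero_left]
  have h2 := vecWeight_oneSubLam f f
  rw [h1, LinearMap.zero_apply, eq_comm, inner_self_eq_zero] at h2
  exact hf h2

/-- Complete positivity, applied to rank one projections and a vector in the range of `T`, makes the
weight positive, so `exists_eq_inner_self` applies. -/
theorem exists_vecWeight_self {ω : WeightMap K} {μ : Module.Dual ℂ (BdryAlg K)}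
    (hω : IsQWeightMap ω) (h : ∀ ρ A, ω ρ A = ρ T * μ A) (hμ : IsBoundaryWeight μ)
    (hT : IsStarProjection T) (h0 : T ≠ 0) : ∃ f, μ = vecWeight f f := by
  obtain ⟨x, y, rfl⟩ := isBoundaryWeight_iff.1 hμ
  obtain ⟨v, hv, hv0⟩ := hT.exists_apply_eq h0
  have hpos : ∀ k : KL2 K, 0 ≤ (vecWeight x y ∘ₗ toBdry) (InnerProductSpace.rankOne ℂ k k) := by
    intro k
    have h1 := hω.cp 1 (fun _ _ => toBdry (InnerProductSpace.rankOne ℂ k k)) (fun z => by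
      simp only [Finset.univ_unique, Finset.sum_singleton, Fin.default_eq_zero, coe_toBdry]
      change 0 ≤ ⟪z 0, rootD K (⟪k, rootD K (z 0)⟫_ℂ • k)⟫_ℂ
      rw [← rootD_inner, inner_smul_right, ← inner_conj_symm k]
      exact star_mul_self_nonneg _) (fun _ => v)
    simp only [Finset.univ_unique, Finset.sum_singleton] at h1
    have h2 : dualize ω (toBdry (InnerProductSpace.rankOne ℂ k k))
        = vecWeight x y (toBdry (InnerProductSpace.rankOne ℂ k k)) • T :=
      op_ext_dual fun ρ => by rw [dualize_spec, h, map_smul, smul_eq_mul, mul_comm]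
    rw [h2] at h1
    rw [smul_apply, hv, inner_smul_right, inner_self_eq_ofReal] at h1
    exact le_of_mul_le_mul_right (by simpa using h1)
      (Complex.zero_lt_real.2 (show 0 < ‖v‖ ^ 2 by positivity))
  obtain ⟨F, hF⟩ := exists_eq_inner_self (fun B => vecWeight_toBdry x y B) hpos
  exact ⟨F, eq_vecWeight_iff.2 hF⟩

end RankOne

end QWeight

namespace QWeight

/-! ### Consequences of `q`-purity -/

section Purity

variable {K : Type*} [NormedAddCommGroup K] [InnerProductSpace ℂ K] [CompleteSpace K]

theorem isStarProjection_rankOne {v : K} (hv : ‖v‖ = 1) :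
    IsStarProjection (InnerProductSpace.rankOne ℂ v v) := by
  refine ⟨InnerProductSpace.isIdempotentElem_rankOne_self hv, ?_⟩
  rw [IsSelfAdjoint, ContinuousLinearMap.star_eq_adjoint, eq_comm,
    ContinuousLinearMap.eq_adjoint_iff]
  intro x y
  rw [InnerProductSpace.inner_left_rankOne_apply, InnerProductSpace.inner_right_rankOne_apply]

theorem isStarProjection_sub {T Q : Op K} (hT : IsStarProjection T) (hQ : IsStarProjection Q)
    (h : T * Q = Q) : IsStarProjection (T - Q) := by
  have h' : Q * T = Q := by
    have := congrArg star h
    rwa [star_mul, hT.isSelfAdjoint.star_eq, hQ.isSelfAdjoint.star_eq] at this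
  refine ⟨?_, hT.isSelfAdjoint.sub hQ.isSelfAdjoint⟩
  rw [IsIdempotentElem, sub_mul, mul_sub, mul_sub, h, h', hT.isIdempotentElem.eq,
    hQ.isIdempotentElem.eq]
  simp

theorem hat_sq_sub {T Q : Op K} (hT : IsStarProjection T) (hQ : IsStarProjection Q)
    (h : T * Q = Q) (x : SeqL2 (KL2 K)) :
    ‖hat T x‖ ^ 2 = ‖hat (T - Q) x‖ ^ 2 + ‖hat Q x‖ ^ 2 := by
  have h1 : ⟪x, hat T x⟫_ℂ = ⟪x, hat (T - Q) x⟫_ℂ + ⟪x, hat Q x⟫_ℂ := by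
    rw [hat_sub_apply, inner_sub_right]; ring
  rw [hT.hat_inner_self, (isStarProjection_sub hT hQ h).hat_inner_self, hQ.hat_inner_self] at h1
  exact_mod_cast h1

variable [FiniteDimensional ℂ K] {f : SeqL2 (KL2 K)} {T : Op K}

/-- The difference of the boundary representations splits as `(b - a) Ψ ⊗ T + a Ψ ⊗ Q`, with `a ≤ b`
the scalar coefficients of the two sides and `Ψ` the cut-off weight. -/
theorem qle_rankOneMap {s r : ℝ} {P Q : Op K} (hs : 0 ≤ s) (hr : 0 ≤ r) (hT : IsStarProjection T)
    (hP : IsStarProjection P) (hQ : IsStarProjection Q) (hPQ : P + Q = T)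
    (h : ∀ t (ht : 0 < t), s / (1 + s * ‖hat P (seqRatio t ht f)‖ ^ 2)
      ≤ r / (1 + r * ‖hat T (seqRatio t ht f)‖ ^ 2)) :
    QLE (rankOneMap s f P) (rankOneMap r f T) := by
  intro t ht
  set Ψ : Op (KL2 K) →ₗ[ℂ] ℂ := vecWeight f f ∘ₗ cutoff t ht with hΨ
  set a := s / (1 + s * ‖hat P (seqRatio t ht f)‖ ^ 2) with ha
  set b := r / (1 + r * ‖hat T (seqRatio t ht f)‖ ^ 2) with hb
  have hΨ' : ∀ A, Ψ A = ⟪seqInvRoot t ht f, amp A (seqInvRoot t ht f)⟫_ℂ :=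
    fun A => vecWeight_cutoff f f t ht A
  have h1 : IsCPFull (E := KL2 K) ((((b - a : ℝ) : ℂ) • Ψ).smulRight T) :=
    isCPFull_inner hT (sub_nonneg.2 (h t ht)) fun A => by
      rw [← hΨ']; rfl
  have ha0 : 0 ≤ a := by positivity
  have h2 : IsCPFull (E := KL2 K) ((((a : ℝ) : ℂ) • Ψ).smulRight Q) :=
    isCPFull_inner hQ ha0 fun A => by
      rw [← hΨ']; rfl
  convert h1.add h2 using 1
  ext1 A
  rw [LinearMap.sub_apply, bdryRep_rankOneMap hr hT, bdryRep_rankOneMap hs hP, ← hΨ', ← ha, ← hb]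
  change _ = (((b - a : ℝ) : ℂ) * Ψ A) • T + ((a : ℂ) * Ψ A) • Q
  rw [← hPQ]
  push_cast
  module

/-- Boundedness in the direction `v` allows that direction to be removed from `T`: with `Q = |v⟩⟨v|`
and a small scalar `s`, both `s ρ(T - Q) μ` and `(s/2) ρ(T) μ` are `q`-subordinates. Neither is
subordinate to the other. -/
theorem IsQPure.false_of_bounded (hω : IsQWeightMap (rankOneMap 1 f T))
    (hpure : IsQPure (rankOneMap 1 f T)) (hT : IsStarProjection T) (hf : f ≠ 0) {x v : K}
    (hx : T x = x) (hx0 : x ≠ 0) (hv : T v = v) (hv1 : ‖v‖ = 1) (hvx : ⟪v, x⟫_ℂ = 0) {R : ℝ}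
    (hR : ∀ t (ht : 0 < t), ‖hat (InnerProductSpace.rankOne ℂ v v) (seqRatio t ht f)‖ ^ 2 ≤ R) :
    False := by
  set Q : Op K := InnerProductSpace.rankOne ℂ v v with hQdef
  have hQ : IsStarProjection Q := isStarProjection_rankOne hv1
  have hTQ : T * Q = Q := by
    ext w
    change T (⟪v, w⟫_ℂ • v) = ⟪v, w⟫_ℂ • v
    rw [map_smul, hv]
  have hP := isStarProjection_sub hT hQ hTQ
  have hsplit := hat_sq_sub hT hQ hTQ
  have hT0 : T ≠ 0 := by rintro rfl; exact hx0 (by simpa using hx.symm)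
  have hR0 : 0 ≤ R := (sq_nonneg _).trans (hR 1 one_pos)
  -- As `s (1 + R) = 1`, one has `s (1 + ‖P D_t f‖² + ‖Q D_t f‖²) ≤ 1 + s ‖P D_t f‖²` with `P = T -
  -- Q`. This gives both contractivity and subordination of the first map.
  set s : ℝ := 1 / (1 + R) with hs
  have hspos : 0 < s := by positivity
  have hsR : s * (1 + R) = 1 := by rw [hs]; field_simp
  have hs1 : s ≤ 1 := by nlinarith
  have hf1 := norm_sq_le_one hω hT hT0
  have hG := norm_seqInvRoot_le hω hT hT0
  have hη₁ : IsQWeightMap (rankOneMap s f (T - Q)) := by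
    refine isQWeightMap_rankOneMap hspos.le hP (by nlinarith [sq_nonneg ‖f‖]) fun t ht => ?_
    have h1 := hsplit (seqRatio t ht f)
    nlinarith [mul_le_mul_of_nonneg_left (hG t ht) hspos.le,
      mul_le_mul_of_nonneg_left (hR t ht) hspos.le]
  have hη₂ : IsQWeightMap (rankOneMap (s / 2) f T) := by
    refine isQWeightMap_rankOneMap (by positivity) hT (by nlinarith [sq_nonneg ‖f‖]) fun t ht => ?_
    nlinarith [mul_le_mul_of_nonneg_left (hG t ht) hspos.le]
  have hle₁ : QLE (rankOneMap s f (T - Q)) (rankOneMap 1 f T) := by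
    refine qle_rankOneMap hspos.le zero_le_one hT hP hQ (by abel) fun t ht => ?_
    rw [div_le_div_iff₀ (by positivity) (by positivity), hsplit]
    nlinarith [mul_le_mul_of_nonneg_left (hR t ht) hspos.le]
  have hle₂ : QLE (rankOneMap (s / 2) f T) (rankOneMap 1 f T) := by
    refine qle_rankOneMap (by positivity) zero_le_one hT hT (.zero _) (add_zero T) fun t ht => ?_
    rw [div_le_div_iff₀ (by positivity) (by positivity)]
    nlinarith
  obtain ⟨n, hn⟩ := exists_seqInvRoot_ne_zero hf
  set t := cut n
  have ht := cut_pos n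
  have hpos : 0 < ‖seqInvRoot t ht f‖ ^ 2 := by positivity
  have hone : ∀ y : KL2 K, 0 ≤ ⟪y, (1 : Op (KL2 K)) y⟫_ℂ := inner_self_nonneg_complex
  have hrep : ∀ (r : ℝ) (S : Op K) (hr : 0 ≤ r) (hS : IsStarProjection S) (w : K),
      ⟪w, bdryRep (rankOneMap r f S) t ht 1 w⟫_ℂ = ((r / (1 + r * ‖hat S (seqRatio t ht f)‖ ^ 2) *
        ‖seqInvRoot t ht f‖ ^ 2 : ℝ) : ℂ) * ⟪w, S w⟫_ℂ := by
    intro r S hr hS w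
    rw [bdryRep_rankOneMap hr hS, amp_one]
    change ⟪w, (_ * ⟪seqInvRoot t ht f, seqInvRoot t ht f⟫_ℂ) • S w⟫_ℂ = _
    rw [inner_smul_right, inner_self_eq_ofReal, Complex.ofReal_mul]
  -- On `x`, which `Q` kills, the factor `1/2` makes the second map strictly smaller; on `v`, which
  -- `T - Q` kills, the first map vanishes and the second does not.
  rcases hpure _ _ hη₁ hη₂ hle₁ hle₂ with h | h
  · have h1 := (h t ht).inner_nonneg hone x
    have hPx : (T - Q) x = x := by
      change T x - ⟪v, x⟫_ℂ • v = x
      rw [hvx, zero_smul, sub_zero, hx]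
    rw [LinearMap.sub_apply, sub_apply, inner_sub_right, hrep _ _ (by positivity) hT,
      hrep _ _ hspos.le hP, hPx, hx, inner_self_eq_ofReal, ← Complex.ofReal_mul,
      ← Complex.ofReal_mul, ← Complex.ofReal_sub, Complex.zero_le_real, sub_nonneg] at h1
    have hx' : 0 < ‖x‖ ^ 2 := by positivity
    have h2 := le_of_mul_le_mul_right (le_of_mul_le_mul_right h1 hx') hpos
    rw [div_le_div_iff₀ (by positivity) (by positivity), hsplit] at h2
    nlinarith [mul_nonneg (mul_nonneg hspos.le hspos.le)
      (sq_nonneg ‖hat (T - Q) (seqRatio t ht f)‖), mul_nonneg (mul_nonneg hspos.le hspos.le)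
      (sq_nonneg ‖hat Q (seqRatio t ht f)‖)]
  · have h1 := (h t ht).inner_nonneg hone v
    have hPv : (T - Q) v = 0 := by
      change T v - ⟪v, v⟫_ℂ • v = 0
      rw [inner_self_eq_ofReal, hv1, hv]
      simp
    rw [LinearMap.sub_apply, sub_apply, inner_sub_right, hrep _ _ (by positivity) hT,
      hrep _ _ hspos.le hP, hPv, hv, inner_self_eq_ofReal, hv1, inner_zero_right, mul_zero, zero_sub,
      ← Complex.ofReal_mul, ← Complex.ofReal_neg, Complex.zero_le_real] at h1
    have h2 : 0 < s / 2 / (1 + s / 2 * ‖hat T (seqRatio t ht f)‖ ^ 2) *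
        ‖seqInvRoot t ht f‖ ^ 2 := by positivity
    linarith

/-- The vectors on which `D` acts boundedly do not matter for a `q`-pure map. -/
theorem IsQPure.eq_zero_of_bounded (hω : IsQWeightMap (rankOneMap 1 f T))
    (hpure : IsQPure (rankOneMap 1 f T)) (hT : IsStarProjection T) (hf : f ≠ 0) {D : Op K}
    (hD : star D = D) (hTD : T * D = D) {x : K} (hx : T x = x) (hx0 : x ≠ 0) (hDx : D x = 0)
    {R : ℝ} (hR : ∀ t (ht : 0 < t), ‖hat D (seqRatio t ht f)‖ ≤ R) : D = 0 := by
  by_contra hD0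
  obtain ⟨w, hw⟩ : ∃ w, D w ≠ 0 := by
    by_contra! h
    exact hD0 (ContinuousLinearMap.ext h)
  have hDsymm : ∀ a b, ⟪D a, b⟫_ℂ = ⟪a, D b⟫_ℂ := fun a b => by
    conv_lhs => rw [← hD, inner_star_left]
  set c : ℂ := ((‖D w‖⁻¹ : ℝ) : ℂ) with hc
  set v : K := c • D w with hvdef
  have hv1 : ‖v‖ = 1 := by
    rw [hvdef, hc, norm_smul, Complex.norm_real, norm_inv, norm_norm,
      inv_mul_cancel₀ (norm_ne_zero_iff.2 hw)]
  have hvD : v = D (c • w) := by rw [map_smul]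
  -- The projection onto a vector in the range of `D` factors through `D`, so boundedness of `D D_t
  -- f` passes to it.
  have hrank : InnerProductSpace.rankOne ℂ v v = InnerProductSpace.rankOne ℂ v (c • w) * D := by
    ext y
    change ⟪v, y⟫_ℂ • v = ⟪c • w, D y⟫_ℂ • v
    nth_rewrite 1 [hvD]
    rw [hDsymm]
  refine hpure.false_of_bounded hω hT hf hx hx0 (v := v) ?_ hv1 ?_
    (R := (‖InnerProductSpace.rankOne ℂ v (c • w)‖ * R) ^ 2) fun t ht => ?_
  · rw [hvD]
    exact congrArg (fun S : Op K => S (c • w)) hTD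
  · rw [hvD, hDsymm, hDx, inner_zero_right]
  · rw [hrank, hat_mul_apply]
    gcongr
    exact (hat_norm_le _ _).trans (by gcongr; exact hR t ht)

end Purity

end QWeight

namespace QWeight

/-! ### Two-by-two block structure of a corner -/

section Corners

variable {K : Type*} [NormedAddCommGroup K] [InnerProductSpace ℂ K] [CompleteSpace K]

theorem compress_cutoff_Lam (E F X : Op K) (t : ℝ) (ht : 0 < t) :
    compress E F (cutoff t ht (Lam X)) = cutoff t ht (Lam (E * X * F)) := by
  rw [cutoff_eq, cutoff_eq, compress_toBdry, Lam_eq, Lam_eq, ampl_mul, ampl_mul]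
  have hE : rootLam K * ampl E = ampl E * rootLam K := mulOp_ampl _ E
  have hF : rootLam K * ampl F = ampl F * rootLam K := mulOp_ampl _ F
  congr 1
  calc _ = (ampl E * invRoot K t ht) * rootLam K * ampl X * rootLam K *
        (invRoot K t ht * ampl F) := by simp only [mul_assoc]
    _ = invRoot K t ht * (ampl E * rootLam K) * ampl X * (rootLam K * ampl F) *
        invRoot K t ht := by
      rw [ampl_mul_invRoot, ← ampl_mul_invRoot F]; simp only [mul_assoc]
    _ = _ := by rw [← hE, hF]; simp only [mul_assoc]

/-- Each weight `φ a b` sees only the `(a, b)` block, and `Λ(C)` occupies the block of `C`, so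
distinct blocks do not interact. -/
theorem corner_diag {E : Fin 2 → Op K} (hE : ∀ a b, E a * E b = if a = b then E a else 0)
    {C : Fin 2 → Fin 2 → Op K} {φ : Fin 2 → Fin 2 → Module.Dual ℂ (BdryAlg K)}
    (hC : ∀ a b, E a * C a b * E b = C a b)
    (hφ : ∀ a b A, φ a b (compress (E a) (E b) A) = φ a b A) (t : ℝ) (ht : 0 < t)
    (i j : Fin 2 × Fin 2) : φ i.1 i.2 (cutoff t ht (Lam (C j.1 j.2))) =
      if i = j then φ i.1 i.2 (cutoff t ht (Lam (C i.1 i.2))) else 0 := by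
  split_ifs with h
  · rw [h]
  · rw [← hφ, compress_cutoff_Lam, ← hC j.1 j.2]
    have h1 : E i.1 * (E j.1 * C j.1 j.2 * E j.2) * E i.2
        = (E i.1 * E j.1) * C j.1 j.2 * (E j.2 * E i.2) := by simp only [mul_assoc]
    have h2 : (E i.1 * E j.1) * C j.1 j.2 * (E j.2 * E i.2) = 0 := by
      rw [hE, hE]
      by_cases h3 : i.1 = j.1
      · by_cases h4 : j.2 = i.2
        · exact absurd (Prod.ext h3 h4.symm) h
        · simp [h4]
      · simp [h3]
    rw [h1, h2]
    simp

theorem adjMap_tensorWeight (C : Op K) (x y : SeqL2 (KL2 K)) :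
    adjMap (tensorWeight C (vecWeight x y)) = tensorWeight (star C) (vecWeight y x) := by
  refine LinearMap.ext fun ρ => LinearMap.ext fun A => ?_
  change star (star (ρ (star C)) * vecWeight x y (bdryStar A)) = ρ (star C) * vecWeight y x A
  rw [← vecWeight_star x y A, star_mul', star_star]

/-- The map `ω + γ + γ* + η` for `ω`, `η` and `γ` of range rank one. -/
noncomputable def cornerMap (T₁ T₂ C : Op K) (f g x y : SeqL2 (KL2 K)) : WeightMap K :=
  rankOneMap 1 f T₁ + tensorWeight C (vecWeight x y) + adjMap (tensorWeight C (vecWeight x y))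
    + rankOneMap 1 g T₂

/-- The support conditions on the data of a `q`-corner of range rank one. -/
structure CornerData (E₁ E₂ T₁ T₂ C : Op K) (f g x y : SeqL2 (KL2 K)) : Prop where
  proj₁ : IsStarProjection E₁
  proj₂ : IsStarProjection E₂
  orth : E₁ * E₂ = 0
  range₁ : IsStarProjection T₁
  range₂ : IsStarProjection T₂
  mul₁ : E₁ * T₁ = T₁
  mul₂ : E₂ * T₂ = T₂
  corner : E₁ * C * E₂ = C
  supp_f : hat E₁ f = f
  supp_g : hat E₂ g = g
  supp_x : hat E₁ x = x
  supp_y : hat E₂ y = y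

namespace CornerData

variable {E₁ E₂ T₁ T₂ C : Op K} {f g x y : SeqL2 (KL2 K)} (h : CornerData E₁ E₂ T₁ T₂ C f g x y)

include h

theorem orth' : E₂ * E₁ = 0 := by
  have := congrArg star h.orth
  rwa [star_mul, h.proj₁.isSelfAdjoint.star_eq, h.proj₂.isSelfAdjoint.star_eq, star_zero] at this

theorem mul₁' : T₁ * E₁ = T₁ := by
  have := congrArg star h.mul₁
  rwa [star_mul, h.proj₁.isSelfAdjoint.star_eq, h.range₁.isSelfAdjoint.star_eq] at this

theorem mul₂' : T₂ * E₂ = T₂ := by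
  have := congrArg star h.mul₂
  rwa [star_mul, h.proj₂.isSelfAdjoint.star_eq, h.range₂.isSelfAdjoint.star_eq] at this

theorem corner' : E₂ * star C * E₁ = star C := by
  have := congrArg star h.corner
  rwa [star_mul, star_mul, h.proj₁.isSelfAdjoint.star_eq, h.proj₂.isSelfAdjoint.star_eq,
    ← mul_assoc] at this

theorem T_mul : T₁ * T₂ = 0 := by
  rw [← h.mul₁', ← h.mul₂, mul_assoc, ← mul_assoc E₁, h.orth]; simp

theorem inner_eq_zero {u v : SeqL2 (KL2 K)} (hu : hat E₁ u = u) (hv : hat E₂ v = v) :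
    ⟪u, v⟫_ℂ = 0 := by
  rw [← hu, ← hv, hat_inner_left, h.proj₁.isSelfAdjoint.star_eq, ← hat_mul_apply, h.orth,
    hat_zero_apply, inner_zero_right]

theorem eq_sum (ρ : Module.Dual ℂ (Op K)) (A : BdryAlg K) :
    cornerMap T₁ T₂ C f g x y ρ A = ∑ i : Fin 2 × Fin 2,
      ρ (![![T₁, C], ![star C, T₂]] i.1 i.2) *
        ![![vecWeight f f, vecWeight x y], ![vecWeight y x, vecWeight g g]] i.1 i.2 A := by
  rw [Fintype.sum_prod_type, cornerMap, adjMap_tensorWeight]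
  simp only [Fin.sum_univ_two, Matrix.cons_val_zero, Matrix.cons_val_one, LinearMap.add_apply,
    rankOneMap_apply, tensorWeight_apply, Complex.ofReal_one, one_mul]
  ring

theorem diag (t : ℝ) (ht : 0 < t) (i j : Fin 2 × Fin 2) :
    (![![vecWeight f f, vecWeight x y], ![vecWeight y x, vecWeight g g]] :
        Fin 2 → Fin 2 → Module.Dual ℂ (BdryAlg K)) i.1 i.2
      (cutoff t ht (Lam ((![![T₁, C], ![star C, T₂]] : Fin 2 → Fin 2 → Op K) j.1 j.2))) =
      if i = j then (![![((‖hat T₁ (seqRatio t ht f)‖ ^ 2 : ℝ) : ℂ),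
        ⟪seqRatio t ht x, hat C (seqRatio t ht y)⟫_ℂ],
        ![(starRingEnd ℂ) ⟪seqRatio t ht x, hat C (seqRatio t ht y)⟫_ℂ,
          ((‖hat T₂ (seqRatio t ht g)‖ ^ 2 : ℝ) : ℂ)]] : Fin 2 → Fin 2 → ℂ) i.1 i.2 else 0 := by
  rw [corner_diag (E := ![E₁, E₂])]
  · congr 1
    obtain ⟨a, b⟩ := i
    fin_cases a <;> fin_cases b
    · exact (vecWeight_cutoff_Lam _ _ _ _ _).trans (h.range₁.hat_inner_self _)
    · exact vecWeight_cutoff_Lam _ _ _ _ _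
    · refine (vecWeight_cutoff_Lam _ _ _ _ _).trans ?_
      change ⟪seqRatio t ht y, hat (star C) (seqRatio t ht x)⟫_ℂ =
        (starRingEnd ℂ) ⟪seqRatio t ht x, hat C (seqRatio t ht y)⟫_ℂ
      rw [hat_inner_right, star_star, inner_conj_symm]
    · exact (vecWeight_cutoff_Lam _ _ _ _ _).trans (h.range₂.hat_inner_self _)
  · intro a b
    fin_cases a <;> fin_cases b
    · exact h.proj₁.isIdempotentElem.eq
    · exact h.orth
    · exact h.orth'
    · exact h.proj₂.isIdempotentElem.eq
  · intro a b
    fin_cases a <;> fin_cases b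
    · change E₁ * T₁ * E₁ = T₁
      rw [h.mul₁, h.mul₁']
    · exact h.corner
    · exact h.corner'
    · change E₂ * T₂ * E₂ = T₂
      rw [h.mul₂, h.mul₂']
  · have e₁ := h.proj₁.isSelfAdjoint.star_eq
    have e₂ := h.proj₂.isSelfAdjoint.star_eq
    intro a b A
    fin_cases a <;> fin_cases b <;> refine (vecWeight_compress _ _ _ _ _).trans ?_
    · simp only [Fin.zero_eta, Matrix.cons_val_zero, e₁, h.supp_f]
    · simp only [Fin.zero_eta, Fin.mk_one, Matrix.cons_val_zero, Matrix.cons_val_one, e₁, h.supp_x,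
        h.supp_y]
    · simp only [Fin.zero_eta, Fin.mk_one, Matrix.cons_val_zero, Matrix.cons_val_one, e₂, h.supp_x,
        h.supp_y]
    · change vecWeight (hat (star E₂) g) (hat E₂ g) A = vecWeight g g A
      rw [e₂, h.supp_g]

variable [FiniteDimensional ℂ K]

theorem isUnit {t : ℝ} {ht : 0 < t}
    (hc : 1 + ⟪seqRatio t ht x, hat C (seqRatio t ht y)⟫_ℂ ≠ 0) :
    IsUnit (resolventMap (cornerMap T₁ T₂ C f g x y) t ht) := by
  refine isUnit_resolventMap h.eq_sum (h.diag t ht) fun i => ?_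
  obtain ⟨a, b⟩ := i
  fin_cases a <;> fin_cases b
  · simpa using one_add_mul_sq_ne_zero zero_le_one ‖hat T₁ (seqRatio t ht f)‖
  · exact hc
  · intro h0
    apply hc
    have := congrArg (starRingEnd ℂ) h0
    simpa using this
  · simpa using one_add_mul_sq_ne_zero zero_le_one ‖hat T₂ (seqRatio t ht g)‖

/-- Invertibility of the resolvent forces the eigenvalue belonging to a nonzero `C` to be nonzero.
-/
theorem ne_zero (hC : C ≠ 0) {t : ℝ} {ht : 0 < t}
    (hu : IsUnit (resolventMap (cornerMap T₁ T₂ C f g x y) t ht)) :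
    1 + ⟪seqRatio t ht x, hat C (seqRatio t ht y)⟫_ℂ ≠ 0 :=
  one_add_ne_zero h.eq_sum (h.diag t ht) hu (i := (0, 1)) hC

theorem bdryRep_eq {t : ℝ} {ht : 0 < t}
    (hc : 1 + ⟪seqRatio t ht x, hat C (seqRatio t ht y)⟫_ℂ ≠ 0) (A : Op (KL2 K)) :
    bdryRep (cornerMap T₁ T₂ C f g x y) t ht A =
      (((1 + ‖hat T₁ (seqRatio t ht f)‖ ^ 2)⁻¹ : ℝ) *
        ⟪seqInvRoot t ht f, amp A (seqInvRoot t ht f)⟫_ℂ) • T₁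
      + ((1 + ⟪seqRatio t ht x, hat C (seqRatio t ht y)⟫_ℂ)⁻¹ *
        ⟪seqInvRoot t ht x, amp A (seqInvRoot t ht y)⟫_ℂ) • C
      + ((starRingEnd ℂ) (1 + ⟪seqRatio t ht x, hat C (seqRatio t ht y)⟫_ℂ)⁻¹ *
        ⟪seqInvRoot t ht y, amp A (seqInvRoot t ht x)⟫_ℂ) • star C
      + (((1 + ‖hat T₂ (seqRatio t ht g)‖ ^ 2)⁻¹ : ℝ) *
        ⟪seqInvRoot t ht g, amp A (seqInvRoot t ht g)⟫_ℂ) • T₂ := by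
  rw [bdryRep_eq_sum h.eq_sum (h.diag t ht) (h.isUnit hc), Fintype.sum_prod_type]
  · simp only [Fin.sum_univ_two, Matrix.cons_val_zero, Matrix.cons_val_one, vecWeight_cutoff,
      map_inv₀, map_add, map_one, Complex.ofReal_inv, Complex.ofReal_add, Complex.ofReal_one]
    abel
  · intro i
    obtain ⟨a, b⟩ := i
    fin_cases a <;> fin_cases b
    · simpa using one_add_mul_sq_ne_zero zero_le_one ‖hat T₁ (seqRatio t ht f)‖
    · exact hc
    · intro h0
      apply hc
      have := congrArg (starRingEnd ℂ) h0
      simpa using this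
    · simpa using one_add_mul_sq_ne_zero zero_le_one ‖hat T₂ (seqRatio t ht g)‖

end CornerData

end Corners

end QWeight

namespace QWeight

/-! ### Construction of a corner from a partial isometry -/

section Existence

variable {K : Type*} [NormedAddCommGroup K] [InnerProductSpace ℂ K] [CompleteSpace K]
  [FiniteDimensional ℂ K]

/-- The relations on `C` turn `T₁`, `C`, `C*`, `T₂` into the Gram matrix of `C* v` and `T₂ v`, so
`amp_posForm` applies. -/
theorem isCPFull_corner {Φ : Op (KL2 K) →ₗ[ℂ] Op K} {x y : SeqL2 (KL2 K)} {T₁ T₂ C : Op K}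
    (hT₂ : IsStarProjection T₂) (hC₁ : C * star C = T₁)
    (hT₂C : T₂ * star C = star C) {α β : ℝ} {κ : ℂ} (hα : 0 < α) (hκ : ‖κ‖ ^ 2 ≤ α * β)
    (h : ∀ A, Φ A = (α * ⟪x, amp A x⟫_ℂ) • T₁ + (κ * ⟪x, amp A y⟫_ℂ) • C
      + ((starRingEnd ℂ) κ * ⟪y, amp A x⟫_ℂ) • star C + (β * ⟪y, amp A y⟫_ℂ) • T₂) :
    IsCPFull Φ := by
  rw [isCPFull_iff]
  intro n A hA v
  refine (amp_posForm hA x y hα hκ (fun i => star C (v i)) (fun i => T₂ (v i))).trans_eq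
    (Finset.sum_congr rfl fun i _ => Finset.sum_congr rfl fun j _ => ?_)
  have hCT : C * T₂ = C := by
    have := congrArg star hT₂C
    rwa [star_mul, star_star, hT₂.isSelfAdjoint.star_eq] at this
  have e1 : ⟪star C (v i), star C (v j)⟫_ℂ = ⟪v i, T₁ (v j)⟫_ℂ := by
    rw [inner_star_left, ← hC₁]; rfl
  have e2 : ⟪star C (v i), T₂ (v j)⟫_ℂ = ⟪v i, C (v j)⟫_ℂ := by
    rw [inner_star_left]
    exact congrArg (fun S : Op K => ⟪v i, S (v j)⟫_ℂ) hCT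
  have e3 : ⟪T₂ (v i), star C (v j)⟫_ℂ = ⟪v i, star C (v j)⟫_ℂ := by
    rw [← hT₂.isSelfAdjoint.star_eq, inner_star_left]
    exact congrArg (fun S : Op K => ⟪v i, S (v j)⟫_ℂ) hT₂C
  have e4 := hT₂.inner_apply (v i) (v j)
  simp only [h, e1, e2, e3, ← e4]
  change _ = ⟪v i, (α * ⟪x, amp (A i j) x⟫_ℂ) • T₁ (v j) + (κ * ⟪x, amp (A i j) y⟫_ℂ) • C (v j)
      + ((starRingEnd ℂ) κ * ⟪y, amp (A i j) x⟫_ℂ) • star C (v j)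
      + (β * ⟪y, amp (A i j) y⟫_ℂ) • T₂ (v j)⟫_ℂ
  simp only [inner_add_right, inner_smul_right]

variable {E₁ E₂ T₁ T₂ C : Op K} {f g : SeqL2 (KL2 K)} {s : ℝ}

/-- The hypothesis `hle` is the determinant condition for the coefficients of `π_t^#`. At `A = 1`
the corner terms vanish because `f` and `g` have orthogonal supports, so contractivity follows from
that of the diagonal maps and the orthogonality of `T₁`, `T₂`. -/
theorem isQWeightMap_cornerMap (h : CornerData E₁ E₂ T₁ T₂ C f g f ((s : ℂ) • g))
    (hC₁ : C * star C = T₁) (hT₂C : T₂ * star C = star C)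
    (hs : 0 < s) (hs1 : s ≤ 1) (hT₁0 : T₁ ≠ 0) (hT₂0 : T₂ ≠ 0)
    (hω : IsQWeightMap (rankOneMap 1 f T₁)) (hη : IsQWeightMap (rankOneMap 1 g T₂))
    (hle : ∀ t (ht : 0 < t), s ^ 2 * ((1 + ‖hat T₁ (seqRatio t ht f)‖ ^ 2) *
      (1 + ‖hat T₂ (seqRatio t ht g)‖ ^ 2)) ≤
        ‖1 + s * ⟪seqRatio t ht f, hat C (seqRatio t ht g)⟫_ℂ‖ ^ 2) :
    IsQWeightMap (cornerMap T₁ T₂ C f g f ((s : ℂ) • g)) := by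
  have hcs : ∀ t (ht : 0 < t), 1 + ⟪seqRatio t ht f, hat C (seqRatio t ht ((s : ℂ) • g))⟫_ℂ
      = 1 + s * ⟪seqRatio t ht f, hat C (seqRatio t ht g)⟫_ℂ := by
    intro t ht
    rw [map_smul, map_smul, inner_smul_right]
  have hc0 : ∀ t (ht : 0 < t), 1 + ⟪seqRatio t ht f, hat C (seqRatio t ht ((s : ℂ) • g))⟫_ℂ ≠ 0 := by
    intro t ht h0
    have h1 := hle t ht
    rw [← hcs, h0, norm_zero] at h1
    have : 0 < s ^ 2 * ((1 + ‖hat T₁ (seqRatio t ht f)‖ ^ 2) *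
      (1 + ‖hat T₂ (seqRatio t ht g)‖ ^ 2)) := by positivity
    simp at h1
    linarith
  have hrest : IsStarProjection (1 - T₁ - T₂) :=
    isStarProjection_sub h.range₁.one_sub h.range₂ (by rw [sub_mul, one_mul, h.T_mul, sub_zero])
  have hcp : ∀ t (ht : 0 < t), IsCPFull (bdryRep (cornerMap T₁ T₂ C f g f ((s : ℂ) • g)) t ht) := by
    intro t ht
    refine isCPFull_corner (x := seqInvRoot t ht f) (y := seqInvRoot t ht g) h.range₂ hC₁ hT₂C
      (α := (1 + ‖hat T₁ (seqRatio t ht f)‖ ^ 2)⁻¹) (β := (1 + ‖hat T₂ (seqRatio t ht g)‖ ^ 2)⁻¹)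
      (κ := s * (1 + ⟪seqRatio t ht f, hat C (seqRatio t ht ((s : ℂ) • g))⟫_ℂ)⁻¹)
      (by positivity) ?_ fun A => ?_
    · have h1 := hle t ht
      rw [← hcs] at h1
      have h2 : 0 < ‖1 + ⟪seqRatio t ht f, hat C (seqRatio t ht ((s : ℂ) • g))⟫_ℂ‖ :=
        norm_pos_iff.2 (hc0 t ht)
      rw [norm_mul, norm_inv, Complex.norm_real, Real.norm_of_nonneg hs.le, mul_pow, inv_pow,
        ← mul_inv, ← div_eq_mul_inv, div_le_iff₀ (by positivity), ← div_eq_inv_mul,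
        le_div_iff₀ (by positivity)]
      exact h1
    · rw [h.bdryRep_eq (hc0 t ht)]
      simp only [map_smul, inner_smul_left, inner_smul_right, Complex.conj_ofReal, map_mul]
      congr 3
      · congr 1; ring
      · ring
  refine ⟨fun ρ => ?_, ?_, fun ρ hρ => ?_, fun t ht => h.isUnit (hc0 t ht), hcp,
    fun t ht => (hcp t ht).norm_le fun v => ?_⟩
  · rw [cornerMap, adjMap_tensorWeight]
    exact ((((isBoundaryWeight_vecWeight f f).smul _).smul _).add
      ((isBoundaryWeight_vecWeight _ _).smul _) |>.add
      ((isBoundaryWeight_vecWeight _ _).smul _)).add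
      (((isBoundaryWeight_vecWeight g g).smul _).smul _)
  · apply isCP_of_toBdry
    refine isCPFull_corner (x := f) (y := g) h.range₂ hC₁ hT₂C (α := 1) (β := 1) (κ := s)
      one_pos ?_ fun A => ?_
    · rw [Complex.norm_real, Real.norm_of_nonneg hs.le]; nlinarith
    · rw [LinearMap.comp_apply, dualize_eq_sum h.eq_sum, Fintype.sum_prod_type]
      simp only [Fin.sum_univ_two, Matrix.cons_val_zero, Matrix.cons_val_one, vecWeight_toBdry,
        map_smul, inner_smul_left, inner_smul_right, Complex.conj_ofReal, Complex.ofReal_one,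
        one_mul]
      abel
  · rw [h.eq_sum, Fintype.sum_prod_type]
    simp only [Fin.sum_univ_two, Matrix.cons_val_zero, Matrix.cons_val_one, vecWeight_oneSubLam,
      h.inner_eq_zero h.supp_f h.supp_y]
    rw [← inner_conj_symm ((s : ℂ) • g), h.inner_eq_zero h.supp_f h.supp_y, inner_self_eq_ofReal,
      inner_self_eq_ofReal]
    simp only [map_zero, mul_zero, zero_add, add_zero]
    have h1 := hρ _ (.of_isStarProjection h.range₁)
    have h2 := hρ _ (.of_isStarProjection h.range₂)
    have h3 := hρ _ (.of_isStarProjection hrest)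
    rw [map_sub, map_sub] at h3
    have h4 : ((‖f‖ ^ 2 : ℝ) : ℂ) ≤ 1 := by exact_mod_cast norm_sq_le_one hω h.range₁ hT₁0
    have h5 : ((‖g‖ ^ 2 : ℝ) : ℂ) ≤ 1 := by exact_mod_cast norm_sq_le_one hη h.range₂ hT₂0
    have h6 := add_le_add (mul_le_mul_of_nonneg_left h4 h1) (mul_le_mul_of_nonneg_left h5 h2)
    refine h6.trans ?_
    rw [mul_one, mul_one]
    have h7 := add_le_add_left h3 (ρ T₁ + ρ T₂)
    simpa using h7
  · have hfg : ⟪seqInvRoot t ht f, seqInvRoot t ht ((s : ℂ) • g)⟫_ℂ = 0 :=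
      h.inner_eq_zero (by rw [hat_seqInvRoot, h.supp_f]) (by rw [hat_seqInvRoot, h.supp_y])
    have hgf : ⟪seqInvRoot t ht ((s : ℂ) • g), seqInvRoot t ht f⟫_ℂ = 0 := by
      rw [← inner_conj_symm, hfg, map_zero]
    rw [h.bdryRep_eq (hc0 t ht), amp_one]
    simp only [one_apply_eq_self, hfg, hgf, mul_zero, zero_smul, add_zero]
    rw [add_apply, smul_apply, smul_apply, inner_add_right, inner_smul_right, inner_smul_right, h.range₁.inner_apply,
      h.range₂.inner_apply, inner_self_eq_ofReal, inner_self_eq_ofReal, inner_self_eq_ofReal,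
      inner_self_eq_ofReal, ← Complex.ofReal_mul, ← Complex.ofReal_mul, ← Complex.ofReal_mul,
      ← Complex.ofReal_mul, ← Complex.ofReal_add, Complex.ofReal_re]
    have h1 : (1 + ‖hat T₁ (seqRatio t ht f)‖ ^ 2)⁻¹ * ‖seqInvRoot t ht f‖ ^ 2 ≤ 1 := by
      rw [inv_mul_le_iff₀ (by positivity), mul_one]
      exact norm_seqInvRoot_le hω h.range₁ hT₁0 t ht
    have h2 : (1 + ‖hat T₂ (seqRatio t ht g)‖ ^ 2)⁻¹ * ‖seqInvRoot t ht g‖ ^ 2 ≤ 1 := by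
      rw [inv_mul_le_iff₀ (by positivity), mul_one]
      exact norm_seqInvRoot_le hη h.range₂ hT₂0 t ht
    have h3 : ‖v‖ ^ 2 = ‖T₁ v‖ ^ 2 + ‖T₂ v‖ ^ 2 + ‖(1 - T₁ - T₂) v‖ ^ 2 := by
      have h4 : ⟪v, v⟫_ℂ = ⟪v, T₁ v⟫_ℂ + ⟪v, T₂ v⟫_ℂ + ⟪v, (1 - T₁ - T₂) v⟫_ℂ := by
        rw [← inner_add_right, ← inner_add_right]
        congr 1
        simp
      rw [h.range₁.inner_apply, h.range₂.inner_apply, hrest.inner_apply, inner_self_eq_ofReal,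
        inner_self_eq_ofReal, inner_self_eq_ofReal, inner_self_eq_ofReal] at h4
      exact_mod_cast h4
    nlinarith [sq_nonneg ‖T₁ v‖, sq_nonneg ‖T₂ v‖, sq_nonneg ‖(1 - T₁ - T₂) v‖]

/-- By the inequality of the means, `2z √((1 + ‖p‖²)(1 + ‖q‖²)) ≤ (1 + ‖q‖²) + z² (1 + ‖p‖²) ≤ (1 +
z² + R) + 2z Re ⟨p, q⟩`. The factor `s` is chosen so that multiplying by it turns the right side
into `2z (1 + s Re ⟨p, q⟩)`. -/
theorem sq_mul_le_of_norm_sub_le {V : Type*} [NormedAddCommGroup V] [InnerProductSpace ℂ V]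
    {p q : V} {z R : ℝ} (hz : 0 < z) (h : ‖q - (z : ℂ) • p‖ ^ 2 ≤ R) :
    (2 * z / (1 + z ^ 2 + R)) ^ 2 * ((1 + ‖p‖ ^ 2) * (1 + ‖q‖ ^ 2)) ≤
      ‖1 + ((2 * z / (1 + z ^ 2 + R) : ℝ) : ℂ) * ⟪p, q⟫_ℂ‖ ^ 2 := by
  have hR : 0 ≤ R := (sq_nonneg _).trans h
  have hd : 0 < 1 + z ^ 2 + R := by positivity
  set s := 2 * z / (1 + z ^ 2 + R) with hs
  have hs0 : 0 < s := by positivity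
  have hsz : s * (1 + z ^ 2 + R) = 2 * z := by rw [hs]; field_simp
  have h1 : ‖q - (z : ℂ) • p‖ ^ 2 = ‖q‖ ^ 2 - 2 * (z * (⟪p, q⟫_ℂ).re) + z ^ 2 * ‖p‖ ^ 2 := by
    rw [norm_sub_sq (𝕜 := ℂ), inner_re_symm, inner_smul_left, Complex.conj_ofReal, norm_smul, Complex.norm_real,
      Real.norm_of_nonneg hz.le, mul_pow]
    simp
  rw [h1] at h
  have h2 : s * ((1 + ‖q‖ ^ 2) + z ^ 2 * (1 + ‖p‖ ^ 2)) ≤ 2 * z * (1 + s * (⟪p, q⟫_ℂ).re) := by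
    nlinarith
  have h3 : 0 ≤ s * ((1 + ‖q‖ ^ 2) + z ^ 2 * (1 + ‖p‖ ^ 2)) := by positivity
  have h4 := pow_le_pow_left₀ h3 h2 2
  have h5 : (1 + s * (⟪p, q⟫_ℂ).re) ^ 2 ≤ ‖1 + (s : ℂ) * ⟪p, q⟫_ℂ‖ ^ 2 := by
    have h6 := Complex.abs_re_le_norm (1 + (s : ℂ) * ⟪p, q⟫_ℂ)
    have h7 : (1 + (s : ℂ) * ⟪p, q⟫_ℂ).re = 1 + s * (⟪p, q⟫_ℂ).re := by simp
    rw [← h7, ← sq_abs]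
    gcongr
  refine le_trans ?_ h5
  have h8 : (2 * z) ^ 2 * (s ^ 2 * ((1 + ‖p‖ ^ 2) * (1 + ‖q‖ ^ 2))) ≤
      (2 * z) ^ 2 * (1 + s * (⟪p, q⟫_ℂ).re) ^ 2 := by
    nlinarith [mul_nonneg (sq_nonneg s) (sq_nonneg ((1 + ‖q‖ ^ 2) - z ^ 2 * (1 + ‖p‖ ^ 2)))]
  exact le_of_mul_le_mul_left h8 (by positivity)

/-- The corner is `ρ ↦ s ρ(C) ⟨f, · g⟩` with the `s` of `sq_mul_le_of_norm_sub_le`. The hypothesis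
`h0` keeps it from vanishing. -/
theorem exists_qCorner (h : CornerData E₁ E₂ T₁ T₂ C f g f g)
    (hC₁ : C * star C = T₁) (hC₂ : star C * C = T₂) (hT₁0 : T₁ ≠ 0) (hT₂0 : T₂ ≠ 0)
    (hω : IsQWeightMap (rankOneMap 1 f T₁)) (hη : IsQWeightMap (rankOneMap 1 g T₂)) {z R : ℝ}
    (hz : 0 < z) (hR : ∀ t (ht : 0 < t),
      ‖hat T₂ (seqRatio t ht g) - (z : ℂ) • hat (star C) (seqRatio t ht f)‖ ^ 2 ≤ R)
    (h0 : vecWeight f g ≠ 0) :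
    ∃ γ, IsQCorner E₁ E₂ (rankOneMap 1 f T₁) (rankOneMap 1 g T₂) γ ∧ γ ≠ 0 ∧ rangeRank γ = 1 := by
  have hR0 : 0 ≤ R := (sq_nonneg _).trans (hR 1 one_pos)
  have hd : 0 < 1 + z ^ 2 + R := by positivity
  set s : ℝ := 2 * z / (1 + z ^ 2 + R) with hs
  have hs0 : 0 < s := by positivity
  have hs1 : s ≤ 1 := by
    rw [hs, div_le_one hd]; nlinarith [sq_nonneg (z - 1)]
  have hC0 : C ≠ 0 := by
    rintro rfl
    exact hT₂0 (by rw [← hC₂, mul_zero])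
  -- `C` is a partial isometry
  have hCT : C * T₂ = C := by
    -- From `C* C = T₂` and `T₂² = T₂`; the `C*`-identity then gives `C T₂ = C`.
    have h1 : star (C * T₂ - C) * (C * T₂ - C) = 0 := by
      rw [star_sub, star_mul, h.range₂.isSelfAdjoint.star_eq, sub_mul, mul_sub, mul_sub,
        mul_assoc T₂, ← mul_assoc (star C), hC₂, mul_assoc, hC₂]
      simp [h.range₂.isIdempotentElem.eq]
    exact sub_eq_zero.1 (CStarRing.star_mul_self_eq_zero_iff _ |>.1 h1)
  have hT₂C : T₂ * star C = star C := by
    have := congrArg star hCT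
    rwa [star_mul, h.range₂.isSelfAdjoint.star_eq] at this
  have hdata : CornerData E₁ E₂ T₁ T₂ C f g f ((s : ℂ) • g) :=
    { h with supp_y := by rw [map_smul, h.supp_y] }
  have hsv : (s : ℂ) • vecWeight f g ≠ 0 :=
    smul_ne_zero (Complex.ofReal_ne_zero.2 hs0.ne') h0
  have hdual : ∀ A, dualize (tensorWeight C (vecWeight f ((s : ℂ) • g))) A
      = vecWeight f ((s : ℂ) • g) A • C := fun A =>
    op_ext_dual fun ρ => by rw [dualize_spec, tensorWeight_apply, map_smul, smul_eq_mul, mul_comm]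
  obtain ⟨A₀, hA₀⟩ : ∃ A, vecWeight f ((s : ℂ) • g) A ≠ 0 := by
    by_contra! hA
    rw [vecWeight_smul] at hA
    exact hsv (LinearMap.ext hA)
  refine ⟨tensorWeight C (vecWeight f ((s : ℂ) • g)), ⟨fun ρ =>
    (isBoundaryWeight_vecWeight _ _).smul _, fun ρ A => ?_, ?_⟩, fun hγ => ?_, ?_⟩
  · rw [tensorWeight_apply, tensorWeight_apply, vecWeight_compress,
      h.proj₁.isSelfAdjoint.star_eq, h.supp_f, hdata.supp_y]
    congr 1
    change ρ C = ρ (E₁ * C * E₂)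
    rw [h.corner]
  · refine isQWeightMap_cornerMap hdata hC₁ hT₂C hs0 hs1 hT₁0 hT₂0 hω hη fun t ht => ?_
    have e1 : ⟪seqRatio t ht f, hat C (seqRatio t ht g)⟫_ℂ
        = ⟪hat (star C) (seqRatio t ht f), hat T₂ (seqRatio t ht g)⟫_ℂ := by
      rw [hat_inner_left, star_star, ← hat_mul_apply, hCT]
    have e2 : ‖hat T₁ (seqRatio t ht f)‖ ^ 2 = ‖hat (star C) (seqRatio t ht f)‖ ^ 2 := by
      have h1 : ((‖hat T₁ (seqRatio t ht f)‖ ^ 2 : ℝ) : ℂ)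
          = ((‖hat (star C) (seqRatio t ht f)‖ ^ 2 : ℝ) : ℂ) := by
        rw [← h.range₁.hat_inner_self, ← inner_self_eq_ofReal, hat_inner_left, star_star,
          ← hat_mul_apply, hC₁]
      exact_mod_cast h1
    rw [e1, e2]
    exact sq_mul_le_of_norm_sub_le hz (hR t ht)
  · apply hA₀
    have h1 := hdual A₀
    rw [hγ] at h1
    have h2 : dualize (0 : WeightMap K) A₀ = 0 := op_ext_dual fun ρ => by
      rw [dualize_spec]; simp
    rw [h2, eq_comm, smul_eq_zero] at h1
    exact h1.resolve_right hC0
  · have h1 : LinearMap.range (dualize (tensorWeight C (vecWeight f ((s : ℂ) • g))))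
        = Submodule.span ℂ {C} := by
      ext X
      rw [LinearMap.mem_range, Submodule.mem_span_singleton]
      constructor
      · rintro ⟨A, rfl⟩
        exact ⟨_, (hdual A).symm⟩
      · rintro ⟨c, rfl⟩
        refine ⟨(c / vecWeight f ((s : ℂ) • g) A₀) • A₀, ?_⟩
        rw [map_smul, hdual, smul_smul, div_mul_cancel₀ _ hA₀]
    rw [rangeRank, h1, finrank_span_singleton hC0]

end Existence

end QWeight

namespace QWeight

/-! ### From the unitary to a corner -/

section Sufficiency

theorem eq_zero_of_hasSum_sub_eq_ite {a b : ℕ → ℂ} {c : ℂ} {j : ℕ} (ha : HasSum a 0)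
    (hb : HasSum b 0) (h : ∀ k, a k - b k = if k = j then c else 0) : c = 0 := by
  have h1 := ha.sub hb
  simp only [h] at h1
  simpa using (hasSum_ite_eq j c).unique h1

/-- The two families differ only in the sign of the `j`-th entry, so subtracting the sums leaves `2
⟨f i, B (g j)⟩`, which is nonzero for a suitable rank one `B`. -/
theorem false_of_hasSum_swap {E : Type*} [NormedAddCommGroup E] [InnerProductSpace ℂ E]
    {f g F₁ F₂ : ℕ → E} {i j : ℕ} (hi : f i ≠ 0) (hj : g j ≠ 0)
    (h₁ : ∀ k, F₁ k = f (Equiv.swap i j k))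
    (h₂ : ∀ k, F₂ k = if k = j then -f (Equiv.swap i j k) else f (Equiv.swap i j k))
    (e₁ : ∀ B : Op E, HasSum (fun k => ⟪F₁ k, B (g k)⟫_ℂ) 0)
    (e₂ : ∀ B : Op E, HasSum (fun k => ⟪F₂ k, B (g k)⟫_ℂ) 0) : False := by
  have h : ∀ B : Op E, 2 * ⟪f i, B (g j)⟫_ℂ = 0 := fun B => by
    refine eq_zero_of_hasSum_sub_eq_ite (e₁ B) (e₂ B) (j := j) fun k => ?_
    rw [h₁, h₂]
    by_cases hk : k = j
    · rw [if_pos hk, if_pos hk, hk, Equiv.swap_apply_right, inner_neg_left]; ring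
    · rw [if_neg hk, if_neg hk, sub_self]
  have h3 := (mul_eq_zero.1 (h (InnerProductSpace.rankOne ℂ (f i) (g j)))).resolve_left two_ne_zero
  rw [InnerProductSpace.inner_right_rankOne_apply] at h3
  rcases mul_eq_zero.1 h3 with h4 | h4
  · exact hi (inner_self_eq_zero.1 h4)
  · exact hj (inner_self_eq_zero.1 h4)

variable {K : Type*} [NormedAddCommGroup K] [InnerProductSpace ℂ K] [FiniteDimensional ℂ K]

theorem exists_dual_ne_zero {C : Op K} (hC : C ≠ 0) : ∃ ρ : Module.Dual ℂ (Op K), ρ C ≠ 0 := by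
  by_contra! h
  exact hC (op_ext_dual fun ρ => by rw [h, map_zero])

/-- Evaluating where `φ` is nonzero shows that `C` is a multiple of `X C Y`, which is fixed by the
compression since `X` and `Y` are idempotent; then `ρ(C)` cancels. -/
theorem supp_of_rank_one {C X Y : Op K} {φ : Module.Dual ℂ (BdryAlg K)}
    {Φ : BdryAlg K → BdryAlg K} (hC : C ≠ 0) (hφ : φ ≠ 0) (hX : IsIdempotentElem X)
    (hY : IsIdempotentElem Y)
    (h : ∀ (ρ : Module.Dual ℂ (Op K)) A, ρ C * φ A = ρ (X * C * Y) * φ (Φ A)) :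
    X * C * Y = C ∧ ∀ A, φ (Φ A) = φ A := by
  obtain ⟨A₀, hA₀⟩ : ∃ A, φ A ≠ 0 := by
    by_contra! hA
    exact hφ (LinearMap.ext hA)
  have h1 : C = (φ (Φ A₀) / φ A₀) • (X * C * Y) := by
    refine op_ext_dual fun ρ => ?_
    rw [map_smul, smul_eq_mul, div_mul_eq_mul_div, mul_comm (φ (Φ A₀)), ← h,
      mul_div_cancel_right₀ _ hA₀]
  have h2 : X * C * Y = C := by
    rw [h1, mul_smul_comm, smul_mul_assoc]
    congr 1
    calc X * (X * C * Y) * Y = (X * X) * C * (Y * Y) := by simp only [mul_assoc]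
      _ = _ := by rw [hX.eq, hY.eq]
  refine ⟨h2, fun A => ?_⟩
  obtain ⟨ρ, hρ⟩ := exists_dual_ne_zero hC
  have h3 := h ρ A
  rw [h2] at h3
  exact (mul_left_cancel₀ hρ h3).symm

variable [CompleteSpace K]

/-- At `I - Λ` the weights give `‖E f‖² = ‖f‖²`, so the complementary component of `f` vanishes. -/
theorem hat_eq_of_compress {E : Op K} (hE : IsStarProjection E) {f : SeqL2 (KL2 K)}
    (h : ∀ A, vecWeight f f (compress E E A) = vecWeight f f A) : hat E f = f := by
  have h1 := h (oneSubLam K)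
  rw [vecWeight_compress, vecWeight_oneSubLam, vecWeight_oneSubLam, hE.isSelfAdjoint.star_eq,
    inner_self_eq_ofReal, inner_self_eq_ofReal] at h1
  have h2 : ‖hat E f‖ ^ 2 = ‖f‖ ^ 2 := by exact_mod_cast h1
  have h3 := hE.hat_norm_sq f
  have h4 : ‖hat (1 - E) f‖ = 0 := by
    refine pow_eq_zero_iff (two_ne_zero) |>.1 ?_
    linarith
  rw [norm_eq_zero, hat_sub_apply, hat_one_apply, sub_eq_zero] at h4
  exact h4.symm

theorem supp_rankOneMap {E T : Op K} {f : SeqL2 (KL2 K)} (hE : IsStarProjection E) (hT0 : T ≠ 0)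
    (hf : f ≠ 0) (h : ∀ ρ A, rankOneMap 1 f T ρ A = rankOneMap 1 f T (psi E E ρ) (compress E E A)) :
    E * T = T ∧ hat E f = f := by
  have hφ : vecWeight f f ≠ 0 := by
    intro h0
    have h2 := vecWeight_oneSubLam f f
    rw [h0, LinearMap.zero_apply, eq_comm, inner_self_eq_zero] at h2
    exact hf h2
  have h1 := supp_of_rank_one hT0 hφ hE.isIdempotentElem hE.isIdempotentElem
    (Φ := compress E E) fun ρ A => by
      have h2 := h ρ A
      rw [rankOneMap_apply, rankOneMap_apply, Complex.ofReal_one, one_mul, one_mul] at h2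
      exact h2
  refine ⟨?_, hat_eq_of_compress hE h1.2⟩
  rw [← h1.1, ← mul_assoc, ← mul_assoc, hE.isIdempotentElem.eq]

/-- Permuting a representing sequence or changing the sign of an entry does not change the weight,
but it does change the mixed functional with `g`. By `false_of_hasSum_swap` one of two such changes
makes it nonzero. -/
theorem exists_vecWeight_ne_zero {f g : SeqL2 (KL2 K)} (hf : f ≠ 0) (hg : g ≠ 0) :
    ∃ F : SeqL2 (KL2 K), vecWeight F F = vecWeight f f ∧ vecWeight F g ≠ 0 := by
  obtain ⟨i, hi⟩ : ∃ i, f i ≠ 0 := by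
    by_contra! h
    exact hf (lp.ext (funext h))
  obtain ⟨j, hj⟩ : ∃ j, g j ≠ 0 := by
    by_contra! h
    exact hg (lp.ext (funext h))
  have hrep : Represents f (vecWeight f f) := represents_iff.2 ⟨f, rfl, rfl⟩
  have h1 : Represents (fun k => f (Equiv.swap i j k)) (vecWeight f f) := fun B =>
    (Equiv.hasSum_iff (Equiv.swap i j)).2 (hrep B)
  have h2 : Represents (fun k => if k = j then -f (Equiv.swap i j k) else f (Equiv.swap i j k))
      (vecWeight f f) := fun B => by
    convert h1 B using 2 with k
    by_cases hk : k = j <;> simp [hk]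
  obtain ⟨F₁, hF₁, hw₁⟩ := represents_iff.1 h1
  obtain ⟨F₂, hF₂, hw₂⟩ := represents_iff.1 h2
  by_cases h3 : vecWeight F₁ g = 0
  · refine ⟨F₂, hw₂.symm, fun h4 => ?_⟩
    refine false_of_hasSum_swap hi hj (fun k => congrFun hF₁ k) (fun k => congrFun hF₂ k)
      (fun B => ?_) (fun B => ?_)
    · have := hasSum_inner_amp F₁ g B
      rwa [← vecWeight_toBdry, h3] at this
    · have := hasSum_inner_amp F₂ g B
      rwa [← vecWeight_toBdry, h4] at this
  · exact ⟨F₁, hw₁.symm, h3⟩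

variable {E₁ E₂ T₁ T₂ : Op K} {f g : SeqL2 (KL2 K)}

theorem norm_hat_seqRatio_eq {T : Op K} (hT : IsStarProjection T) {F : SeqL2 (KL2 K)}
    (h : vecWeight F F = vecWeight f f) (t : ℝ) (ht : 0 < t) :
    ‖hat T (seqRatio t ht F)‖ ^ 2 = ‖hat T (seqRatio t ht f)‖ ^ 2 := by
  have h1 := congrArg (fun φ : Module.Dual ℂ (BdryAlg K) => φ (cutoff t ht (Lam T))) h
  simp only [vecWeight_cutoff_Lam, hT.hat_inner_self] at h1
  exact_mod_cast h1

/-- With `C = T₁ U*`, the identity `T₂ U = C*` turns `T₂ D_t g - z C* D_t f` into `T₂ D_t (I -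
Λ)^{1/2} u`, whose norm is at most `‖u‖`. -/
theorem exists_qCorner_of_unitary
    (hω : IsQWeightMap (rankOneMap 1 f T₁)) (hη : IsQWeightMap (rankOneMap 1 g T₂))
    (horth : CompletelyOrthogonal E₁ E₂ (rankOneMap 1 f T₁) (rankOneMap 1 g T₂))
    (hT₁ : IsStarProjection T₁) (hT₂ : IsStarProjection T₂) (hT₁0 : T₁ ≠ 0) (hT₂0 : T₂ ≠ 0)
    (hf : f ≠ 0) (hg : g ≠ 0) {U : Op K} (hU : U ∈ unitary (Op K)) (hUT : U * T₁ * star U = T₂)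
    {z : ℝ} (hz : 0 < z) {u : SeqL2 (KL2 K)} (hu : g = (z : ℂ) • hat U f + amp (rootD K) u) :
    ∃ γ, IsQCorner E₁ E₂ (rankOneMap 1 f T₁) (rankOneMap 1 g T₂) γ ∧ γ ≠ 0 ∧ rangeRank γ = 1 := by
  obtain ⟨hm₁, hs₁⟩ := supp_rankOneMap horth.proj₁ hT₁0 hf horth.supp₁
  obtain ⟨hm₂, hs₂⟩ := supp_rankOneMap horth.proj₂ hT₂0 hg horth.supp₂
  have hUU : star U * U = 1 := (Unitary.mem_iff.1 hU).1
  set C : Op K := T₁ * star U with hC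
  have hsC : star C = U * T₁ := by
    rw [hC, star_mul, star_star, hT₁.isSelfAdjoint.star_eq]
  have hC₁ : C * star C = T₁ := by
    rw [hsC, hC, mul_assoc, ← mul_assoc (star U), hUU, one_mul, hT₁.isIdempotentElem.eq]
  have hC₂ : star C * C = T₂ := by
    rw [hsC, hC, mul_assoc, ← mul_assoc T₁, hT₁.isIdempotentElem.eq, ← mul_assoc, hUT]
  have hCU : C = star U * T₂ := by
    rw [← hUT, ← mul_assoc, ← mul_assoc, hUU, one_mul]
  have hT₂U : T₂ * U = star C := by
    rw [hsC, ← hUT, mul_assoc, hUU, mul_one]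
  have hm₂' : T₂ * E₂ = T₂ := by
    have := congrArg star hm₂
    rwa [star_mul, horth.proj₂.isSelfAdjoint.star_eq, hT₂.isSelfAdjoint.star_eq] at this
  have hcorner : E₁ * C * E₂ = C := by
    rw [hC, ← mul_assoc, hm₁, ← hC, hCU, mul_assoc, hm₂']
  have hdata : ∀ F : SeqL2 (KL2 K), vecWeight F F = vecWeight f f →
      CornerData E₁ E₂ T₁ T₂ C F g F g := by
    intro F hF
    have hF' : rankOneMap 1 F T₁ = rankOneMap 1 f T₁ := by rw [rankOneMap, hF]; rfl
    have hF0 : F ≠ 0 := by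
      rintro rfl
      have h2 := vecWeight_oneSubLam f f
      rw [← hF, vecWeight_oneSubLam, inner_zero_left, eq_comm, inner_self_eq_zero] at h2
      exact hf h2
    have hs := (supp_rankOneMap horth.proj₁ hT₁0 hF0 (by rw [hF']; exact horth.supp₁)).2
    exact ⟨horth.proj₁, horth.proj₂, horth.orth, hT₁, hT₂, hm₁, hm₂, hcorner, hs, hs₂, hs, hs₂⟩
  have hCn : ∀ F : SeqL2 (KL2 K), ‖hat (star C) F‖ ^ 2 = ‖hat T₁ F‖ ^ 2 := by
    intro F
    have h1 : ((‖hat T₁ F‖ ^ 2 : ℝ) : ℂ) = ((‖hat (star C) F‖ ^ 2 : ℝ) : ℂ) := by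
      rw [← hT₁.hat_inner_self, ← inner_self_eq_ofReal, hat_inner_left, star_star,
        ← hat_mul_apply, hC₁]
    exact_mod_cast h1.symm
  have hR : ∀ t (ht : 0 < t),
      ‖hat T₂ (seqRatio t ht g) - (z : ℂ) • hat (star C) (seqRatio t ht f)‖ ^ 2 ≤ ‖u‖ ^ 2 := by
    intro t ht
    have h1 : hat T₂ (seqRatio t ht g) - (z : ℂ) • hat (star C) (seqRatio t ht f)
        = hat T₂ (seqRatio t ht (amp (rootD K) u)) := by
      rw [hu, map_add, map_add, map_smul, map_smul, ← hat_seqRatio, ← hat_mul_apply, hT₂U]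
      simp
    rw [h1]
    refine (hT₂.hat_norm_le _).trans ?_
    gcongr
    exact seqRatio_rootD t ht u
  -- If `⟨f, · g⟩ = 0`, then `T₂ D_t g` and `z C* D_t f` are orthogonal, so a bound on their
  -- difference bounds each one. The bound then holds for every representing sequence, with `z`
  -- replaced by `1`.
  by_cases h0 : vecWeight f g = 0
  · obtain ⟨F, hF, hFg⟩ := exists_vecWeight_ne_zero hf hg
    have hF' : rankOneMap 1 F T₁ = rankOneMap 1 f T₁ := by rw [rankOneMap, hF]; rfl
    rw [← hF']
    refine exists_qCorner (hdata F hF) hC₁ hC₂ hT₁0 hT₂0 (hF' ▸ hω) hη one_pos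
      (R := 2 * (‖u‖ ^ 2 + ‖u‖ ^ 2 / z ^ 2)) (fun t ht => ?_) hFg
    have h1 : ⟪hat T₂ (seqRatio t ht g), (z : ℂ) • hat (star C) (seqRatio t ht f)⟫_ℂ = 0 := by
      rw [inner_smul_right, hat_inner_left, hT₂.isSelfAdjoint.star_eq, ← hat_mul_apply]
      have h2 : T₂ * star C = star C := by rw [hsC, ← hUT, mul_assoc, mul_assoc, ← mul_assoc (star U),
        hUU, one_mul, hT₁.isIdempotentElem.eq]
      rw [h2, ← inner_conj_symm, hat_inner_left, star_star, ← vecWeight_cutoff_Lam, h0]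
      simp
    have h2 := hR t ht
    rw [norm_sub_sq (𝕜 := ℂ), h1, norm_smul, mul_pow, Complex.norm_real, Real.norm_of_nonneg hz.le,
      hCn, ← norm_hat_seqRatio_eq hT₁ hF, ← hCn] at h2
    simp only [map_zero, mul_zero, sub_zero] at h2
    have h3 : ‖hat (star C) (seqRatio t ht F)‖ ^ 2 ≤ ‖u‖ ^ 2 / z ^ 2 := by
      rw [le_div_iff₀ (by positivity)]
      nlinarith [sq_nonneg ‖hat T₂ (seqRatio t ht g)‖]
    have h4 : ‖hat T₂ (seqRatio t ht g)‖ ^ 2 ≤ ‖u‖ ^ 2 := by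
      nlinarith [mul_nonneg (sq_nonneg z) (sq_nonneg ‖hat (star C) (seqRatio t ht F)‖)]
    rw [Complex.ofReal_one, one_smul]
    have h5 := norm_sub_le (hat T₂ (seqRatio t ht g)) (hat (star C) (seqRatio t ht F))
    have h6 := pow_le_pow_left₀ (norm_nonneg _) h5 2
    nlinarith [sq_nonneg (‖hat T₂ (seqRatio t ht g)‖ - ‖hat (star C) (seqRatio t ht F)‖)]
  · exact exists_qCorner (hdata f rfl) hC₁ hC₂ hT₁0 hT₂0 hω hη hz hR h0

end Sufficiency

end QWeight

namespace QWeight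

/-! ### The form of a corner of range rank one -/

section CornerForm

variable {K : Type*} [NormedAddCommGroup K] [InnerProductSpace ℂ K] [FiniteDimensional ℂ K]
  [CompleteSpace K]

/-- The dual map takes values in the line spanned by `C`. Its coefficient is recovered from a single
`ρ₀` with `ρ₀(C) ≠ 0`, and so is a boundary weight. -/
theorem exists_tensorWeight_of_rangeRank {γ : WeightMap K} (hb : ∀ ρ, IsBoundaryWeight (γ ρ))
    (hr : rangeRank γ = 1) : ∃ (C : Op K) (x y : SeqL2 (KL2 K)), ‖C‖ = 1 ∧
      γ = tensorWeight C (vecWeight x y) := by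
  obtain ⟨⟨C₀, hC₀⟩, hne, hspan⟩ := finrank_eq_one_iff'.1 hr
  have hC₀0 : C₀ ≠ 0 := fun h => hne (Subtype.ext h)
  have hn : ‖C₀‖ ≠ 0 := norm_ne_zero_iff.2 hC₀0
  have hC₁ : ‖((‖C₀‖⁻¹ : ℝ) : ℂ) • C₀‖ = 1 := by
    rw [norm_smul, Complex.norm_real, norm_inv, norm_norm, inv_mul_cancel₀ hn]
  obtain ⟨C, hCn, hC⟩ : ∃ C : Op K, ‖C‖ = 1 ∧ ∀ A, ∃ c : ℂ, c • C = dualize γ A := by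
    refine ⟨_, hC₁, fun A => ?_⟩
    obtain ⟨c, hc⟩ := hspan ⟨dualize γ A, LinearMap.mem_range_self _ A⟩
    refine ⟨c * ‖C₀‖, ?_⟩
    rw [smul_smul, mul_assoc, ← Complex.ofReal_mul, mul_inv_cancel₀ hn, Complex.ofReal_one, mul_one]
    exact congrArg Subtype.val hc
  have hC0 : C ≠ 0 := by rintro rfl; simp at hCn
  obtain ⟨ρ₀, hρ₀⟩ := exists_dual_ne_zero hC0
  obtain ⟨x, y, hxy⟩ := isBoundaryWeight_iff.1 ((hb ρ₀).smul (ρ₀ C)⁻¹)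
  refine ⟨C, x, y, hCn, LinearMap.ext fun ρ => LinearMap.ext fun A => ?_⟩
  obtain ⟨c, hc⟩ := hC A
  rw [tensorWeight_apply, ← hxy, LinearMap.smul_apply, ← dualize_spec, ← dualize_spec, ← hc,
    map_smul, map_smul, smul_eq_mul, smul_eq_mul, smul_eq_mul, mul_comm c (ρ₀ C),
    inv_mul_cancel_left₀ hρ₀, mul_comm]

theorem exists_corner_form {E₁ E₂ : Op K} (hE₁ : IsStarProjection E₁) (hE₂ : IsStarProjection E₂)
    {γ : WeightMap K} (hb : ∀ ρ, IsBoundaryWeight (γ ρ))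
    (hs : ∀ ρ A, γ ρ A = γ (psi E₁ E₂ ρ) (compress E₁ E₂ A)) (h0 : γ ≠ 0)
    (hr : rangeRank γ = 1) : ∃ (C : Op K) (x y : SeqL2 (KL2 K)), ‖C‖ = 1 ∧
      γ = tensorWeight C (vecWeight x y) ∧ E₁ * C * E₂ = C ∧ hat E₁ x = x ∧ hat E₂ y = y ∧
      vecWeight x y ≠ 0 := by
  obtain ⟨C, x, y, hC, rfl⟩ := exists_tensorWeight_of_rangeRank hb hr
  have hC0 : C ≠ 0 := by rintro rfl; simp at hC
  have hτ : vecWeight x y ≠ 0 := fun h => h0 <| by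
    refine LinearMap.ext fun ρ => LinearMap.ext fun A => ?_
    rw [tensorWeight_apply, h]
    simp
  obtain ⟨h1, h2⟩ := supp_of_rank_one hC0 hτ hE₁.isIdempotentElem hE₂.isIdempotentElem hs
  have h3 : vecWeight (hat E₁ x) (hat E₂ y) = vecWeight x y := by
    refine LinearMap.ext fun A => ?_
    rw [← h2 A, vecWeight_compress, hE₁.isSelfAdjoint.star_eq]
  refine ⟨C, hat E₁ x, hat E₂ y, hC, by rw [h3], h1, ?_, ?_, by rwa [h3]⟩
  · rw [← hat_mul_apply, hE₁.isIdempotentElem.eq]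
  · rw [← hat_mul_apply, hE₂.isIdempotentElem.eq]

end CornerForm

/-! ### Positivity of the boundary representation of a corner -/

section Positivity

theorem eq_zero_of_forall_re_add_nonneg {q : ℂ} {k : ℝ} (h : ∀ s : ℂ, 0 ≤ (s * q).re + k) :
    q = 0 := by
  by_contra hq
  have hn : 0 < ‖q‖ ^ 2 := by positivity
  have h1 := h (-((((|k| + 1) / ‖q‖ ^ 2 : ℝ) : ℂ)) * (starRingEnd ℂ) q)
  rw [mul_assoc, mul_comm ((starRingEnd ℂ) q), Complex.mul_conj, Complex.normSq_eq_norm_sq,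
    ← Complex.ofReal_neg, ← Complex.ofReal_mul, Complex.ofReal_re, neg_mul,
    div_mul_cancel₀ _ hn.ne'] at h1
  linarith [le_abs_self k]

/-- Positive operators span the whole algebra. -/
theorem exists_nonneg_ne_zero {E : Type*} [NormedAddCommGroup E] [InnerProductSpace ℂ E]
    [CompleteSpace E] {ℓ : Op E →ₗ[ℂ] ℂ} (h : ℓ ≠ 0) : ∃ A : Op E, 0 ≤ A ∧ ℓ A ≠ 0 := by
  by_contra! h0
  refine h (LinearMap.ext fun A => ?_)
  have h1 : A ∈ Submodule.span ℂ {a : Op E | 0 ≤ a} := by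
    rw [CStarAlgebra.span_nonneg]; trivial
  have h2 : Submodule.span ℂ {a : Op E | 0 ≤ a} ≤ LinearMap.ker ℓ :=
    Submodule.span_le.2 fun a ha => h0 a ha
  exact h2 h1

/-- If the form with entries `p`, `q`, `κ` is nonnegative, its determinant is. -/
theorem norm_sq_le_of_form_nonneg {p q : ℝ} {κ : ℂ}
    (h : ∀ α β : ℂ, 0 ≤ ‖α‖ ^ 2 * p + ‖β‖ ^ 2 * q + 2 * ((starRingEnd ℂ) α * β * κ).re) :
    ‖κ‖ ^ 2 ≤ p * q := by
  have hp : 0 ≤ p := by simpa using h 1 0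
  have hq : 0 ≤ q := by simpa using h 0 1
  have key : ∀ s : ℝ, 0 ≤ s ^ 2 * ‖κ‖ ^ 2 * p + q - 2 * s * ‖κ‖ ^ 2 := by
    intro s
    have h1 := h (-(s * κ)) 1
    have h2 : (starRingEnd ℂ) (-(s * κ)) * 1 * κ = ((-(s * ‖κ‖ ^ 2) : ℝ) : ℂ) := by
      rw [mul_one, map_neg, map_mul, Complex.conj_ofReal, neg_mul, mul_assoc, mul_comm _ κ,
        Complex.mul_conj, Complex.normSq_eq_norm_sq]
      push_cast; ring
    rw [h2, Complex.ofReal_re, norm_neg, norm_mul, Complex.norm_real, norm_one, mul_pow,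
      Real.norm_eq_abs, sq_abs] at h1
    linarith
  rcases hp.eq_or_lt with hp0 | hp0
  · by_contra! h1
    rw [← hp0, zero_mul] at h1
    have h2 := key ((q + 1) / ‖κ‖ ^ 2)
    rw [← hp0, mul_zero, mul_assoc, div_mul_cancel₀ _ h1.ne'] at h2
    linarith
  · have h2 := key (1 / p)
    have h3 : (1 / p) ^ 2 * ‖κ‖ ^ 2 * p + q - 2 * (1 / p) * ‖κ‖ ^ 2 = (p * q - ‖κ‖ ^ 2) / p := by
      field_simp; ring
    rw [h3] at h2
    rw [le_div_iff₀ hp0, zero_mul] at h2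
    linarith

/-- The unit ball is compact in finite dimensions, so the operator norm is attained. -/
theorem exists_norm_apply_eq {E : Type*} [NormedAddCommGroup E] [NormedSpace ℂ E]
    [FiniteDimensional ℂ E] {C : Op E} (hC : ‖C‖ = 1) : ∃ v, ‖v‖ ≤ 1 ∧ ‖C v‖ = 1 := by
  have : ProperSpace E := FiniteDimensional.proper_rclike ℂ E
  obtain ⟨v, hv, hmax⟩ := (isCompact_closedBall (0 : E) 1).exists_isMaxOn
    (Metric.nonempty_closedBall.2 zero_le_one) (f := fun v => ‖C v‖) (by fun_prop)
  have hv1 : ‖v‖ ≤ 1 := by simpa using hv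
  refine ⟨v, hv1, le_antisymm ?_ ?_⟩
  · calc ‖C v‖ ≤ ‖C‖ * ‖v‖ := C.le_opNorm v
      _ ≤ 1 := by rw [hC, one_mul]; exact hv1
  · rw [← hC]
    refine C.opNorm_le_of_unit_norm (norm_nonneg _) fun w hw => hmax (by simp [hw])

variable {K : Type*} [NormedAddCommGroup K] [InnerProductSpace ℂ K] [CompleteSpace K]
  [FiniteDimensional ℂ K] {E₁ E₂ T₁ T₂ C : Op K} {f g x y : SeqL2 (KL2 K)}

theorem inner_amp_nonneg {A : Op (KL2 K)} (hA : 0 ≤ A) (u : SeqL2 (KL2 K)) :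
    ⟪u, amp A u⟫_ℂ = (((⟪u, amp A u⟫_ℂ).re : ℝ) : ℂ) ∧ 0 ≤ (⟪u, amp A u⟫_ℂ).re := by
  have h1 : 0 ≤ ⟪u, amp A u⟫_ℂ := (hasSum_inner_amp u u A).nonneg fun n =>
    (ContinuousLinearMap.nonneg_iff_isPositive A).1 hA |>.inner_nonneg_right (u n)
  have h2 := Complex.nonneg_iff.1 h1
  exact ⟨Complex.ext (by simp) (by simpa using h2.2.symm), h2.1⟩

namespace CornerData

/-- This is `⟨v + w, π_t^#(A)(v + w)⟩ ≥ 0`. The block structure leaves only the two diagonal terms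
and twice the real part of one corner term. -/
theorem form_nonneg (h : CornerData E₁ E₂ T₁ T₂ C f g x y)
    (hq : IsQWeightMap (cornerMap T₁ T₂ C f g x y)) (hC : C ≠ 0) {t : ℝ} (ht : 0 < t)
    {A : Op (KL2 K)} (hA : 0 ≤ A) {v w : K} (hv : E₁ v = v) (hw : E₂ w = w) :
    0 ≤ (1 + ‖hat T₁ (seqRatio t ht f)‖ ^ 2)⁻¹ *
        (⟪seqInvRoot t ht f, amp A (seqInvRoot t ht f)⟫_ℂ).re * ‖T₁ v‖ ^ 2
      + (1 + ‖hat T₂ (seqRatio t ht g)‖ ^ 2)⁻¹ *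
        (⟪seqInvRoot t ht g, amp A (seqInvRoot t ht g)⟫_ℂ).re * ‖T₂ w‖ ^ 2
      + 2 * ((1 + ⟪seqRatio t ht x, hat C (seqRatio t ht y)⟫_ℂ)⁻¹ *
        ⟪seqInvRoot t ht x, amp A (seqInvRoot t ht y)⟫_ℂ * ⟪v, C w⟫_ℂ).re := by
  have hc := h.ne_zero hC (hq.invertible t ht)
  have h1 := (hq.rep_cp t ht).inner_nonneg
    (fun u => (ContinuousLinearMap.nonneg_iff_isPositive A).1 hA |>.inner_nonneg_right u) (v + w)
  have ez : ∀ {X Y : Op K} (u : K), X * Y = 0 → X (Y u) = 0 := fun {X Y} u hXY =>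
    congrArg (fun S : Op K => S u) hXY
  have em : ∀ {X Y Z : Op K} (u : K), X * Y = Z → X (Y u) = Z u := fun {X Y Z} u hXY =>
    congrArg (fun S : Op K => S u) hXY
  have hv2 : E₂ v = 0 := by rw [← hv]; exact ez v h.orth'
  have hw1 : E₁ w = 0 := by rw [← hw]; exact ez w h.orth
  have e1 : T₁ w = 0 := by rw [← em w h.mul₁', hw1, map_zero]
  have e2 : T₂ v = 0 := by rw [← em v h.mul₂', hv2, map_zero]
  have hCE : C * E₂ = C := by
    rw [← h.corner, mul_assoc, h.proj₂.isIdempotentElem.eq]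
  have hEC : E₁ * C = C := by
    rw [← h.corner, ← mul_assoc, ← mul_assoc, h.proj₁.isIdempotentElem.eq]
  have e3 : C v = 0 := by rw [← em v hCE, hv2, map_zero]
  have e4 : ⟪w, C w⟫_ℂ = 0 := by
    rw [← em w hEC, ← inner_star_left, h.proj₁.isSelfAdjoint.star_eq, hw1, inner_zero_left]
  have e5 : ⟪v + w, C (v + w)⟫_ℂ = ⟪v, C w⟫_ℂ := by
    rw [map_add, e3, zero_add, inner_add_left, e4, add_zero]
  have e6 : ⟪v + w, star C (v + w)⟫_ℂ = (starRingEnd ℂ) ⟪v, C w⟫_ℂ := by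
    rw [← e5, inner_conj_symm, ← inner_star_left, star_star]
  have e7 : ⟪v + w, T₁ (v + w)⟫_ℂ = ((‖T₁ v‖ ^ 2 : ℝ) : ℂ) := by
    rw [h.range₁.inner_apply, inner_self_eq_ofReal, map_add, e1, add_zero]
  have e8 : ⟪v + w, T₂ (v + w)⟫_ℂ = ((‖T₂ w‖ ^ 2 : ℝ) : ℂ) := by
    rw [h.range₂.inner_apply, inner_self_eq_ofReal, map_add, e2, zero_add]
  have hsa : star A = A := (IsSelfAdjoint.of_nonneg hA).star_eq
  have e9 : ⟪seqInvRoot t ht y, amp A (seqInvRoot t ht x)⟫_ℂ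
      = (starRingEnd ℂ) ⟪seqInvRoot t ht x, amp A (seqInvRoot t ht y)⟫_ℂ := by
    rw [inner_conj_symm, amp_inner_left, hsa]
  rw [h.bdryRep_eq hc] at h1
  simp only [add_apply, smul_apply, inner_add_right, inner_smul_right] at h1
  rw [e5, e6, e7, e8, e9, (inner_amp_nonneg hA _).1, (inner_amp_nonneg hA (seqInvRoot t ht g)).1,
    ← map_mul, ← map_mul] at h1
  have h2 := (Complex.nonneg_iff.1 h1).1
  rw [Complex.add_re, Complex.add_re, Complex.add_re, Complex.conj_re, ← Complex.ofReal_mul,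
    ← Complex.ofReal_mul, ← Complex.ofReal_mul, ← Complex.ofReal_mul, Complex.ofReal_re,
    Complex.ofReal_re] at h2
  linarith

theorem exists_apply_ne_zero (hτ : vecWeight x y ≠ 0) : ∃ (n : ℕ) (A : Op (KL2 K)), 0 ≤ A ∧
    ⟪seqInvRoot (cut n) (cut_pos n) x, amp A (seqInvRoot (cut n) (cut_pos n) y)⟫_ℂ ≠ 0 := by
  obtain ⟨n, hn⟩ : ∃ n, vecWeight x y ∘ₗ cutoff (cut n) (cut_pos n) ≠ 0 := by
    by_contra! h0
    exact hτ (vecWeight_eq_zero fun n A => congrArg (fun φ => φ A) (h0 n))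
  obtain ⟨A, hA, hA0⟩ := exists_nonneg_ne_zero hn
  refine ⟨n, A, hA, ?_⟩
  rwa [← vecWeight_cutoff]

/-- When `T₁ v = 0` or `T₂ w = 0`, scaling that vector leaves the diagonal part of the form
unchanged, so the cross term `⟨v, C w⟩` must vanish. Hence `C` lives between the ranges of `T₂` and
`T₁`. -/
theorem range_mul (h : CornerData E₁ E₂ T₁ T₂ C f g x y)
    (hq : IsQWeightMap (cornerMap T₁ T₂ C f g x y)) (hC : C ≠ 0) (hτ : vecWeight x y ≠ 0) :
    T₁ * C = C ∧ C * T₂ = C := by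
  obtain ⟨a, b, q, hq0, hform⟩ : ∃ (a b : ℝ) (q : ℂ), q ≠ 0 ∧ ∀ v w : K, E₁ v = v → E₂ w = w →
      0 ≤ a * ‖T₁ v‖ ^ 2 + b * ‖T₂ w‖ ^ 2 + 2 * (q * ⟪v, C w⟫_ℂ).re := by
    -- One `t` and one positive `A` with nonzero corner coefficient suffice.
    obtain ⟨n, A, hA, hA0⟩ := exists_apply_ne_zero hτ
    exact ⟨_, _, _, mul_ne_zero (inv_ne_zero (h.ne_zero hC (hq.invertible (cut n) (cut_pos n)))) hA0,
      fun v w hv hw => h.form_nonneg hq hC (cut_pos n) hA hv hw⟩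
  have em : ∀ {X Y Z : Op K} (u : K), X * Y = Z → X (Y u) = Z u := fun {X Y Z} u hXY =>
    congrArg (fun S : Op K => S u) hXY
  have hCE : C * E₂ = C := by
    rw [← h.corner, mul_assoc, h.proj₂.isIdempotentElem.eq]
  have hEC : E₁ * C = C := by
    rw [← h.corner, ← mul_assoc, ← mul_assoc, h.proj₁.isIdempotentElem.eq]
  have hEC' : E₂ * star C = star C := by
    rw [← h.corner', ← mul_assoc, ← mul_assoc, h.proj₂.isIdempotentElem.eq]
  have hCE' : star C * E₁ = star C := by
    rw [← h.corner', mul_assoc, h.proj₁.isIdempotentElem.eq]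
  have key : ∀ {v w : K}, E₁ v = v → E₂ w = w → T₁ v = 0 ∨ T₂ w = 0 → ⟪v, C w⟫_ℂ = 0 := by
    intro v w hv hw h0
    refine (mul_eq_zero.1 (?_ : q * ⟪v, C w⟫_ℂ = 0)).resolve_left hq0
    rcases h0 with h0 | h0
    · refine eq_zero_of_forall_re_add_nonneg (k := b * ‖T₂ w‖ ^ 2 / 2) fun s => ?_
      have h2 := hform ((starRingEnd ℂ) s • v) w (by rw [map_smul, hv]) hw
      rw [map_smul, h0, smul_zero, norm_zero, inner_smul_left, Complex.conj_conj,
        mul_left_comm] at h2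
      linarith
    · refine eq_zero_of_forall_re_add_nonneg (k := a * ‖T₁ v‖ ^ 2 / 2) fun s => ?_
      have h2 := hform v (s • w) hv (by rw [map_smul, hw])
      rw [map_smul, map_smul, h0, smul_zero, norm_zero, inner_smul_right, mul_left_comm] at h2
      linarith
  constructor
  · refine ContinuousLinearMap.ext fun w => ?_
    have hP := h.range₁.one_sub
    have h1 : ⟪(1 - T₁) (C w), C (E₂ w)⟫_ℂ = 0 := by
      refine key ?_ (h.proj₂.apply_apply w) (Or.inl ?_)
      · rw [sub_apply, map_sub, em _ h.mul₁]
        change E₁ (C w) - _ = C w - _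
        rw [em _ hEC]
      · exact em (Z := 0) _ (by rw [mul_sub, mul_one, h.range₁.isIdempotentElem.eq, sub_self])
    rw [em w hCE, ← inner_conj_symm, hP.inner_apply, inner_conj_symm, inner_self_eq_zero, sub_apply, sub_eq_zero] at h1
    exact h1.symm
  · have hP := h.range₂.one_sub
    have h2 : T₂ * star C = star C := by
      refine ContinuousLinearMap.ext fun v => ?_
      have h1 : ⟪E₁ v, C ((1 - T₂) (star C v))⟫_ℂ = 0 := by
        refine key (h.proj₁.apply_apply v) ?_ (Or.inr ?_)
        · rw [sub_apply, map_sub, em _ h.mul₂]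
          change E₂ (star C v) - _ = star C v - _
          rw [em _ hEC']
        · exact em (Z := 0) _ (by rw [mul_sub, mul_one, h.range₂.isIdempotentElem.eq, sub_self])
      rw [← inner_star_left, em v hCE', hP.inner_apply, inner_self_eq_zero, sub_apply,
        sub_eq_zero] at h1
      exact h1.symm
    have h3 := congrArg star h2
    rwa [star_mul, star_star, h.range₂.isSelfAdjoint.star_eq] at h3

/-- Unit vectors with `v = C w` make `⟨v, C w⟩ = 1`, so on their multiples the form is a positive `2
× 2` matrix; this is its determinant. -/
theorem norm_sq_apply_le (h : CornerData E₁ E₂ T₁ T₂ C f g x y)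
    (hq : IsQWeightMap (cornerMap T₁ T₂ C f g x y)) {v w : K} (hv : E₁ v = v) (hw : E₂ w = w)
    (hTv : T₁ v = v) (hTw : T₂ w = w) (hv1 : ‖v‖ = 1) (hw1 : ‖w‖ = 1) (hvw : v = C w)
    {t : ℝ} (ht : 0 < t) {A : Op (KL2 K)} (hA : 0 ≤ A) :
    (1 + ‖hat T₁ (seqRatio t ht f)‖ ^ 2) * (1 + ‖hat T₂ (seqRatio t ht g)‖ ^ 2) *
        ‖⟪seqInvRoot t ht x, amp A (seqInvRoot t ht y)⟫_ℂ‖ ^ 2 ≤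
      ‖1 + ⟪seqRatio t ht x, hat C (seqRatio t ht y)⟫_ℂ‖ ^ 2 *
        ((⟪seqInvRoot t ht f, amp A (seqInvRoot t ht f)⟫_ℂ).re *
          (⟪seqInvRoot t ht g, amp A (seqInvRoot t ht g)⟫_ℂ).re) := by
  have hC : C ≠ 0 := by
    rintro rfl
    rw [hvw] at hv1
    simp at hv1
  have hc := h.ne_zero hC (hq.invertible t ht)
  have h1 := norm_sq_le_of_form_nonneg
    (p := (1 + ‖hat T₁ (seqRatio t ht f)‖ ^ 2)⁻¹ *
      (⟪seqInvRoot t ht f, amp A (seqInvRoot t ht f)⟫_ℂ).re)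
    (q := (1 + ‖hat T₂ (seqRatio t ht g)‖ ^ 2)⁻¹ *
      (⟪seqInvRoot t ht g, amp A (seqInvRoot t ht g)⟫_ℂ).re)
    (κ := (1 + ⟪seqRatio t ht x, hat C (seqRatio t ht y)⟫_ℂ)⁻¹ *
      ⟪seqInvRoot t ht x, amp A (seqInvRoot t ht y)⟫_ℂ) fun α β => by
    have h2 := h.form_nonneg hq hC ht hA (v := α • v) (w := β • w) (by rw [map_smul, hv])
      (by rw [map_smul, hw])
    rw [map_smul, map_smul, map_smul, hTv, hTw, ← hvw, norm_smul, norm_smul, hv1, hw1, mul_one,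
      mul_one, inner_smul_left, inner_smul_right, inner_self_eq_ofReal, hv1, one_pow,
      Complex.ofReal_one, mul_one] at h2
    convert h2 using 2
    · ring
    · congr 2; ring
  rw [norm_mul, norm_inv] at h1
  have h3 : 0 < ‖1 + ⟪seqRatio t ht x, hat C (seqRatio t ht y)⟫_ℂ‖ := norm_pos_iff.2 hc
  rw [mul_pow, inv_pow, inv_mul_le_iff₀ (by positivity)] at h1
  have h4 : 0 < (1 + ‖hat T₁ (seqRatio t ht f)‖ ^ 2) * (1 + ‖hat T₂ (seqRatio t ht g)‖ ^ 2) := by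
    positivity
  refine (mul_le_mul_of_nonneg_left h1 h4.le).trans_eq ?_
  field_simp

end CornerData

end Positivity

end QWeight

namespace QWeight

/-! ### Monotonicity of the corner ratio -/

section Limit

/-- Cauchy–Schwarz gives `√(ab) + √((a'-a)(b'-b)) ≤ √(a'b')`. Multiplying by `c'` and inserting `h`
leaves `√(a'b') (c' - d)`, which `hcd` bounds. -/
theorem sqrt_mul_le_of_sub {a a' b b' c c' d : ℝ} (ha : 0 ≤ a) (hb : 0 ≤ b) (haa : a ≤ a')
    (hbb : b ≤ b') (hc : 0 ≤ c') (hd : 0 ≤ d)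
    (h : a' * b' * d ^ 2 ≤ c' ^ 2 * ((a' - a) * (b' - b))) (hcd : c' ≤ c + d) :
    Real.sqrt (a * b) * c' ≤ Real.sqrt (a' * b') * c := by
  have h1 : Real.sqrt (a' * b') * d ≤ c' * Real.sqrt ((a' - a) * (b' - b)) := by
    have := Real.sqrt_le_sqrt h
    rwa [Real.sqrt_mul' _ (sq_nonneg d), Real.sqrt_sq hd, Real.sqrt_mul (sq_nonneg c'),
      Real.sqrt_sq hc] at this
  have hab : 0 ≤ a * b := mul_nonneg ha hb
  have hab' : 0 ≤ a' * b' := mul_nonneg (ha.trans haa) (hb.trans hbb)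
  have hsub : 0 ≤ (a' - a) * (b' - b) := mul_nonneg (sub_nonneg.2 haa) (sub_nonneg.2 hbb)
  have h2 : Real.sqrt (a * b) + Real.sqrt ((a' - a) * (b' - b)) ≤ Real.sqrt (a' * b') := by
    have e1 := Real.sq_sqrt hab
    have e2 := Real.sq_sqrt hsub
    refine Real.le_sqrt_of_sq_le ?_
    have h3 : 2 * (Real.sqrt (a * b) * Real.sqrt ((a' - a) * (b' - b)))
        ≤ a * (b' - b) + b * (a' - a) := by
      refine le_of_sq_le_sq ?_ ?_
      · rw [mul_pow, mul_pow, e1, e2]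
        nlinarith [sq_nonneg (a * (b' - b) - b * (a' - a))]
      · nlinarith [mul_nonneg ha (sub_nonneg.2 hbb), mul_nonneg hb (sub_nonneg.2 haa)]
    nlinarith
  nlinarith [mul_le_mul_of_nonneg_right h2 hc,
    mul_le_mul_of_nonneg_left hcd (Real.sqrt_nonneg (a' * b'))]

variable {K : Type*} [NormedAddCommGroup K] [InnerProductSpace ℂ K] [CompleteSpace K]

theorem amp_tailProj_seqRatio {s t : ℝ} (hs : 0 < s) (ht : 0 < t) (h : s ≤ t)
    (u : SeqL2 (KL2 K)) : amp (tailProj K t) (seqRatio s hs u) = seqRatio t ht u := by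
  rw [seqRatio, amp_amp, tailProj_mul_ratio ht hs h]
  rfl

/-- `D_s u - D_t u` is supported in `(s, t]`, orthogonal to `D_t v`, so forms on increments are
increments of forms. -/
theorem inner_seqRatio_sub {s t : ℝ} (hs : 0 < s) (ht : 0 < t) (h : s ≤ t) (D : Op K)
    (u v : SeqL2 (KL2 K)) :
    ⟪seqRatio s hs u - seqRatio t ht u, hat D (seqRatio s hs v - seqRatio t ht v)⟫_ℂ =
      ⟪seqRatio s hs u, hat D (seqRatio s hs v)⟫_ℂ
        - ⟪seqRatio t ht u, hat D (seqRatio t ht v)⟫_ℂ := by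
  rw [map_sub, hat_seqRatio, hat_seqRatio]
  have h1 : ⟪seqRatio t ht u, seqRatio s hs (hat D v)⟫_ℂ
      = ⟪seqRatio t ht u, seqRatio t ht (hat D v)⟫_ℂ := by
    conv_rhs => rw [← amp_tailProj_seqRatio hs ht h (hat D v), ← star_tailProj, ← amp_inner_left,
      ← amp_tailProj_seqRatio hs ht h u, amp_amp, tailProj_mul_self]
    rw [amp_tailProj_seqRatio hs ht h u]
  have h2 : ⟪seqRatio s hs u, seqRatio t ht (hat D v)⟫_ℂ
      = ⟪seqRatio t ht u, seqRatio t ht (hat D v)⟫_ℂ := by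
    conv_rhs => rw [← amp_tailProj_seqRatio hs ht h u, amp_inner_left, star_tailProj,
      ← amp_tailProj_seqRatio hs ht h (hat D v), amp_amp, tailProj_mul_self]
    rw [amp_tailProj_seqRatio hs ht h (hat D v)]
  rw [inner_sub_left, inner_sub_right, inner_sub_right, h1, h2]
  ring

/-- Take `A = S* S` with `S = (X ⊗ I)(1 - E(t,∞)) Λ^{1/2}`: the factor `Λ^{1/2}` turns `E(s,∞)(I -
Λ)^{-1/2}` into `D_s`, and the projection keeps the part in `(s, t]`. -/
theorem exists_nonneg_inner_eq {s t : ℝ} (hs : 0 < s) (ht : 0 < t) (h : s ≤ t) (X : Op K) :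
    ∃ A : Op (KL2 K), 0 ≤ A ∧ ∀ u v, ⟪seqInvRoot s hs u, amp A (seqInvRoot s hs v)⟫_ℂ =
      ⟪seqRatio s hs u, hat (star X * X) (seqRatio s hs v)⟫_ℂ
        - ⟪seqRatio t ht u, hat (star X * X) (seqRatio t ht v)⟫_ℂ := by
  set S : Op (KL2 K) := ampl X * (1 - tailProj K t) * rootLam K with hS
  have hSv : ∀ v, amp S (seqInvRoot s hs v) = hat X (seqRatio s hs v - seqRatio t ht v) := by
    intro v
    rw [← amp_tailProj_seqRatio hs ht h v, hS, amp_mul_apply, amp_mul_apply, amp_sub, amp_one,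
      seqInvRoot, amp_amp, ← ratio_eq_mul]
    rfl
  refine ⟨star S * S, star_mul_self_nonneg S, fun u v => ?_⟩
  rw [← inner_seqRatio_sub hs ht h, amp_mul_apply, ← amp_inner_left, hSv, hSv, hat_inner_left,
    ← hat_mul_apply]

variable [FiniteDimensional ℂ K]

namespace CornerData

variable {E₁ E₂ T₁ T₂ C : Op K} {f g x y : SeqL2 (KL2 K)}

/-- Where `C` attains its norm `1`, equality in Cauchy–Schwarz gives `C* C w = w`. -/
theorem exists_unit_vectors (hC : ‖C‖ = 1) (hT₁ : T₁ * C = C) (hT₂ : C * T₂ = C)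
    (hT₂s : IsStarProjection T₂) :
    ∃ v w, T₁ v = v ∧ T₂ w = w ∧ ‖v‖ = 1 ∧ ‖w‖ = 1 ∧ v = C w ∧ w = star C v := by
  obtain ⟨w, hw, hCw⟩ := exists_norm_apply_eq hC
  have hw1 : ‖w‖ = 1 := by
    refine le_antisymm hw ?_
    have := C.le_opNorm w
    rwa [hC, one_mul, hCw] at this
  have h1 : star C (C w) = w := by
    have e1 : ‖star C (C w)‖ ≤ 1 := by
      have := (star C).le_opNorm (C w)
      rwa [norm_star, hC, one_mul, hCw] at this
    have e2 : ‖star C (C w) - w‖ ^ 2 ≤ 0 := by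
      rw [norm_sub_sq (𝕜 := ℂ), inner_star_left, inner_self_eq_ofReal, hCw, hw1]
      simp only [one_pow, Complex.ofReal_one, RCLike.one_re]
      nlinarith [norm_nonneg (star C (C w))]
    have e3 : ‖star C (C w) - w‖ = 0 := by
      have := sq_nonneg ‖star C (C w) - w‖
      exact pow_eq_zero_iff two_ne_zero |>.1 (le_antisymm e2 this)
    exact sub_eq_zero.1 (norm_eq_zero.1 e3)
  have h2 : T₂ * star C = star C := by
    have := congrArg star hT₂
    rwa [star_mul, hT₂s.isSelfAdjoint.star_eq] at this
  refine ⟨C w, w, congrArg (fun S : Op K => S w) hT₁, ?_, hCw, hw1, rfl, h1.symm⟩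
  rw [← h1]
  exact congrArg (fun S : Op K => S (C w)) h2

end CornerData

/-- The factor by which the off-diagonal part of a generalized boundary representation exceeds
that of the boundary weight. -/
noncomputable def cornerRatio (T₁ T₂ C : Op K) (f g x y : SeqL2 (KL2 K)) (n : ℕ) : ℝ :=
  Real.sqrt ((1 + ‖hat T₁ (seqRatio (cut n) (cut_pos n) f)‖ ^ 2) *
    (1 + ‖hat T₂ (seqRatio (cut n) (cut_pos n) g)‖ ^ 2)) /
    ‖1 + ⟪seqRatio (cut n) (cut_pos n) x, hat C (seqRatio (cut n) (cut_pos n) y)⟫_ℂ‖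

namespace CornerData

variable {E₁ E₂ T₁ T₂ C : Op K} {f g x y : SeqL2 (KL2 K)}

theorem cornerRatio_pos (h : CornerData E₁ E₂ T₁ T₂ C f g x y)
    (hq : IsQWeightMap (cornerMap T₁ T₂ C f g x y)) (hC : C ≠ 0) (n : ℕ) :
    0 < cornerRatio T₁ T₂ C f g x y n := by
  have := norm_pos_iff.2 (h.ne_zero hC (hq.invertible (cut n) (cut_pos n)))
  unfold cornerRatio
  positivity

theorem cornerRatio_sq_le (h : CornerData E₁ E₂ T₁ T₂ C f g x y)
    (hq : IsQWeightMap (cornerMap T₁ T₂ C f g x y)) (hC : ‖C‖ = 1) (hτ : vecWeight x y ≠ 0)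
    (n : ℕ) {A : Op (KL2 K)} (hA : 0 ≤ A) :
    cornerRatio T₁ T₂ C f g x y n ^ 2 *
        ‖⟪seqInvRoot (cut n) (cut_pos n) x, amp A (seqInvRoot (cut n) (cut_pos n) y)⟫_ℂ‖ ^ 2 ≤
      (⟪seqInvRoot (cut n) (cut_pos n) f, amp A (seqInvRoot (cut n) (cut_pos n) f)⟫_ℂ).re *
        (⟪seqInvRoot (cut n) (cut_pos n) g, amp A (seqInvRoot (cut n) (cut_pos n) g)⟫_ℂ).re := by
  have hC0 : C ≠ 0 := by rintro rfl; simp at hC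
  obtain ⟨h1, h2⟩ := h.range_mul hq hC0 hτ
  obtain ⟨v, w, hv, hw, hv1, hw1, hvw, -⟩ := exists_unit_vectors hC h1 h2 h.range₂
  have hv' : E₁ v = v := by rw [← hv]; exact congrArg (fun S : Op K => S v) h.mul₁
  have hw' : E₂ w = w := by rw [← hw]; exact congrArg (fun S : Op K => S w) h.mul₂
  have h3 := h.norm_sq_apply_le hq hv' hw' hv hw hv1 hw1 hvw (cut_pos n) hA
  have h4 := norm_pos_iff.2 (h.ne_zero hC0 (hq.invertible (cut n) (cut_pos n)))
  rw [cornerRatio, div_pow, Real.sq_sqrt (by positivity), div_mul_eq_mul_div,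
    div_le_iff₀ (by positivity)]
  linarith

/-- Positivity at the smaller parameter is tested on an operator living between the two parameters,
so it bounds the change of the corner term by the changes of the diagonal terms.
`sqrt_mul_le_of_sub` then compares the quotients. -/
theorem cornerRatio_mono (h : CornerData E₁ E₂ T₁ T₂ C f g x y)
    (hq : IsQWeightMap (cornerMap T₁ T₂ C f g x y)) (hC : ‖C‖ = 1) (hτ : vecWeight x y ≠ 0) :
    Monotone (cornerRatio T₁ T₂ C f g x y) := by
  intro k n hkn
  have hC0 : C ≠ 0 := by rintro rfl; simp at hC
  obtain ⟨h1, h2⟩ := h.range_mul hq hC0 hτ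
  have hp := norm_pos_iff.2 (h.ne_zero hC0 (hq.invertible (cut n) (cut_pos n)))
  have hp' := norm_pos_iff.2 (h.ne_zero hC0 (hq.invertible (cut k) (cut_pos k)))
  have hcut : cut n ≤ cut k := cut_anti hkn
  -- On the range of `E₁` the operator `T₁ + C` acts as `T₁`, on that of `E₂` as `C`, so one
  -- positive test operator controls the `f`, `g` and corner terms at once.
  obtain ⟨A, hA, hAe⟩ := exists_nonneg_inner_eq (cut_pos n) (cut_pos k) hcut (T₁ + C)
  have h3 := h.cornerRatio_sq_le hq hC hτ n hA
  set Y : Op K := star (T₁ + C) * (T₁ + C) with hY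
  have hsT := h.range₁.isSelfAdjoint.star_eq
  have hCE₁ : C * E₁ = 0 := by rw [← h.corner, mul_assoc, h.orth', mul_zero]
  have hCE₂ : C * E₂ = C := by rw [← h.corner, mul_assoc, h.proj₂.isIdempotentElem.eq]
  have hTE₂ : T₁ * E₂ = 0 := by rw [← h.mul₁', mul_assoc, h.orth, mul_zero]
  have e₁ : (T₁ + C) * E₁ = T₁ := by rw [add_mul, h.mul₁', hCE₁, add_zero]
  have e₂ : (T₁ + C) * E₂ = C := by rw [add_mul, hTE₂, hCE₂, zero_add]
  have hcomp : ∀ {X Z : Op K} {u v : SeqL2 (KL2 K)} (t : ℝ) (ht : 0 < t), hat X u = u → hat Z v = v →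
      ⟪seqRatio t ht u, hat Y (seqRatio t ht v)⟫_ℂ =
        ⟪seqRatio t ht u, hat (star ((T₁ + C) * X) * ((T₁ + C) * Z)) (seqRatio t ht v)⟫_ℂ := by
    intro X Z u v t ht hu hv
    conv_lhs => rw [← hu, ← hv, ← hat_seqRatio, ← hat_seqRatio, hat_inner_left, ← hat_mul_apply,
      ← hat_mul_apply]
    rw [star_mul, hY]
    simp only [mul_assoc]
  have hff : ∀ t (ht : 0 < t), ⟪seqRatio t ht f, hat Y (seqRatio t ht f)⟫_ℂ
      = ((‖hat T₁ (seqRatio t ht f)‖ ^ 2 : ℝ) : ℂ) := by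
    intro t ht
    rw [hcomp t ht h.supp_f h.supp_f, e₁, hsT, h.range₁.isIdempotentElem.eq, h.range₁.hat_inner_self]
  have hxy : ∀ t (ht : 0 < t), ⟪seqRatio t ht x, hat Y (seqRatio t ht y)⟫_ℂ
      = ⟪seqRatio t ht x, hat C (seqRatio t ht y)⟫_ℂ := by
    intro t ht
    rw [hcomp t ht h.supp_x h.supp_y, e₁, e₂, hsT, h1]
  -- Only an inequality for `g`: at this stage `‖C‖ = 1` and `C T₂ = C` give `C* C ≤ T₂`, not
  -- equality.
  have hgg : (⟪seqInvRoot (cut n) (cut_pos n) g, amp A (seqInvRoot (cut n) (cut_pos n) g)⟫_ℂ).re ≤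
      ‖hat T₂ (seqRatio (cut n) (cut_pos n) g)‖ ^ 2
        - ‖hat T₂ (seqRatio (cut k) (cut_pos k) g)‖ ^ 2 := by
    have e3 : ((‖hat T₂ (seqRatio (cut n) (cut_pos n) g)‖ ^ 2
        - ‖hat T₂ (seqRatio (cut k) (cut_pos k) g)‖ ^ 2 : ℝ) : ℂ) =
        ((‖hat T₂ (seqRatio (cut n) (cut_pos n) g - seqRatio (cut k) (cut_pos k) g)‖ ^ 2 : ℝ) : ℂ)
        := by
      rw [← h.range₂.hat_inner_self, inner_seqRatio_sub _ _ hcut, h.range₂.hat_inner_self,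
        h.range₂.hat_inner_self, Complex.ofReal_sub]
    rw [hAe, hcomp _ _ h.supp_g h.supp_g, hcomp _ _ h.supp_g h.supp_g,
      ← inner_seqRatio_sub _ _ hcut, e₂, hat_mul_apply, ← hat_inner_left, inner_self_eq_ofReal,
      Complex.ofReal_re, Complex.ofReal_injective e3]
    gcongr
    conv_lhs => rw [← h2, hat_mul_apply]
    have := hat_norm_le C (hat T₂ (seqRatio (cut n) (cut_pos n) g - seqRatio (cut k) (cut_pos k) g))
    rwa [hC, one_mul] at this
  rw [hAe f f, hff, hff, hAe x y, hxy, hxy, ← Complex.ofReal_sub, Complex.ofReal_re, cornerRatio,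
    div_pow, Real.sq_sqrt (by positivity)] at h3
  have hm : ‖hat T₁ (seqRatio (cut k) (cut_pos k) f)‖ ≤ ‖hat T₁ (seqRatio (cut n) (cut_pos n) f)‖ := by
    rw [hat_seqRatio, hat_seqRatio]
    exact seqRatio_anti _ _ hcut _
  have hn : ‖hat T₂ (seqRatio (cut k) (cut_pos k) g)‖ ≤ ‖hat T₂ (seqRatio (cut n) (cut_pos n) g)‖ := by
    rw [hat_seqRatio, hat_seqRatio]
    exact seqRatio_anti _ _ hcut _
  have hm2 := pow_le_pow_left₀ (norm_nonneg _) hm 2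
  have hn2 := pow_le_pow_left₀ (norm_nonneg _) hn 2
  rw [cornerRatio, cornerRatio, div_le_div_iff₀ hp' hp]
  refine sqrt_mul_le_of_sub (d := ‖⟪seqRatio (cut n) (cut_pos n) x,
    hat C (seqRatio (cut n) (cut_pos n) y)⟫_ℂ - ⟪seqRatio (cut k) (cut_pos k) x,
      hat C (seqRatio (cut k) (cut_pos k) y)⟫_ℂ‖) (by positivity) (by positivity) (by linarith)
    (by linarith) (norm_nonneg _) (norm_nonneg _) ?_ ?_
  · rw [div_mul_eq_mul_div, div_le_iff₀ (by positivity)] at h3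
    refine h3.trans ?_
    rw [mul_comm]
    refine mul_le_mul_of_nonneg_left (mul_le_mul (by linarith) (by linarith) ?_ (by linarith))
      (sq_nonneg _)
    exact (inner_amp_nonneg hA _).2
  · refine le_trans (le_of_eq ?_) (norm_add_le _ _)
    congr 1
    ring

end CornerData

end Limit

end QWeight

namespace QWeight

/-! ### The limiting positive matrix of weights -/

section Limit

variable {K : Type*} [NormedAddCommGroup K] [InnerProductSpace ℂ K] [CompleteSpace K]
  [FiniteDimensional ℂ K]

namespace CornerData

variable {E₁ E₂ T₁ T₂ C : Op K} {f g x y : SeqL2 (KL2 K)}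

/-- A fixed positive operator, cut off at `cut k` and with nonzero corner value, takes values
independent of `n ≥ k`, so `cornerRatio_sq_le` gives a bound independent of `n`. -/
theorem cornerRatio_bddAbove (h : CornerData E₁ E₂ T₁ T₂ C f g x y)
    (hq : IsQWeightMap (cornerMap T₁ T₂ C f g x y)) (hC : ‖C‖ = 1) (hτ : vecWeight x y ≠ 0) :
    BddAbove (Set.range (cornerRatio T₁ T₂ C f g x y)) := by
  have hC0 : C ≠ 0 := by rintro rfl; simp at hC
  obtain ⟨k, A, hA, hA0⟩ := exists_apply_ne_zero hτ
  set a := (⟪seqInvRoot (cut k) (cut_pos k) f, amp A (seqInvRoot (cut k) (cut_pos k) f)⟫_ℂ).re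
  set b := (⟪seqInvRoot (cut k) (cut_pos k) g, amp A (seqInvRoot (cut k) (cut_pos k) g)⟫_ℂ).re
  set d := ‖⟪seqInvRoot (cut k) (cut_pos k) x, amp A (seqInvRoot (cut k) (cut_pos k) y)⟫_ℂ‖
  have hd : 0 < d := norm_pos_iff.2 hA0
  have key : ∀ n, k ≤ n → cornerRatio T₁ T₂ C f g x y n ≤ Real.sqrt (a * b / d ^ 2) := by
    intro n hn
    have hB : 0 ≤ tailProj K (cut k) * A * tailProj K (cut k) := by
      have := star_left_conjugate_nonneg hA (tailProj K (cut k))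
      rwa [star_tailProj] at this
    have h1 := h.cornerRatio_sq_le hq hC hτ n hB
    have e1 : ∀ u v, ⟪seqInvRoot (cut n) (cut_pos n) u, amp (tailProj K (cut k) * A *
        tailProj K (cut k)) (seqInvRoot (cut n) (cut_pos n) v)⟫_ℂ =
        ⟪seqInvRoot (cut k) (cut_pos k) u, amp A (seqInvRoot (cut k) (cut_pos k) v)⟫_ℂ := by
      have hG : ∀ u, amp (tailProj K (cut k)) (seqInvRoot (cut n) (cut_pos n) u)
          = seqInvRoot (cut k) (cut_pos k) u := fun u => by
        rw [seqInvRoot, amp_amp, tailProj_mul_invRoot (cut_pos k) (cut_pos n) (cut_anti hn)]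
        rfl
      intro u v
      rw [← hG u, ← hG v, amp_inner_left, star_tailProj, mul_assoc, amp_mul_apply, amp_mul_apply]
    rw [e1, e1, e1] at h1
    refine Real.le_sqrt_of_sq_le ?_
    rwa [le_div_iff₀ (by positivity)]
  refine ⟨Real.sqrt (a * b / d ^ 2), ?_⟩
  rintro _ ⟨n, rfl⟩
  exact (h.cornerRatio_mono hq hC hτ (le_max_left n k)).trans (key _ (le_max_right n k))

/-- For `(I - Λ)^{1/2} B (I - Λ)^{1/2}` the truncated values are those of `E(t,∞) B E(t,∞)`; then `t
→ 0`. -/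
theorem iSup_sq_le (h : CornerData E₁ E₂ T₁ T₂ C f g x y)
    (hq : IsQWeightMap (cornerMap T₁ T₂ C f g x y)) (hC : ‖C‖ = 1) (hτ : vecWeight x y ≠ 0)
    {B : Op (KL2 K)} (hB : 0 ≤ B) :
    (⨆ n, cornerRatio T₁ T₂ C f g x y n) ^ 2 * ‖⟪x, amp B y⟫_ℂ‖ ^ 2 ≤
      (⟪f, amp B f⟫_ℂ).re * (⟪g, amp B g⟫_ℂ).re := by
  have hlim := tendsto_atTop_ciSup (h.cornerRatio_mono hq hC hτ) (h.cornerRatio_bddAbove hq hC hτ)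
  have hA : 0 ≤ rootD K * B * rootD K := by
    have := star_left_conjugate_nonneg hB (rootD K)
    rwa [adjoint_rootD] at this
  have e1 : ∀ u v n, ⟪seqInvRoot (cut n) (cut_pos n) u, amp (rootD K * B * rootD K)
      (seqInvRoot (cut n) (cut_pos n) v)⟫_ℂ =
      ⟪u, amp (tailProj K (cut n) * B * tailProj K (cut n)) v⟫_ℂ := by
    intro u v n
    rw [← vecWeight_cutoff, ← coe_toBdry, cutoff_coe _ _ (cut_pos n) B rfl, vecWeight_toBdry]
  have h1 := fun n => h.cornerRatio_sq_le hq hC hτ n hA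
  simp only [e1] at h1
  exact le_of_tendsto_of_tendsto' ((hlim.pow 2).mul ((tendsto_inner_tailProj x y B).norm.pow 2))
    (((Complex.continuous_re.tendsto _).comp (tendsto_inner_tailProj f f B)).mul
      ((Complex.continuous_re.tendsto _).comp (tendsto_inner_tailProj g g B))) h1

theorem _root_.QWeight.vecWeight_zero_left (y : SeqL2 (KL2 K)) : vecWeight 0 y = 0 :=
  (eq_vecWeight_iff.2 fun B => by rw [inner_zero_left]; rfl).symm

theorem _root_.QWeight.vecWeight_zero_right (x : SeqL2 (KL2 K)) : vecWeight x 0 = 0 :=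
  (eq_vecWeight_iff.2 fun B => by rw [map_zero, inner_zero_right]; rfl).symm

/-- A positive `2 × 2` matrix of boundary weights is given by two square summable sequences. -/
theorem exists_vectors (h : CornerData E₁ E₂ T₁ T₂ C f g x y) {r : ℝ}
    (hpos : ∀ B : Op (KL2 K), 0 ≤ B → r ^ 2 * ‖⟪x, amp B y⟫_ℂ‖ ^ 2 ≤
      (⟪f, amp B f⟫_ℂ).re * (⟪g, amp B g⟫_ℂ).re) :
    ∃ f' g' : SeqL2 (KL2 K), hat E₁ f' = f' ∧ hat E₂ g' = g' ∧ vecWeight f' f' = vecWeight f f ∧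
      vecWeight g' g' = vecWeight g g ∧ vecWeight f' g' = (r : ℂ) • vecWeight x y := by
  set φ : Module.Dual ℂ (BdryAlg K) := vecWeight f f + (r : ℂ) • vecWeight x y
    + (r : ℂ) • vecWeight y x + vecWeight g g with hφ
  have hb : IsBoundaryWeight φ :=
    (((isBoundaryWeight_vecWeight f f).add ((isBoundaryWeight_vecWeight x y).smul _)).add
      ((isBoundaryWeight_vecWeight y x).smul _)).add (isBoundaryWeight_vecWeight g g)
  obtain ⟨X, Y, hXY⟩ := isBoundaryWeight_iff.1 hb
  obtain ⟨F, hF⟩ := exists_eq_inner_self (ℓ := φ ∘ₗ toBdry) (x := X) (y := Y)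
    (fun B => by rw [hXY]; exact vecWeight_toBdry X Y B) fun k => by
    have hB : (0 : Op (KL2 K)) ≤ InnerProductSpace.rankOne ℂ k k :=
      (ContinuousLinearMap.nonneg_iff_isPositive _).2
        (InnerProductSpace.isPositive_rankOne_self k)
    set B : Op (KL2 K) := InnerProductSpace.rankOne ℂ k k
    have h1 := hpos B hB
    have e1 : ⟪y, amp B x⟫_ℂ = (starRingEnd ℂ) ⟪x, amp B y⟫_ℂ := by
      rw [inner_conj_symm, amp_inner_left, (IsSelfAdjoint.of_nonneg hB).star_eq]
    have e2 : (φ ∘ₗ toBdry) B = (((⟪f, amp B f⟫_ℂ).re + 2 * (r * (⟪x, amp B y⟫_ℂ).re)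
        + (⟪g, amp B g⟫_ℂ).re : ℝ) : ℂ) := by
      change vecWeight f f (toBdry B) + r * vecWeight x y (toBdry B) + r * vecWeight y x (toBdry B)
        + vecWeight g g (toBdry B) = _
      rw [vecWeight_toBdry, vecWeight_toBdry, vecWeight_toBdry, vecWeight_toBdry, e1,
        (inner_amp_nonneg hB f).1, (inner_amp_nonneg hB g).1, add_assoc (Complex.ofReal _),
        ← mul_add, Complex.add_conj, Complex.ofReal_re, Complex.ofReal_re]
      push_cast
      ring
    rw [e2, Complex.zero_le_real]
    have h2 := (inner_amp_nonneg hB f).2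
    have h3 := (inner_amp_nonneg hB g).2
    have h4 : (⟪x, amp B y⟫_ℂ).re ^ 2 ≤ ‖⟪x, amp B y⟫_ℂ‖ ^ 2 := by
      rw [← sq_abs]
      gcongr
      exact Complex.abs_re_le_norm _
    -- The determinant bound and `4ab ≤ (a + b)²` show that the diagonal terms dominate the cross
    -- terms, so `φ` is positive.
    have h5 : (2 * (r * (⟪x, amp B y⟫_ℂ).re)) ^ 2 ≤
        ((⟪f, amp B f⟫_ℂ).re + (⟪g, amp B g⟫_ℂ).re) ^ 2 := by
      nlinarith [sq_nonneg ((⟪f, amp B f⟫_ℂ).re - (⟪g, amp B g⟫_ℂ).re),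
        mul_le_mul_of_nonneg_left h4 (sq_nonneg r)]
    have h6 := (abs_le_of_sq_le_sq' h5 (by linarith)).1
    linarith
  have hφF : φ = vecWeight F F := eq_vecWeight_iff.2 hF
  have hs₁ := h.proj₁.isSelfAdjoint.star_eq
  have hs₂ := h.proj₂.isSelfAdjoint.star_eq
  have hcomp : ∀ {E E' : Op K} (A : BdryAlg K), star E = E → vecWeight (hat E F) (hat E' F) A =
      vecWeight (hat E f) (hat E' f) A + r * vecWeight (hat E x) (hat E' y) A
        + r * vecWeight (hat E y) (hat E' x) A + vecWeight (hat E g) (hat E' g) A := by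
    intro E E' A hE
    have := vecWeight_compress F F E E' A
    rw [hE] at this
    rw [← this, ← hφF]
    change vecWeight f f _ + r * vecWeight x y _ + r * vecWeight y x _ + vecWeight g g _ = _
    simp only [vecWeight_compress, hE]
  have z₁ : ∀ {u}, hat E₂ u = u → hat E₁ u = 0 := fun {u} hu => by
    rw [← hu, ← hat_mul_apply, h.orth, hat_zero_apply]
  have z₂ : ∀ {u}, hat E₁ u = u → hat E₂ u = 0 := fun {u} hu => by
    rw [← hu, ← hat_mul_apply, h.orth', hat_zero_apply]
  -- One vector `F` represents the sum of all four weights; its two components recover the blocks.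
  refine ⟨hat E₁ F, hat E₂ F, ?_, ?_, LinearMap.ext fun A => ?_, LinearMap.ext fun A => ?_,
    LinearMap.ext fun A => ?_⟩
  · rw [← hat_mul_apply, h.proj₁.isIdempotentElem.eq]
  · rw [← hat_mul_apply, h.proj₂.isIdempotentElem.eq]
  · rw [hcomp A hs₁, h.supp_f, z₁ h.supp_y, z₁ h.supp_g, vecWeight_zero_left, vecWeight_zero_left,
      vecWeight_zero_right]
    simp
  · rw [hcomp A hs₂, h.supp_g, z₂ h.supp_x, z₂ h.supp_f, vecWeight_zero_left, vecWeight_zero_left,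
      vecWeight_zero_right]
    simp
  · rw [hcomp A hs₁, h.supp_x, h.supp_y, z₁ h.supp_y, z₁ h.supp_g, z₂ h.supp_f,
      vecWeight_zero_left, vecWeight_zero_left, vecWeight_zero_right]
    simp

end CornerData

end Limit

/-! ### Near-equality in the Cauchy–Schwarz inequality -/

section Phase

/-- A near-equality in the Cauchy–Schwarz inequality makes two vectors nearly proportional. -/
theorem exists_near_multiple {V : Type*} [NormedAddCommGroup V] [InnerProductSpace ℂ V]
    {a b p q : V} {r : ℝ} (hp : ‖p‖ ≤ ‖a‖) (hq : ‖q‖ ≤ ‖b‖) (hpq : ⟪a, q⟫_ℂ = ⟪p, b⟫_ℂ)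
    (h : Real.sqrt ((1 + ‖a‖ ^ 2) * (1 + ‖b‖ ^ 2)) ≤ r + ‖⟪p, b⟫_ℂ‖) :
    ∃ w : ℂ, 1 ≤ 2 * r * ‖w‖ ∧ ‖w‖ ≤ 2 * r ∧ ‖b - w • p‖ ≤ r ∧ ‖w • a - q‖ ≤ r := by
  set κ := ⟪p, b⟫_ℂ with hκ
  obtain ⟨θ, hθ, hθκ⟩ : ∃ θ : ℂ, ‖θ‖ = 1 ∧ (starRingEnd ℂ) θ * κ = ‖κ‖ := by
    by_cases h0 : κ = 0
    · exact ⟨1, norm_one, by simp [h0]⟩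
    · have hn : (‖κ‖ : ℂ) ≠ 0 := by simpa using h0
      refine ⟨κ / ‖κ‖, by simp [h0], ?_⟩
      rw [map_div₀, Complex.conj_ofReal, div_mul_eq_mul_div, mul_comm, Complex.mul_conj,
        Complex.normSq_eq_norm_sq]
      field_simp
      push_cast
      ring
  -- This `z` balances `z² (1 + ‖a‖²) = 1 + ‖b‖²`. Both squared distances are then at most `2zr - 1
  -- - z² ≤ r²`, and nonnegativity of `2zr - 1 - z²` bounds `z` on both sides.
  set z := Real.sqrt ((1 + ‖b‖ ^ 2) / (1 + ‖a‖ ^ 2)) with hz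
  have hz0 : 0 < z := Real.sqrt_pos.2 (by positivity)
  have hz2 : z ^ 2 * (1 + ‖a‖ ^ 2) = 1 + ‖b‖ ^ 2 := by
    rw [hz, Real.sq_sqrt (by positivity)]
    field_simp
  have hzs : z * Real.sqrt ((1 + ‖a‖ ^ 2) * (1 + ‖b‖ ^ 2)) = 1 + ‖b‖ ^ 2 := by
    rw [hz, ← Real.sqrt_mul (by positivity)]
    rw [show (1 + ‖b‖ ^ 2) / (1 + ‖a‖ ^ 2) * ((1 + ‖a‖ ^ 2) * (1 + ‖b‖ ^ 2))
      = (1 + ‖b‖ ^ 2) ^ 2 by field_simp]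
    exact Real.sqrt_sq (by positivity)
  have hzh : 1 + ‖b‖ ^ 2 ≤ z * r + z * ‖κ‖ := by
    rw [← hzs, ← mul_add]
    gcongr
  have hw : ‖(z : ℂ) * θ‖ = z := by
    rw [norm_mul, hθ, mul_one, Complex.norm_real, Real.norm_of_nonneg hz0.le]
  have hzκ : (starRingEnd ℂ) ((z : ℂ) * θ) * κ = ((z * ‖κ‖ : ℝ) : ℂ) := by
    rw [map_mul, Complex.conj_ofReal, mul_assoc, hθκ, Complex.ofReal_mul]
  have e1 : ‖b - ((z : ℂ) * θ) • p‖ ^ 2 = ‖b‖ ^ 2 - 2 * (z * ‖κ‖) + z ^ 2 * ‖p‖ ^ 2 := by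
    rw [norm_sub_sq (𝕜 := ℂ), inner_re_symm, inner_smul_left, ← hκ, hzκ, norm_smul, hw,
      mul_pow]
    simp
  have e2 : ‖((z : ℂ) * θ) • a - q‖ ^ 2 = z ^ 2 * ‖a‖ ^ 2 - 2 * (z * ‖κ‖) + ‖q‖ ^ 2 := by
    rw [norm_sub_sq (𝕜 := ℂ), inner_smul_left, hpq, hzκ, norm_smul, hw, mul_pow]
    simp
  have hp2 : z ^ 2 * ‖p‖ ^ 2 ≤ z ^ 2 * ‖a‖ ^ 2 := by gcongr
  have hq2 : ‖q‖ ^ 2 ≤ ‖b‖ ^ 2 := by gcongr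
  have b1 : ‖b - ((z : ℂ) * θ) • p‖ ^ 2 ≤ 2 * z * r - 1 - z ^ 2 := by rw [e1]; linarith
  have b2 : ‖((z : ℂ) * θ) • a - q‖ ^ 2 ≤ 2 * z * r - 1 - z ^ 2 := by rw [e2]; linarith
  have b3 : 0 ≤ 2 * z * r - 1 - z ^ 2 := (sq_nonneg _).trans b1
  have b4 : 2 * z * r - 1 - z ^ 2 ≤ r ^ 2 := by nlinarith [sq_nonneg (z - r)]
  have hr : 0 ≤ r := by
    by_contra! hr
    nlinarith [mul_pos hz0 (neg_pos.2 hr), sq_nonneg z]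
  refine ⟨z * θ, ?_, ?_, ?_, ?_⟩
  · rw [hw]; nlinarith [sq_nonneg z]
  · rw [hw]; nlinarith
  · exact abs_le_of_sq_le_sq' (b1.trans b4) hr |>.2
  · exact abs_le_of_sq_le_sq' (b2.trans b4) hr |>.2

end Phase

end QWeight

namespace QWeight

/-! ### From a corner to the unitary -/

section Necessity

variable {K : Type*} [NormedAddCommGroup K] [InnerProductSpace ℂ K] [CompleteSpace K]
  [FiniteDimensional ℂ K] {E₁ E₂ T₁ T₂ C : Op K} {f g x y : SeqL2 (KL2 K)}

theorem exists_cut_le {t : ℝ} (ht : 0 < t) : ∃ n, cut n ≤ t :=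
  (exists_nat_one_div_lt ht).imp fun _ h => h.le

/-- A corner ratio at most `r` bounds the square root by `r |1 + c| ≤ r + |r c|`, and `r c` is the
corner value of `f'`, `g'`. -/
theorem norm_inner_cornerRatio (h : CornerData E₁ E₂ T₁ T₂ C f g x y)
    (hq : IsQWeightMap (cornerMap T₁ T₂ C f g x y)) (hC : ‖C‖ = 1) {r : ℝ} (hr : 0 ≤ r) {n : ℕ}
    (hn : cornerRatio T₁ T₂ C f g x y n ≤ r) {f' g' : SeqL2 (KL2 K)}
    (hf : vecWeight f' f' = vecWeight f f) (hg : vecWeight g' g' = vecWeight g g)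
    (hfg : vecWeight f' g' = (r : ℂ) • vecWeight x y) :
    Real.sqrt ((1 + ‖hat T₁ (seqRatio (cut n) (cut_pos n) f')‖ ^ 2) *
      (1 + ‖hat T₂ (seqRatio (cut n) (cut_pos n) g')‖ ^ 2)) ≤
      r + ‖⟪seqRatio (cut n) (cut_pos n) f', hat C (seqRatio (cut n) (cut_pos n) g')⟫_ℂ‖ := by
  have hC0 : C ≠ 0 := by rintro rfl; simp at hC
  have hc := norm_pos_iff.2 (h.ne_zero hC0 (hq.invertible (cut n) (cut_pos n)))
  rw [cornerRatio, div_le_iff₀ hc] at hn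
  rw [norm_hat_seqRatio_eq h.range₁ hf, norm_hat_seqRatio_eq h.range₂ hg]
  refine hn.trans ?_
  have e1 : ⟪seqRatio (cut n) (cut_pos n) f', hat C (seqRatio (cut n) (cut_pos n) g')⟫_ℂ
      = r * ⟪seqRatio (cut n) (cut_pos n) x, hat C (seqRatio (cut n) (cut_pos n) y)⟫_ℂ := by
    rw [← vecWeight_cutoff_Lam, hfg, ← vecWeight_cutoff_Lam]
    rfl
  rw [e1, norm_mul, Complex.norm_real, Real.norm_of_nonneg hr]
  nlinarith [norm_add_le (1 : ℂ) ⟪seqRatio (cut n) (cut_pos n) x,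
    hat C (seqRatio (cut n) (cut_pos n) y)⟫_ℂ, norm_one (α := ℂ)]

/-- For each `t` near-equality yields a multiplier `w`. The admissible sets are compact and decrease
as `t → 0`, so one `w` serves all `t`. -/
theorem exists_bounded_differences (h : CornerData E₁ E₂ T₁ T₂ C f g x y)
    (hq : IsQWeightMap (cornerMap T₁ T₂ C f g x y)) (hC : ‖C‖ = 1) (hτ : vecWeight x y ≠ 0) :
    ∃ (f' g' : SeqL2 (KL2 K)) (w : ℂ) (r : ℝ), vecWeight f' f' = vecWeight f f ∧
      vecWeight g' g' = vecWeight g g ∧ w ≠ 0 ∧ ∀ t (ht : 0 < t),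
        ‖seqRatio t ht (hat T₂ g' - w • hat (star C) f')‖ ≤ r ∧
        ‖seqRatio t ht (w • hat T₁ f' - hat C g')‖ ≤ r := by
  have hC0 : C ≠ 0 := by rintro rfl; simp at hC
  obtain ⟨h1, h2⟩ := h.range_mul hq hC0 hτ
  have hbdd := h.cornerRatio_bddAbove hq hC hτ
  set r := ⨆ n, cornerRatio T₁ T₂ C f g x y n with hr
  have hr0 : 0 < r := (h.cornerRatio_pos hq hC0 0).trans_le (le_ciSup hbdd 0)
  obtain ⟨f', g', -, -, hf, hg, hfg⟩ :=
    h.exists_vectors (r := r) fun B hB => h.iSup_sq_le hq hC hτ hB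
  have hC1 : star C * T₁ = star C := by
    have := congrArg star h1
    rwa [star_mul, h.range₁.isSelfAdjoint.star_eq] at this
  -- The upper bound on `‖w‖` gives compactness, the lower one keeps the common `w` nonzero.
  set S : ℕ → Set ℂ := fun n => {w | 1 ≤ 2 * r * ‖w‖ ∧ ‖w‖ ≤ 2 * r ∧
    ‖seqRatio (cut n) (cut_pos n) (hat T₂ g' - w • hat (star C) f')‖ ≤ r ∧
    ‖seqRatio (cut n) (cut_pos n) (w • hat T₁ f' - hat C g')‖ ≤ r} with hS
  have hcl : ∀ n, IsClosed (S n) := fun n => by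
    simp only [hS, Set.ofPred_and]
    refine (isClosed_le ?_ ?_).inter ((isClosed_le ?_ ?_).inter
      ((isClosed_le ?_ ?_).inter (isClosed_le ?_ ?_))) <;> fun_prop
  have hne : ∀ n, (S n).Nonempty := by
    intro n
    set a := hat T₁ (seqRatio (cut n) (cut_pos n) f')
    set b := hat T₂ (seqRatio (cut n) (cut_pos n) g')
    have e1 : ⟪hat (star C) a, b⟫_ℂ =
        ⟪seqRatio (cut n) (cut_pos n) f', hat C (seqRatio (cut n) (cut_pos n) g')⟫_ℂ := by
      rw [hat_inner_left, star_star, hat_inner_left, ← hat_mul_apply, ← hat_mul_apply,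
        h.range₁.isSelfAdjoint.star_eq, h1, h2]
    have h3 := norm_inner_cornerRatio h hq hC hr0.le (le_ciSup hbdd n) hf hg hfg
    rw [← e1] at h3
    obtain ⟨w, hw1, hw2, hw3, hw4⟩ := exists_near_multiple (a := a) (b := b) (p := hat (star C) a)
      (q := hat C b) (by simpa [hC] using hat_norm_le (star C) a)
      (by simpa [hC] using hat_norm_le C b) (hat_inner_right C a b) h3
    refine ⟨w, hw1, hw2, ?_, ?_⟩
    · rwa [map_sub, map_smul, ← hat_seqRatio, ← hat_seqRatio, ← hC1, hat_mul_apply]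
    · rw [map_sub, map_smul, ← hat_seqRatio, ← hat_seqRatio]
      rwa [← hat_mul_apply, h2] at hw4
  have hmono : ∀ n, S (n + 1) ⊆ S n := by
    rintro n w ⟨hw1, hw2, hw3, hw4⟩
    exact ⟨hw1, hw2, (seqRatio_anti _ _ (cut_anti n.le_succ) _).trans hw3,
      (seqRatio_anti _ _ (cut_anti n.le_succ) _).trans hw4⟩
  have hcomp : IsCompact (S 0) :=
    (isCompact_closedBall (0 : ℂ) (2 * r)).of_isClosed_subset (hcl 0) fun w hw => by
      simpa using hw.2.1
  obtain ⟨w, hw⟩ :=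
    IsCompact.nonempty_iInter_of_sequence_nonempty_isCompact_isClosed S hmono hne hcomp hcl
  rw [Set.mem_iInter] at hw
  refine ⟨f', g', w, r, hf, hg, ?_, fun t ht => ?_⟩
  · rintro rfl
    have := (hw 0).1
    rw [norm_zero] at this
    linarith
  · obtain ⟨n, hn⟩ := exists_cut_le ht
    exact ⟨(seqRatio_anti _ _ hn _).trans (hw n).2.2.1, (seqRatio_anti _ _ hn _).trans (hw n).2.2.2⟩

theorem rankOneMap_congr {s : ℝ} {T : Op K} {f' : SeqL2 (KL2 K)}
    (h : vecWeight f' f' = vecWeight f f) : rankOneMap s f' T = rankOneMap s f T := by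
  rw [rankOneMap, h]
  rfl

theorem ne_zero_of_vecWeight_eq {f' : SeqL2 (KL2 K)} (h : vecWeight f' f' = vecWeight f f)
    (hf : f ≠ 0) : f' ≠ 0 := by
  rintro rfl
  have h2 := vecWeight_oneSubLam f f
  rw [← h, vecWeight_oneSubLam, inner_zero_left, eq_comm, inner_self_eq_zero] at h2
  exact hf h2

/-- `T₁ - C C*` and `T₂ - C* C` kill the norming vectors of `C`, and the two bounded differences
combine to make them bounded on `D_t f` and `D_t g`. Purity forces both to be zero. -/
theorem partialIsometry_of_isQPure (hT₁ : IsStarProjection T₁) (hT₂ : IsStarProjection T₂)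
    (hω : IsQWeightMap (rankOneMap 1 f T₁)) (hη : IsQWeightMap (rankOneMap 1 g T₂))
    (hωp : IsQPure (rankOneMap 1 f T₁)) (hηp : IsQPure (rankOneMap 1 g T₂))
    (hf : f ≠ 0) (hg : g ≠ 0) (hC : ‖C‖ = 1) (h1 : T₁ * C = C) (h2 : C * T₂ = C) {w : ℂ}
    (hw : w ≠ 0) {r : ℝ} (hr : ∀ t (ht : 0 < t),
        ‖seqRatio t ht (hat T₂ g - w • hat (star C) f)‖ ≤ r ∧
        ‖seqRatio t ht (w • hat T₁ f - hat C g)‖ ≤ r) :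
    C * star C = T₁ ∧ star C * C = T₂ := by
  obtain ⟨u, v, hu, hv, hu1, hv1, huv, hvu⟩ := CornerData.exists_unit_vectors hC h1 h2 hT₂
  have hu0 : u ≠ 0 := by rintro rfl; simp at hu1
  have hv0 : v ≠ 0 := by rintro rfl; simp at hv1
  have hC₁ : star C * T₁ = star C := by
    have := congrArg star h1
    rwa [star_mul, hT₁.isSelfAdjoint.star_eq] at this
  have hC₂ : T₂ * star C = star C := by
    have := congrArg star h2
    rwa [star_mul, hT₂.isSelfAdjoint.star_eq] at this
  have hn : ∀ X : SeqL2 (KL2 K), ‖hat C X‖ ≤ ‖X‖ := fun X => by simpa [hC] using hat_norm_le C X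
  have hn' : ∀ X : SeqL2 (KL2 K), ‖hat (star C) X‖ ≤ ‖X‖ := fun X => by
    simpa [hC] using hat_norm_le (star C) X
  constructor
  · refine (sub_eq_zero.1 (hωp.eq_zero_of_bounded hω hT₁ hf (D := T₁ - C * star C) (x := u)
      (R := ‖w‖⁻¹ * (r + r)) ?_ ?_ hu hu0 ?_ fun t ht => ?_)).symm
    · rw [star_sub, star_mul, star_star, hT₁.isSelfAdjoint.star_eq]
    · rw [mul_sub, hT₁.isIdempotentElem.eq, ← mul_assoc, h1]
    · change T₁ u - C (star C u) = 0
      rw [hu, ← hvu, ← huv, sub_self]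
    · have e1 : hat (T₁ - C * star C) (seqRatio t ht f) = w⁻¹ •
          (seqRatio t ht (w • hat T₁ f - hat C g)
            + hat C (seqRatio t ht (hat T₂ g - w • hat (star C) f))) := by
        rw [hat_seqRatio, hat_seqRatio, ← map_add, ← map_smul, map_sub (hat C), ← hat_mul_apply C T₂, h2,
          map_smul (hat C), ← hat_mul_apply, hat_sub_apply, sub_add_sub_cancel, ← smul_sub,
          inv_smul_smul₀ hw]
      rw [e1, norm_smul, norm_inv]
      gcongr
      exact (norm_add_le _ _).trans (add_le_add (hr t ht).2 ((hn _).trans (hr t ht).1))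
  · refine (sub_eq_zero.1 (hηp.eq_zero_of_bounded hη hT₂ hg (D := T₂ - star C * C) (x := v)
      (R := r + r) ?_ ?_ hv hv0 ?_ fun t ht => ?_)).symm
    · rw [star_sub, star_mul, star_star, hT₂.isSelfAdjoint.star_eq]
    · rw [mul_sub, hT₂.isIdempotentElem.eq, ← mul_assoc, hC₂]
    · change T₂ v - star C (C v) = 0
      rw [hv, ← huv, ← hvu, sub_self]
    · have e1 : hat (T₂ - star C * C) (seqRatio t ht g) =
          seqRatio t ht (hat T₂ g - w • hat (star C) f)
            + hat (star C) (seqRatio t ht (w • hat T₁ f - hat C g)) := by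
        rw [hat_seqRatio, hat_seqRatio, ← map_add, map_sub, map_smul, ← hat_mul_apply,
          ← hat_mul_apply, hC₁, hat_sub_apply, sub_add_sub_cancel]
      rw [e1]
      exact (norm_add_le _ _).trans (add_le_add (hr t ht).1 ((hn' _).trans (hr t ht).2))

/-- `V` is isometric on the range of `T`, and in finite dimensions an isometry of a subspace into
the whole space extends to a unitary. -/
theorem exists_unitary_extending {V T : Op K} (hT : IsStarProjection T) (hV : star V * V = T)
    (hVT : V * T = V) : ∃ U ∈ unitary (Op K), U * T = V := by
  have hnorm : ∀ v : K, T v = v → ‖V v‖ = ‖v‖ := by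
    intro v hv
    have h1 : ⟪V v, V v⟫_ℂ = ⟪v, v⟫_ℂ := by
      have h2 : star V (V v) = v := (congrArg (fun S : Op K => S v) hV).trans hv
      rw [← inner_star_left, h2]
    rw [inner_self_eq_ofReal, inner_self_eq_ofReal] at h1
    exact (sq_eq_sq₀ (norm_nonneg _) (norm_nonneg _)).1 (Complex.ofReal_injective h1)
  set S : Submodule ℂ K := LinearMap.range T.toLinearMap with hS
  have hmem : ∀ v ∈ S, T v = v := by
    rintro _ ⟨v, rfl⟩
    exact hT.apply_apply v
  let L : S →ₗᵢ[ℂ] K :=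
    ⟨V.toLinearMap ∘ₗ S.subtype, fun v => hnorm v (hmem v v.2)⟩
  set U : Op K := L.extend.toContinuousLinearMap with hU
  have hU1 : star U * U = 1 := by
    refine ContinuousLinearMap.ext fun v => ext_inner_left ℂ fun w => ?_
    change ⟪w, star U (U v)⟫_ℂ = ⟪w, v⟫_ℂ
    rw [← inner_star_left, star_star]
    exact L.extend.inner_map_map w v
  have hU2 : U * star U = 1 := by
    have h1 : (star U).toLinearMap * U.toLinearMap = 1 :=
      congrArg ContinuousLinearMap.toLinearMap hU1
    have h2 := mul_eq_one_comm.1 h1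
    exact ContinuousLinearMap.ext fun v => congrArg (fun Z : K →ₗ[ℂ] K => Z v) h2
  refine ⟨U, Unitary.mem_iff.2 ⟨hU1, hU2⟩, ContinuousLinearMap.ext fun v => ?_⟩
  have h3 : L.extend (⟨T v, v, rfl⟩ : S) = L ⟨T v, v, rfl⟩ := L.extend_apply _
  exact h3.trans (congrArg (fun Z : Op K => Z v) hVT)

/-- Contractivity bounds `‖D_t f‖²` by `1 + ‖T D_t f‖²`, so the part of `f` outside `T` contributes
at most `1`. This lets `g - z U f` be controlled without the projections. -/
theorem norm_seqRatio_compl_le {T : Op K} (hω : IsQWeightMap (rankOneMap 1 f T))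
    (hT : IsStarProjection T) (hT0 : T ≠ 0) (t : ℝ) (ht : 0 < t) :
    ‖seqRatio t ht (hat (1 - T) f)‖ ≤ 1 := by
  have h1 := norm_seqInvRoot_le hω hT hT0 t ht
  have h2 := seqRatio_le_seqInvRoot t ht f
  have h3 := hT.hat_norm_sq (seqRatio t ht f)
  rw [hat_seqRatio (1 - T)] at h3
  exact (sq_le_one_iff₀ (norm_nonneg _)).1 (by linarith)

theorem exists_unitary_of_isQCorner (hT₁ : IsStarProjection T₁) (hT₂ : IsStarProjection T₂)
    (hω : IsQWeightMap (rankOneMap 1 f T₁)) (hη : IsQWeightMap (rankOneMap 1 g T₂))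
    (hωp : IsQPure (rankOneMap 1 f T₁)) (hηp : IsQPure (rankOneMap 1 g T₂))
    (horth : CompletelyOrthogonal E₁ E₂ (rankOneMap 1 f T₁) (rankOneMap 1 g T₂))
    (hT₁0 : T₁ ≠ 0) (hT₂0 : T₂ ≠ 0) (hf : f ≠ 0) (hg : g ≠ 0) {γ : WeightMap K}
    (hγ : IsQCorner E₁ E₂ (rankOneMap 1 f T₁) (rankOneMap 1 g T₂) γ) (hγ0 : γ ≠ 0)
    (hγr : rangeRank γ = 1) :
    ∃ U ∈ unitary (Op K), ∃ z : ℝ, 0 < z ∧ U * T₁ * star U = T₂ ∧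
      ∃ f' g' u : SeqL2 (KL2 K), vecWeight f' f' = vecWeight f f ∧
        vecWeight g' g' = vecWeight g g ∧ g' = (z : ℂ) • hat U f' + amp (rootD K) u := by
  obtain ⟨hm₁, hs₁⟩ := supp_rankOneMap horth.proj₁ hT₁0 hf horth.supp₁
  obtain ⟨hm₂, hs₂⟩ := supp_rankOneMap horth.proj₂ hT₂0 hg horth.supp₂
  obtain ⟨C, x, y, hC, rfl, hEC, hx, hy, hτ⟩ :=
    exists_corner_form horth.proj₁ horth.proj₂ hγ.boundary hγ.supp hγ0 hγr
  have hC0 : C ≠ 0 := by rintro rfl; simp at hC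
  have hd : CornerData E₁ E₂ T₁ T₂ C f g x y :=
    ⟨horth.proj₁, horth.proj₂, horth.orth, hT₁, hT₂, hm₁, hm₂, hEC, hs₁, hs₂, hx, hy⟩
  have hq : IsQWeightMap (cornerMap T₁ T₂ C f g x y) := hγ.qweight
  obtain ⟨h1, h2⟩ := hd.range_mul hq hC0 hτ
  obtain ⟨f', g', w, r, hf', hg', hw, hr⟩ := exists_bounded_differences hd hq hC hτ
  rw [← rankOneMap_congr hf'] at hω hωp
  rw [← rankOneMap_congr hg'] at hη hηp
  obtain ⟨hC₁, hC₂⟩ := partialIsometry_of_isQPure hT₁ hT₂ hω hη hωp hηp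
    (ne_zero_of_vecWeight_eq hf' hf) (ne_zero_of_vecWeight_eq hg' hg) hC h1 h2 hw hr
  have hw0 : (‖w‖ : ℂ) ≠ 0 := by simpa using hw
  -- The phase of `w` is absorbed into the unitary, so that `z = ‖w‖` is positive.
  set θ : ℂ := w / ‖w‖ with hθ
  have hθ1 : (starRingEnd ℂ) θ * θ = 1 := by
    rw [mul_comm, Complex.mul_conj, Complex.normSq_eq_norm_sq, hθ, norm_div, Complex.norm_real,
      norm_norm, div_self (by simpa using hw)]
    simp
  have hzθ : (‖w‖ : ℂ) * θ = w := by rw [hθ, mul_div_cancel₀ _ hw0]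
  have hsV : star (θ • star C) = (starRingEnd ℂ) θ • C := by rw [star_smul, star_star]; rfl
  obtain ⟨U, hU, hUT⟩ := exists_unitary_extending (V := θ • star C) hT₁
    (by rw [hsV, smul_mul_smul_comm, hθ1, hC₁, one_smul])
    (by
      rw [smul_mul_assoc]
      have := congrArg star h1
      rw [star_mul, hT₁.isSelfAdjoint.star_eq] at this
      rw [this])
  refine ⟨U, hU, ‖w‖, norm_pos_iff.2 hw, ?_, ?_⟩
  · have e1 : T₁ * star U = (starRingEnd ℂ) θ • C := by
      rw [← hsV, ← hUT, star_mul, hT₁.isSelfAdjoint.star_eq]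
    rw [← hT₁.isIdempotentElem.eq, ← mul_assoc, mul_assoc, e1, hUT, smul_mul_smul_comm, mul_comm θ,
      hθ1, hC₂, one_smul]
  -- Each of the three terms has bounded `D_t`-image, so `exists_rootD_eq` puts the difference in
  -- the range of `(I - Λ)^{1/2}`.
  have hsplit : g' - (‖w‖ : ℂ) • hat U f' = (hat T₂ g' - w • hat (star C) f') + hat (1 - T₂) g'
      - (‖w‖ : ℂ) • hat U (hat (1 - T₁) f') := by
    have e2 : hat U (hat (1 - T₁) f') = hat U f' - θ • hat (star C) f' := by
      rw [← hat_mul_apply, mul_sub, mul_one, hUT, hat_sub_apply, hat_smul_apply]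
    rw [e2, smul_sub, smul_smul, hzθ, hat_sub_apply, hat_one_apply]
    abel
  obtain ⟨u, hu⟩ := exists_rootD_eq (p := g' - (‖w‖ : ℂ) • hat U f')
    (R := (r + 1 + ‖w‖ * (‖U‖ * 1)) ^ 2) fun n => by
    gcongr
    rw [hsplit, map_sub, map_add, map_smul, ← hat_seqRatio U]
    refine (norm_sub_le _ _).trans (add_le_add ((norm_add_le _ _).trans (add_le_add
      (hr _ (cut_pos n)).1 (norm_seqRatio_compl_le hη hT₂ hT₂0 _ _))) ?_)
    rw [norm_smul, Complex.norm_real, norm_norm]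
    gcongr
    refine (hat_norm_le U _).trans ?_
    gcongr
    exact norm_seqRatio_compl_le hω hT₁ hT₁0 _ _
  exact ⟨f', g', u, hf', hg', by rw [← hu, add_sub_cancel]⟩

end Necessity

end QWeight

namespace QWeight

/-! ### Passage to sequences and the final equivalence -/

section Equivalence

variable {K : Type*} [NormedAddCommGroup K] [InnerProductSpace ℂ K] [FiniteDimensional ℂ K]
  [CompleteSpace K] {ω η : WeightMap K} {E₁ E₂ T₁ T₂ : Op K} {μ ν : Module.Dual ℂ (BdryAlg K)}

theorem exists_rankOneMap_form (hω : IsQWeightMap ω) (hr : rangeRank ω = 1)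
    (hT : IsStarProjection T₁) (hT0 : T₁ ≠ 0) (hμ : IsBoundaryWeight μ)
    (h : ∀ ρ A, ω ρ A = ρ T₁ * μ A) : ∃ f : SeqL2 (KL2 K), f ≠ 0 ∧ μ = vecWeight f f ∧
      ω = rankOneMap 1 f T₁ := by
  obtain ⟨f, hf⟩ := exists_vecWeight_self hω h hμ hT hT0
  refine ⟨f, ?_, hf, eq_rankOneMap h hf⟩
  rintro rfl
  have h0 : dualize ω = 0 := LinearMap.ext fun A => op_ext_dual fun ρ => by
    rw [dualize_spec, h, hf, vecWeight_zero_left]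
    simp
  rw [rangeRank, h0, LinearMap.range_zero, finrank_bot] at hr
  exact zero_ne_one hr

theorem represents_coe_iff {f f' : SeqL2 (KL2 K)} :
    Represents (f' : ℕ → KL2 K) (vecWeight f f) ↔ vecWeight f' f' = vecWeight f f := by
  rw [represents_iff]
  constructor
  · rintro ⟨F, hF, h⟩
    rw [h, lp.ext hF]
  · exact fun h => ⟨f', rfl, h.symm⟩

theorem smul_hat_add_apply (z : ℂ) (U : Op K) (f u : SeqL2 (KL2 K)) (k : ℕ) :
    (z • hat U f + amp (rootD K) u) k = z • ampl U (f k) + rootD K (u k) := by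
  rw [lp.coeFn_add, Pi.add_apply, lp.coeFn_smul, Pi.smul_apply, hat, amp_apply, amp_apply]

theorem exists_qCorner_iff (hω : IsQWeightMap ω) (hη : IsQWeightMap η)
    (hωpure : IsQPure ω) (hηpure : IsQPure η)
    (hωrank : rangeRank ω = 1) (hηrank : rangeRank η = 1)
    (horth : CompletelyOrthogonal E₁ E₂ ω η)
    (hT₁ : IsStarProjection T₁) (hT₂ : IsStarProjection T₂)
    (hT₁0 : T₁ ≠ 0) (hT₂0 : T₂ ≠ 0) (hμ : IsBoundaryWeight μ) (hν : IsBoundaryWeight ν)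
    (hωform : ∀ ρ A, ω ρ A = ρ T₁ * μ A) (hηform : ∀ ρ A, η ρ A = ρ T₂ * ν A) :
    (∃ γ : WeightMap K, IsQCorner E₁ E₂ ω η γ ∧ γ ≠ 0 ∧ rangeRank γ = 1) ↔
      ∃ U ∈ unitary (Op K), ∃ z : ℝ, 0 < z ∧ U * T₁ * star U = T₂ ∧
        ∃ f g h u : ℕ → KL2 K, Represents f μ ∧ Represents g ν ∧
          (∀ k, g k = (z : ℂ) • ampl U (f k) + h k) ∧
          (∀ k, h k = rootD K (u k)) ∧ Summable (fun k => ‖u k‖ ^ 2) := by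
  obtain ⟨f₀, hf₀, rfl, rfl⟩ := exists_rankOneMap_form hω hωrank hT₁ hT₁0 hμ hωform
  obtain ⟨g₀, hg₀, rfl, rfl⟩ := exists_rankOneMap_form hη hηrank hT₂ hT₂0 hν hηform
  constructor
  · rintro ⟨γ, hγ, hγ0, hγr⟩
    obtain ⟨U, hU, z, hz, hUT, f, g, u, hf, hg, hgu⟩ := exists_unitary_of_isQCorner hT₁ hT₂ hω hη
      hωpure hηpure horth hT₁0 hT₂0 hf₀ hg₀ hγ hγ0 hγr
    refine ⟨U, hU, z, hz, hUT, f, g, fun k => rootD K (u k), u, represents_coe_iff.2 hf,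
      represents_coe_iff.2 hg, fun k => ?_, fun k => rfl, u.summable_sq⟩
    rw [hgu, smul_hat_add_apply]
  · rintro ⟨U, hU, z, hz, hUT, f, g, h, u, hf, hg, hgh, hh, hu⟩
    obtain ⟨f, rfl, hf₁⟩ := represents_iff.1 hf
    obtain ⟨g, rfl, hg₁⟩ := represents_iff.1 hg
    have hf' : rankOneMap 1 f T₁ = rankOneMap 1 f₀ T₁ := rankOneMap_congr hf₁.symm
    have hg' : rankOneMap 1 g T₂ = rankOneMap 1 g₀ T₂ := rankOneMap_congr hg₁.symm
    rw [← hf', ← hg'] at horth ⊢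
    rw [← hf'] at hω
    rw [← hg'] at hη
    refine exists_qCorner_of_unitary hω hη horth hT₁ hT₂ hT₁0 hT₂0
      (ne_zero_of_vecWeight_eq hf₁.symm hf₀) (ne_zero_of_vecWeight_eq hg₁.symm hg₀) hU hUT hz
      (u := ⟨u, memlp_two_iff.2 hu⟩) (lp.ext (funext fun k => ?_))
    rw [hgh, hh, smul_hat_add_apply]

/-- Representing sequences inherit the support of the map. -/
theorem ampl_eq_of_supp {f : ℕ → KL2 K} (hr : rangeRank ω = 1) (hT : IsStarProjection T₁)
    (hT0 : T₁ ≠ 0) (h : ∀ ρ A, ω ρ A = ρ T₁ * μ A)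
    (hs : ∀ ρ A, ω ρ A = ω (psi T₁ T₁ ρ) (compress T₁ T₁ A)) (hf : Represents f μ) (k : ℕ) :
    ampl T₁ (f k) = f k := by
  obtain ⟨F, rfl, rfl⟩ := represents_iff.1 hf
  obtain rfl := eq_rankOneMap h rfl
  have hF : F ≠ 0 := by
    rintro rfl
    have h0 : dualize (rankOneMap 1 0 T₁ : WeightMap K) = 0 :=
      LinearMap.ext fun A => op_ext_dual fun ρ => by
        rw [dualize_spec, h, vecWeight_zero_left]
        simp
    rw [rangeRank, h0, LinearMap.range_zero, finrank_bot] at hr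
    exact zero_ne_one hr
  have h1 := (supp_rankOneMap hT hT0 hF hs).2
  have h2 := congrArg (fun G : SeqL2 (KL2 K) => G k) h1
  simpa [hat] using h2

end Equivalence

end QWeight

theorem mainTheorem3 {K : Type*} [NormedAddCommGroup K] [InnerProductSpace ℂ K]
    [FiniteDimensional ℂ K] [CompleteSpace K]
    (ω η : WeightMap K) (hω : IsQWeightMap ω) (hη : IsQWeightMap η)
    (hωpure : IsQPure ω) (hηpure : IsQPure η)
    (hωrank : rangeRank ω = 1) (hηrank : rangeRank η = 1)
    (E₁ E₂ : Op K) (horth : CompletelyOrthogonal E₁ E₂ ω η)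
    (T₁ T₂ : Op K) (hT₁ : IsStarProjection T₁) (hT₂ : IsStarProjection T₂)
    (hT₁0 : T₁ ≠ 0) (hT₂0 : T₂ ≠ 0)
    (μ ν : Module.Dual ℂ (BdryAlg K)) (hμ : IsBoundaryWeight μ) (hν : IsBoundaryWeight ν)
    (hωform : ∀ ρ A, ω ρ A = ρ T₁ * μ A) (hηform : ∀ ρ A, η ρ A = ρ T₂ * ν A) :
    ((∃ γ : WeightMap K, IsQCorner E₁ E₂ ω η γ ∧ γ ≠ 0 ∧ rangeRank γ = 1) ↔
      ∃ U ∈ unitary (Op K), ∃ z : ℝ, 0 < z ∧ U * T₁ * star U = T₂ ∧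
        ∃ f g h u : ℕ → KL2 K, Represents f μ ∧ Represents g ν ∧
          (∀ k, g k = (z : ℂ) • ampl U (f k) + h k) ∧
          (∀ k, h k = rootD K (u k)) ∧ Summable (fun k => ‖u k‖ ^ 2)) ∧
    (CompletelyOrthogonal T₁ T₂ ω η →
      ((∃ γ : WeightMap K, IsQCorner E₁ E₂ ω η γ ∧ γ ≠ 0 ∧ rangeRank γ = 1) ↔
        ∃ U ∈ unitary (Op K), ∃ z : ℝ, 0 < z ∧ U * T₁ * star U = T₂ ∧
          ∃ f g h u : ℕ → KL2 K, Represents f μ ∧ Represents g ν ∧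
            (∀ k, g k = (z : ℂ) • ampl U (f k) + h k) ∧
            (∀ k, f k ∈ LinearMap.range (ampl T₁).toLinearMap) ∧
            (∀ k, h k ∈ LinearMap.range (rootD K * ampl T₂).toLinearMap) ∧
            (∀ k, h k = rootD K (u k)) ∧ Summable (fun k => ‖u k‖ ^ 2))) := by
  refine ⟨exists_qCorner_iff hω hη hωpure hηpure hωrank hηrank horth hT₁ hT₂ hT₁0 hT₂0 hμ hν hωform
    hηform, fun horth' => ?_⟩
  rw [exists_qCorner_iff hω hη hωpure hηpure hωrank hηrank horth hT₁ hT₂ hT₁0 hT₂0 hμ hν hωform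
    hηform]
  constructor
  · rintro ⟨U, hU, z, hz, hUT, f, g, h, u, hf, hg, hgh, hh, hu⟩
    -- In part (b) the extra requirements are automatic: complete orthogonality with respect to
    -- `T₁`, `T₂` puts every representing sequence in the corresponding range.
    have hTf := ampl_eq_of_supp hωrank hT₁ hT₁0 hωform horth'.supp₁ hf
    have hTg := ampl_eq_of_supp hηrank hT₂ hT₂0 hηform horth'.supp₂ hg
    -- Since `U` intertwines `T₁` and `T₂`, each `h k = g k - z U (f k)` is fixed by `T₂`. As `T₂ ⊗
    -- I` commutes with `(I - Λ)^{1/2}`, the witness `u k` also shows the stronger range condition.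
    have hTU : T₂ * U = U * T₁ := by
      rw [← hUT, mul_assoc, (Unitary.mem_iff.1 hU).1, mul_one]
    have hTUf : ∀ k, ampl T₂ (ampl U (f k)) = ampl U (f k) := fun k => by
      have h1 : ampl T₂ * ampl U = ampl U * ampl T₁ := by rw [← ampl_mul, hTU, ampl_mul]
      exact (congrArg (fun S : Op (KL2 K) => S (f k)) h1).trans (congrArg (ampl U) (hTf k))
    have hTh : ∀ k, ampl T₂ (h k) = h k := fun k => by
      have h1 : h k = g k - (z : ℂ) • ampl U (f k) := by rw [hgh, add_sub_cancel_left]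
      rw [h1, map_sub, map_smul, hTg, hTUf]
    refine ⟨U, hU, z, hz, hUT, f, g, h, u, hf, hg, hgh, fun k => ⟨f k, hTf k⟩,
      fun k => ⟨u k, ?_⟩, hh, hu⟩
    have h2 := congrArg (fun S : Op (KL2 K) => S (u k)) (ampl_mul_rootD T₂)
    refine h2.symm.trans ((congrArg (ampl T₂) (hh k)).symm.trans (hTh k))
  · rintro ⟨U, hU, z, hz, hUT, f, g, h, u, hf, hg, hgh, -, -, hh, hu⟩
    exact ⟨U, hU, z, hz, hUT, f, g, h, u, hf, hg, hgh, hh, hu⟩
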